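/- Let $U\subset\mathbb C$ be a non-empty connected open set, and let $h$ be a Gaussian free field (GFF) on $U$, i.e. either a zero-boundary GFF on $U$ (where $U$ has harmonically non-trivial boundary), or the restriction to $U$ of a whole-plane GFF whose additive constant is fixed so that its average over some circle is zero. Here, with $(f,g)_\nabla=\frac1{2\pi}\int\nabla f\cdot\nabla g$, the zero-boundary GFF is the random distribution such that $(h,\phi)=-2\pi(h,\Delta^{-1}\phi)_\nabla$ for $\phi\in C_c^\infty(U)$, where $\{(h,f)_\nabla\}$ is centered Gaussian with covariances $\mathbb E[(h,f)_\nabla(h,g)_\nabla]=(f,g)_\nabla$, indexed by the completion of $C_c^\infty(U)$ with respect to $(\cdot,\cdot)_\nabla$. The whole-plane GFF is defined in the same way modulo additive constant, using test functions on $\mathbb C$ with integral zero. A continuous length metric on $U$ is a finite metric $D$ on $U$ which induces the Euclidean topology and is such that, for all $x,y\in U$ and $\varepsilon>0$, there is a curve in $U$ from $x$ to $y$ of $D$-length at most $D(x,y)+\varepsilon$. For open $V\subset U$, $D(x,y;V)\in[0,\infty]$ denotes the infimum of the $D$-lengths of the curves in $V$ from $x$ to $y$. The restriction $h|_V$ is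 the collection of pairings $(h,\phi)$ with $\phi\in C_c^\infty(V)$, and for $K$ closed in $U$ the $\sigma$-algebra generated by $h|_K$ is $\bigcap_{\varepsilon>0}\sigma(h|_{B_\varepsilon(K)\cap U})$, where $B_\varepsilon(K)$ is the Euclidean $\varepsilon$-neighbourhood of $K$. Let $(h,D)$ be a coupling of $h$ with a random continuous length metric $D$ on $U$ which is a local metric for $h$: for every open $V\subset U$, the internal metric $D(\cdot,\cdot;V)$ is conditionally independent from the pair $(h|_{U\setminus V},D(\cdot,\cdot;U\setminus\overline V))$ given $h|_V$. Let $D,\widetilde D$ be conditionally i.i.d. samples from the conditional law of $D$ given $h$, and suppose that there is a random constant $C=C_h>1$, depending only on $h$ (i.e. a measurable function of $h$), such that a.s. $\widetilde D(z,w)\le C_h\,D(z,w)$ for all $z,w\in U$. Then $D$ is a.s. determined by $h$, i.e. there is a measurable function $F$ such that $D=F(h)$ a.s.; in particular, a.s. $\widetilde D(z,w)\le D(z,w)$ for all $z,w\in U$, so that one can take $C=1$. -/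

import Mathlib

open MeasureTheory ProbabilityTheory TopologicalSpace UniformSpace
open scoped ENNReal Distributions unitInterval

noncomputable section

namespace LocalMetrics

/-! ### Metrics on a topological space -/

section Metric

variable {X : Type*} [TopologicalSpace X]

/-- The `d`-length of a curve `γ : [0, 1] → X`: the supremum over all partitions
`0 = t₀ < ⋯ < tₙ = 1` of `∑ d (γ tᵢ₋₁) (γ tᵢ)`. It may be infinite. -/
def curveLength (d : X → X → ℝ) {x y : X} (γ : Path x y) : ℝ≥0∞ :=
  ⨆ (n : ℕ) (t : Fin (n + 1) → I) (_ : StrictMono t ∧ t 0 = 0 ∧ t (Fin.last n) = 1),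
    ∑ i : Fin n, ENNReal.ofReal (d (γ (t i.castSucc)) (γ (t i.succ)))

/-- `d` is a (finite) metric on the set `X` which induces the given topology of `X`:
the open `d`-balls around each point form a basis of neighbourhoods of that point. -/
structure IsContinuousMetric (d : X → X → ℝ) : Prop where
  dist_self : ∀ x, d x x = 0
  eq_of_dist_eq_zero : ∀ x y, d x y = 0 → x = y
  symm : ∀ x y, d x y = d y x
  triangle : ∀ x y z, d x z ≤ d x y + d y z
  nhds_basis : ∀ x, (nhds x).HasBasis (fun r : ℝ => 0 < r) (fun r => {y | d x y < r})

/-- A continuous metric which is a length metric: any two points `x`, `y` are joined, for each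
`ε > 0`, by a curve of `d`-length at most `d x y + ε`. -/
structure IsContinuousLengthMetric (d : X → X → ℝ) : Prop extends IsContinuousMetric d where
  exists_curve : ∀ x y, ∀ ε : ℝ, 0 < ε →
    ∃ γ : Path x y, curveLength d γ ≤ ENNReal.ofReal (d x y + ε)

end Metric

/-- The internal metric `d(x, y; W)`, for `W ⊆ U`: the infimum of the `d`-lengths of the
curves from `x` to `y` which stay in `W` (infinite if there is none, in particular if
`x ∉ W` or `y ∉ W`). -/
def internalMetric {U : Opens ℂ} (d : U → U → ℝ) (W : Set ℂ) (x y : U) : ℝ≥0∞ :=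
  ⨅ (γ : Path x y) (_ : ∀ t, (γ t : ℂ) ∈ W), curveLength d γ

/-! ### The Dirichlet inner product and the Gaussian free field -/

/-- The Dirichlet inner product `(φ, ψ)_∇ = (1 / 2π) ∫ ∇φ · ∇ψ`. -/
def dirichletInner {U : Opens ℂ} (φ ψ : 𝓓(U, ℝ)) : ℝ :=
  1 / (2 * Real.pi) * ∫ z, inner ℝ (gradient φ z) (gradient ψ z)

/-- The space of smooth compactly supported functions on `U`, to be equipped with the Dirichlet
inner product. -/
def DirichletTestSpace (U : Opens ℂ) : Type := 𝓓(U, ℝ)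

instance (U : Opens ℂ) : AddCommGroup (DirichletTestSpace U) :=
  inferInstanceAs (AddCommGroup 𝓓(U, ℝ))

instance (U : Opens ℂ) : Module ℝ (DirichletTestSpace U) :=
  inferInstanceAs (Module ℝ 𝓓(U, ℝ))

/-- A test function, as an element of the Dirichlet space. -/
def toDirichlet {U : Opens ℂ} (φ : 𝓓(U, ℝ)) : DirichletTestSpace U := φ

/-- An element of the Dirichlet space of test functions, as a test function. -/
def ofDirichlet {U : Opens ℂ} (φ : DirichletTestSpace U) : 𝓓(U, ℝ) := φ

theorem differentiable_test {U : Opens ℂ} (φ : 𝓓(U, ℝ)) : Differentiable ℝ φ :=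
  φ.contDiff.differentiable (by simp)

theorem continuous_gradient {U : Opens ℂ} (φ : 𝓓(U, ℝ)) : Continuous (gradient φ) := by
  have h : Continuous (fderiv ℝ φ) := φ.contDiff.continuous_fderiv (by simp)
  exact (InnerProductSpace.toDual ℝ ℂ).symm.continuous.comp h

theorem hasCompactSupport_gradient {U : Opens ℂ} (φ : 𝓓(U, ℝ)) :
    HasCompactSupport (gradient φ) :=
  (φ.hasCompactSupport.fderiv ℝ).comp_left (map_zero (InnerProductSpace.toDual ℝ ℂ).symm)

theorem gradient_add' {U : Opens ℂ} (φ ψ : 𝓓(U, ℝ)) (z : ℂ) :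
    gradient (φ + ψ : 𝓓(U, ℝ)) z = gradient φ z + gradient ψ z := by
  have h : ((φ + ψ : 𝓓(U, ℝ)) : ℂ → ℝ) = (φ : ℂ → ℝ) + ψ := rfl
  rw [gradient, h, fderiv_add (differentiable_test φ z) (differentiable_test ψ z), map_add]
  rfl

theorem gradient_smul' {U : Opens ℂ} (c : ℝ) (φ : 𝓓(U, ℝ)) (z : ℂ) :
    gradient (c • φ : 𝓓(U, ℝ)) z = c • gradient φ z := by
  have h : ((c • φ : 𝓓(U, ℝ)) : ℂ → ℝ) = c • (φ : ℂ → ℝ) := rfl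
  rw [gradient, h, fderiv_const_smul (differentiable_test φ z), map_smul]
  rfl

theorem integrable_inner_gradient {U : Opens ℂ} (φ ψ : 𝓓(U, ℝ)) :
    Integrable fun z => (inner ℝ (gradient φ z) (gradient ψ z) : ℝ) := by
  refine ((continuous_gradient φ).inner (continuous_gradient ψ)).integrable_of_hasCompactSupport ?_
  refine (hasCompactSupport_gradient φ).mono ?_
  intro z hz hz0
  apply hz
  simp only at hz0 ⊢
  rw [hz0, inner_zero_left]

/-- The Dirichlet inner product is a symmetric, positive semi-definite bilinear form. -/
abbrev dirichletCore (U : Opens ℂ) : PreInnerProductSpace.Core ℝ (DirichletTestSpace U) where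
  inner φ ψ := dirichletInner (ofDirichlet φ) (ofDirichlet ψ)
  conj_inner_symm φ ψ := by
    simp only [dirichletInner, conj_trivial]
    congr 2
    ext z
    rw [real_inner_comm]
  re_inner_nonneg φ := by
    simp only [dirichletInner, RCLike.re_to_real]
    exact mul_nonneg (by positivity) (integral_nonneg fun z => real_inner_self_nonneg)
  add_left φ ψ χ := by
    have h : ofDirichlet (φ + ψ) = ofDirichlet φ + ofDirichlet ψ := rfl
    simp only [dirichletInner, h, gradient_add', inner_add_left]
    rw [integral_add (integrable_inner_gradient _ _) (integrable_inner_gradient _ _), mul_add]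
  smul_left φ ψ c := by
    have h : ofDirichlet (c • φ) = c • ofDirichlet φ := rfl
    simp only [dirichletInner, h, gradient_smul', real_inner_smul_left, conj_trivial]
    rw [integral_const_mul]
    ring

instance (U : Opens ℂ) : SeminormedAddCommGroup (DirichletTestSpace U) :=
  @InnerProductSpace.Core.toSeminormedAddCommGroup ℝ _ _ _ _ (dirichletCore U)

instance (U : Opens ℂ) : InnerProductSpace ℝ (DirichletTestSpace U) :=
  InnerProductSpace.ofCore (dirichletCore U)

/-- The Hilbert space `H(U)`: the completion of the space of smooth compactly supported functions
on `U` with respect to the Dirichlet inner product. -/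
abbrev DirichletHilbert (U : Opens ℂ) : Type := Completion (DirichletTestSpace U)

theorem integrable_test {U : Opens ℂ} (φ : 𝓓(U, ℝ)) : Integrable φ :=
  φ.continuous.integrable_of_hasCompactSupport φ.hasCompactSupport

/-- The smooth compactly supported functions on `ℂ` with vanishing integral. -/
def meanZeroTestSpace : Submodule ℝ (DirichletTestSpace ⊤) where
  carrier := {φ | ∫ z, ofDirichlet φ z = 0}
  add_mem' {φ ψ} hφ hψ := by
    have h : ∀ z, ofDirichlet (φ + ψ) z = ofDirichlet φ z + ofDirichlet ψ z := fun _ => rfl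
    simp only [Set.mem_ofPred_eq] at hφ hψ ⊢
    simp only [h]
    rw [integral_add (integrable_test _) (integrable_test _), hφ, hψ, add_zero]
  zero_mem' := by
    have h : ∀ z, ofDirichlet (0 : DirichletTestSpace ⊤) z = 0 := fun _ => rfl
    simp only [Set.mem_ofPred_eq, h, integral_zero]
  smul_mem' c φ hφ := by
    have h : ∀ z, ofDirichlet (c • φ) z = c * ofDirichlet φ z := fun _ => rfl
    simp only [Set.mem_ofPred_eq] at hφ ⊢
    simp only [h]
    rw [integral_const_mul, hφ, mul_zero]

/-- The Hilbert space `H(ℂ)`: the completion of the space of smooth compactly supported functions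
on `ℂ` with vanishing integral with respect to the Dirichlet inner product. -/
abbrev WholePlaneHilbert : Type := Completion meanZeroTestSpace

/-- `f ∈ H(U)` is the inverse Laplacian `Δ⁻¹φ` (zero boundary conditions) of `φ`, i.e. `Δf = φ`
weakly: `(f, ψ)_∇ = -(1 / 2π) ∫ φ ψ` for all test functions `ψ`. -/
def IsInvLaplacian {U : Opens ℂ} (φ : 𝓓(U, ℝ)) (f : DirichletHilbert U) : Prop :=
  ∀ ψ : 𝓓(U, ℝ), inner ℝ f ((toDirichlet ψ : DirichletTestSpace U) : DirichletHilbert U) =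
    -(1 / (2 * Real.pi)) * ∫ z, φ z * ψ z

/-- `f ∈ H(ℂ)` is the inverse Laplacian of the signed measure `φ dz - (∫ φ) σ` of total mass zero,
where `σ` is the uniform probability measure on the circle of radius `r` around `z₀`. -/
def IsInvLaplacianNormalized {U : Opens ℂ} (z₀ : ℂ) (r : ℝ) (φ : 𝓓(U, ℝ))
    (f : WholePlaneHilbert) : Prop :=
  ∀ ψ : meanZeroTestSpace, inner ℝ f (ψ : WholePlaneHilbert) =
    -(1 / (2 * Real.pi)) * ((∫ z, φ z * ofDirichlet (ψ : DirichletTestSpace ⊤) z) -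
      (∫ z, φ z) * Real.circleAverage (ofDirichlet (ψ : DirichletTestSpace ⊤)) z₀ r)

/-- The σ-algebra on the space of distributions on `U` which is generated by the pairings
`T ↦ (T, φ)` with test functions `φ`. -/
instance distributionMeasurableSpace (U : Opens ℂ) : MeasurableSpace 𝓓'(U, ℝ) :=
  ⨆ φ : 𝓓(U, ℝ), MeasurableSpace.comap (fun T : 𝓓'(U, ℝ) => T φ) inferInstance

section GFF

variable {Ω : Type*} [MeasurableSpace Ω] {U : Opens ℂ}

/-- `h` is a random distribution on `U` such that the pairings `(h, φ)` with test functions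
form a centered Gaussian process. -/
structure IsCenteredGaussianDistribution (P : Measure Ω) (h : Ω → 𝓓'(U, ℝ)) : Prop where
  measurable : Measurable h
  gaussian : IsGaussianProcess (fun (φ : 𝓓(U, ℝ)) (ω : Ω) => h ω φ) P
  centered : ∀ φ : 𝓓(U, ℝ), ∫ ω, h ω φ ∂P = 0

/-- `h` is a zero-boundary Gaussian free field on `U`: `(h, φ) = -2π (h, Δ⁻¹φ)_∇` for all test
functions `φ`, where `(h, f)_∇`, `f ∈ H(U)`, are jointly centered Gaussian with covariances
`E[(h, f)_∇ (h, g)_∇] = (f, g)_∇`. That `Δ⁻¹φ` exists in `H(U)` for every test function `φ` says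
that `U` has harmonically non-trivial boundary. -/
structure IsZeroBoundaryGFF (P : Measure Ω) (h : Ω → 𝓓'(U, ℝ)) : Prop
    extends IsCenteredGaussianDistribution P h where
  covariance : ∃ G : 𝓓(U, ℝ) → DirichletHilbert U, (∀ φ, IsInvLaplacian φ (G φ)) ∧
    ∀ φ ψ : 𝓓(U, ℝ), ∫ ω, h ω φ * h ω ψ ∂P = (2 * Real.pi) ^ 2 * inner ℝ (G φ) (G ψ)

/-- `h` is (the restriction to `U` of) a whole-plane Gaussian free field, with the additive
constant chosen so that its average `h_r(z₀)` over the circle of radius `r` around `z₀` is zero.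
That is, `h = h̃ - h̃_r(z₀)` with `h̃` a whole-plane field modulo additive constant, so that
`(h, φ) = (h̃, φ - (∫ φ) σ) = -2π (h̃, Δ⁻¹(φ - (∫ φ) σ))_∇`, with `σ` the uniform measure on
that circle and `(h̃, f)_∇`, `f ∈ H(ℂ)`, jointly centered Gaussian with covariances
`E[(h̃, f)_∇ (h̃, g)_∇] = (f, g)_∇`. -/
structure IsWholePlaneGFF (P : Measure Ω) (h : Ω → 𝓓'(U, ℝ)) (z₀ : ℂ) (r : ℝ) : Prop
    extends IsCenteredGaussianDistribution P h where
  covariance : ∃ G : 𝓓(U, ℝ) → WholePlaneHilbert,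
    (∀ φ, IsInvLaplacianNormalized z₀ r φ (G φ)) ∧
    ∀ φ ψ : 𝓓(U, ℝ), ∫ ω, h ω φ * h ω ψ ∂P = (2 * Real.pi) ^ 2 * inner ℝ (G φ) (G ψ)

/-- `h` is a Gaussian free field on `U`: either a zero-boundary field on `U`, or (the restriction
to `U` of) a whole-plane field, normalized to have average zero over some circle. -/
def IsGFF (P : Measure Ω) (h : Ω → 𝓓'(U, ℝ)) : Prop :=
  IsZeroBoundaryGFF P h ∨ ∃ (z₀ : ℂ) (r : ℝ), 0 < r ∧ IsWholePlaneGFF P h z₀ r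

end GFF

/-! ### σ-algebras and conditional independence -/

section Sigma

variable {Ω : Type*} {U : Opens ℂ}

/-- The σ-algebra generated by `h|_V`, for `V` open: it is generated by the pairings `(h, φ)`
with the test functions `φ` which are supported in `V`. -/
abbrev fieldSigma (h : Ω → 𝓓'(U, ℝ)) (V : Set ℂ) : MeasurableSpace Ω :=
  ⨆ (φ : 𝓓(U, ℝ)) (_ : tsupport φ ⊆ V),
    MeasurableSpace.comap (fun ω => h ω φ) inferInstance

/-- The σ-algebra generated by `h|_K`, for `K` closed in `U`: the intersection over `ε > 0` of the
σ-algebras generated by the restrictions of `h` to the `ε`-neighbourhoods of `K`. -/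
abbrev fieldSigmaClosed (h : Ω → 𝓓'(U, ℝ)) (K : Set ℂ) : MeasurableSpace Ω :=
  ⨅ (ε : ℝ) (_ : 0 < ε), fieldSigma h (Metric.thickening ε K)

/-- The σ-algebra generated by the internal metric `D(·, ·; W)`, i.e. by the random variables
`D(x, y; W)` (it is trivial for `W = ∅`). -/
abbrev internalSigma (D : Ω → U → U → ℝ) (W : Set ℂ) : MeasurableSpace Ω :=
  MeasurableSpace.comap (fun ω => internalMetric (D ω) W) inferInstance

/-- The σ-algebras `m₁` and `m₂` are conditionally independent given `m`: almost surely
`P(A ∩ B | m) = P(A | m) P(B | m)` for all `A ∈ m₁`, `B ∈ m₂`. -/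
def CondIndepGiven (m m₁ m₂ : MeasurableSpace Ω) [MeasurableSpace Ω] (P : Measure Ω) : Prop :=
  ∀ A B : Set Ω, MeasurableSet[m₁] A → MeasurableSet[m₂] B →
    P⟦A ∩ B | m⟧ =ᵐ[P] P⟦A | m⟧ * P⟦B | m⟧

/-- Conditionally on `m`, the random variables `X` and `Y` are independent and have the
same law. -/
structure IsCondIIDGiven {S : Type*} [MeasurableSpace S] (m : MeasurableSpace Ω)
    [MeasurableSpace Ω] (P : Measure Ω) (X Y : Ω → S) : Prop where
  indep : CondIndepGiven m (MeasurableSpace.comap X inferInstance)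
    (MeasurableSpace.comap Y inferInstance) P
  same_law : ∀ A : Set S, MeasurableSet A → P⟦X ⁻¹' A | m⟧ =ᵐ[P] P⟦Y ⁻¹' A | m⟧

/-! ### Local metrics -/

/-- `D` is a random continuous length metric on `U`. Measurability refers to the σ-algebra
generated by the evaluations `d ↦ d x y`, which on continuous metrics is the Borel σ-algebra of
the local uniform topology. -/
structure IsRandomContinuousLengthMetric [MeasurableSpace Ω] (D : Ω → U → U → ℝ) : Prop where
  measurable : Measurable D
  isContinuousLengthMetric : ∀ ω, IsContinuousLengthMetric (D ω)

/-- `D` is local for `h`: for each open `V ⊆ U`, the internal metric `D(·, ·; V)` is conditionally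
independent from the pair `(h|_{U \ V}, D(·, ·; U \ closure V))` given `h|_V`. -/
def IsLocalMetric [MeasurableSpace Ω] (P : Measure Ω) (h : Ω → 𝓓'(U, ℝ))
    (D : Ω → U → U → ℝ) : Prop :=
  ∀ V : Set ℂ, IsOpen V → V ⊆ U →
    CondIndepGiven (fieldSigma h V) (internalSigma D V)
      (fieldSigmaClosed h (U \ V) ⊔ internalSigma D (U \ closure V)) P

end Sigma

end LocalMetrics

end

open LocalMetrics

/-! Fix points `x`, `y` of a countable dense set `Q` and let `G` be the σ-algebra generated by `h`
and `Dt`. Given `h`, the pair `(D, Dt)` is exchangeable, so the assumed bound `Dt ≤ C D` also gives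
`D ≤ C Dt`. Hence `r = C Dt` is a `G`-measurable weight with `D ≤ r ≤ C² D` on `Q`. The main claim
is that `D x y` has zero conditional variance given `G`. Since `D` and `Dt` are conditionally
independent given `h`, it is then a function of `h` alone. Continuity of `D` extends this from `Q`
to `U`, and exchangeability transfers it to `Dt`.

Independence. The field is a.s. determined by its restrictions to `V` and to `U \ V`
(`IsGFF.comap_le_eventuallyMeasurableSpace`; this rests on a bound of the variance of `(h, φ)` by
the `L²`-norm of `φ`, obtained from a Poincaré inequality). Locality can therefore be stated given
all of `h`, and then given `G`: the internal metrics of `D` in the disjoint squares of a grid are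
conditionally independent (`IsLocalMetric.condExp_sup_internalSigma`). The Efron-Stein inequality
(`integral_sq_condExp_sub_le_sum`) bounds the conditional variance of a function `X'` of these
metrics by the sum over `i` of `E (X' - Y i)²`, for any `Y i` which do not involve the square `i`.

Approximation. Take for `X'` the `patchedDist`: the cheapest chain from `x` to `y` whose steps cost
either `r` or the internal metric of `D` in one square. For `Y i`, forbid the square `i`. A step of
an almost optimal chain relies on at most one square, and replacing its cost by `r` loses at most a
factor `K = C²`, so the differences `Y i - X'` sum to at most `K X'`
(`sum_patchedDist_erase_sub_le`). Each single difference is small on a fine grid: an almost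
`D`-geodesic chain has little length in one small square, and little length near the grid lines for
most shifts of the grid (`exists_patchedDist_erase_le`). A sum of squares is at most the maximum
times the sum, so the bound tends to zero after averaging over the shifts (`tendsto_gridError`).
Truncating the distances and restricting to the events `C ≤ k` supplies the domination for passing
to the limit in expectation. -/

namespace LocalMetrics

open Set Topology

/-! ### Chains -/

/-- The infimum of the total weight over all finite chains from `a` to `b`. -/
noncomputable def chainInf {ι : Type*} (w : ι → ι → ℝ≥0∞) (a b : ι) : ℝ≥0∞ :=
  ⨅ (n : ℕ) (q : Fin (n + 1) → ι) (_ : q 0 = a ∧ q (Fin.last n) = b),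
    ∑ i : Fin n, w (q i.castSucc) (q i.succ)

section Chains

variable {ι : Type*} {w w' : ι → ι → ℝ≥0∞}

theorem chainInf_le_sum (w : ι → ι → ℝ≥0∞) (n : ℕ) (q : ℕ → ι) :
    chainInf w (q 0) (q n) ≤ ∑ k ∈ Finset.range n, w (q k) (q (k + 1)) := by
  refine iInf_le_of_le n (iInf_le_of_le (fun i : Fin (n + 1) => q i)
    (iInf_le_of_le ⟨rfl, by simp⟩ ?_))
  rw [Finset.sum_range]
  simp

theorem exists_chain_of_chainInf_lt {a b : ι} {c : ℝ≥0∞} (h : chainInf w a b < c) :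
    ∃ (n : ℕ) (q : ℕ → ι), q 0 = a ∧ q n = b ∧
      ∑ k ∈ Finset.range n, w (q k) (q (k + 1)) < c := by
  simp only [chainInf, iInf_lt_iff] at h
  obtain ⟨n, q, ⟨h0, h1⟩, hs⟩ := h
  refine ⟨n, fun k => q ⟨min k n, by omega⟩, by simpa using h0, ?_, ?_⟩
  · rw [← h1]
    exact congrArg q (Fin.ext (by simp))
  · refine lt_of_eq_of_lt ?_ hs
    rw [Finset.sum_range]
    refine Finset.sum_congr rfl fun i _ => ?_
    exact congrArg₂ w (congrArg q (Fin.ext (by simp))) (congrArg q (Fin.ext (by simp)))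

theorem chainInf_mono (h : ∀ p q, w p q ≤ w' p q) (a b : ι) : chainInf w a b ≤ chainInf w' a b := by
  unfold chainInf
  gcongr
  apply h

theorem chainInf_le (w : ι → ι → ℝ≥0∞) (a b : ι) : chainInf w a b ≤ w a b := by
  simpa using chainInf_le_sum w 1 (fun k => if k = 0 then a else b)

/-- The triangle inequality telescopes along a chain; this is how chain infima are bounded from
below. -/
theorem le_chainInf {f : ι → ι → ℝ≥0∞} {a b : ι} (h0 : f a a = 0)
    (htri : ∀ p q, f a q ≤ f a p + f p q) (hfw : ∀ p q, f p q ≤ w p q) :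
    f a b ≤ chainInf w a b := by
  refine le_of_forall_gt fun c hc => ?_
  obtain ⟨n, q, rfl, rfl, hs⟩ := exists_chain_of_chainInf_lt hc
  refine lt_of_le_of_lt ?_ hs
  have : ∀ m, f (q 0) (q m) ≤ ∑ k ∈ Finset.range m, w (q k) (q (k + 1)) := by
    intro m
    induction m with
    | zero => simp [h0]
    | succ m ih =>
      rw [Finset.sum_range_succ]
      exact (htri _ _).trans (add_le_add ih (hfw _ _))
  exact this n

theorem measurable_chainInf [Countable ι] {Ω : Type*} {m : MeasurableSpace Ω}
    {w : Ω → ι → ι → ℝ≥0∞} (hw : ∀ p q, Measurable fun ω => w ω p q) (a b : ι) :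
    Measurable fun ω => chainInf (w ω) a b := by
  unfold chainInf
  refine Measurable.iInf fun n => Measurable.iInf fun q => Measurable.iInf fun _ => ?_
  exact Finset.measurable_sum _ fun i _ => hw _ _

end Chains

/-! ### Lengths of curves -/

/-- The infimum of the `d`-lengths of the curves from `x` to `y` which stay in `W`. -/
noncomputable def innerDist {X : Type*} [TopologicalSpace X] (d : X → X → ℝ) (W : Set X)
    (x y : X) : ℝ≥0∞ :=
  ⨅ (γ : Path x y) (_ : ∀ t, γ t ∈ W), curveLength d γ

section Length

variable {X : Type*} [PseudoMetricSpace X]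

/-- The two suprema differ in form only: strict partitions with prescribed endpoints against
arbitrary monotone sequences. Adding points never decreases a variation sum, so both give the same
value, and the calculus of variations on sets becomes available. -/
theorem curveLength_eq_eVariationOn {x y : X} (γ : Path x y) :
    curveLength dist γ = eVariationOn γ univ := by
  apply le_antisymm
  · refine iSup_le fun n => iSup_le fun t => iSup_le fun ht' => ?_
    have ht := ht'.1
    have hmono : Monotone (fun k : ℕ => t (⟨min k n, by omega⟩ : Fin (n + 1))) := fun a b hab =>
      ht.monotone (by simp only [Fin.mk_le_mk]; omega)
    refine le_trans (le_of_eq ?_)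
      (eVariationOn.sum_le (f := γ) (n := n) hmono (fun _ => mem_univ _))
    rw [Finset.sum_range]
    refine Finset.sum_congr rfl fun i _ => ?_
    rw [edist_comm, edist_dist]
    congr 4 <;> ext <;> simp
  · refine iSup_le fun ⟨n, u, hu, _⟩ => ?_
    obtain ⟨v, m, hv, -, ⟨N, hN, hvN⟩, hle⟩ := eVariationOn.add_point γ (mem_univ 0) u hu
      (fun _ => mem_univ _) n
    refine hle.trans ?_
    -- The values of the monotone sequence, together with both endpoints, enumerated increasingly as
    -- a strict partition.
    let s : Finset I := insert 0 (insert 1 ((Finset.range (m + 1)).image v))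
    have h0 : (0 : I) ∈ s := by simp [s]
    have h1 : (1 : I) ∈ s := by simp [s]
    obtain ⟨k, hk⟩ : ∃ k, s.card = k + 1 := ⟨s.card - 1, by
      have := Finset.card_pos.2 ⟨_, h0⟩; omega⟩
    let t : Fin (k + 1) ↪o I := s.orderEmbOfFin hk
    have hrange : range t = s := Finset.range_orderEmbOfFin s hk
    have ht0 : t 0 = 0 := by
      obtain ⟨i, hi⟩ : (0 : I) ∈ range t := hrange ▸ h0
      exact le_antisymm (hi ▸ t.monotone (Fin.zero_le i)) (unitInterval.nonneg _)
    have ht1 : t (Fin.last k) = 1 := by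
      obtain ⟨i, hi⟩ : (1 : I) ∈ range t := hrange ▸ h1
      exact le_antisymm (unitInterval.le_one _) (hi ▸ t.monotone (Fin.le_last i))
    have hsum : ∑ i : Fin k, ENNReal.ofReal (dist (γ (t i.castSucc)) (γ (t i.succ))) ≤
        curveLength dist γ :=
      le_iSup_of_le k <| le_iSup_of_le t <| le_iSup_of_le ⟨t.strictMono, ht0, ht1⟩ le_rfl
    refine le_trans ?_ hsum
    let T : ℕ → I := fun j => t ⟨min j k, by omega⟩
    have hT : Monotone T := fun a b hab => t.monotone (by simp only [Fin.mk_le_mk]; omega)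
    have hTs : T '' Iic k = s := by
      rw [← hrange]
      ext z
      constructor
      · rintro ⟨j, -, rfl⟩; exact ⟨_, rfl⟩
      · rintro ⟨i, rfl⟩
        refine ⟨i, by simp only [mem_Iic]; omega, ?_⟩
        simp only [T]; congr 1; ext; simp; omega
    have hA := eVariationOn.image_range_of_monotone γ hT k
    have hB := eVariationOn.image_range_of_monotone γ hv m
    have hsub : v '' Iic m ⊆ T '' Iic k := by
      rw [hTs]
      rintro _ ⟨j, hj, rfl⟩
      simp only [s, Finset.coe_insert, Finset.coe_image, mem_insert_iff]
      exact Or.inr (Or.inr ⟨j, by simpa [Nat.lt_succ_iff] using hj, rfl⟩)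
    calc ∑ j ∈ Finset.range m, edist (γ (v (j + 1))) (γ (v j))
        = eVariationOn γ (v '' Iic m) := by
          rw [hB]; exact Finset.sum_congr rfl fun j _ => edist_comm _ _
      _ ≤ eVariationOn γ (T '' Iic k) := eVariationOn.mono _ hsub
      _ ≤ _ := by
        rw [hA, Finset.sum_range]
        refine Finset.sum_le_sum fun i _ => ?_
        have h1 : T i = t i.castSucc := congrArg t (Fin.ext (by simp))
        have h2 : T (i + 1) = t i.succ := congrArg t (Fin.ext (by simp))
        rw [edist_dist, h1, h2]

theorem edist_le_curveLength {x y : X} (γ : Path x y) (s t : I) :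
    edist (γ s) (γ t) ≤ curveLength dist γ := by
  rw [curveLength_eq_eVariationOn]
  exact eVariationOn.edist_le _ (mem_univ _) (mem_univ _)

theorem edist_le_innerDist (W : Set X) (x y : X) : edist x y ≤ innerDist dist W x y :=
  le_iInf fun γ => le_iInf fun _ => by simpa using edist_le_curveLength γ 0 1

theorem curveLength_trans_le {x y z : X} (γ : Path x y) (γ' : Path y z) :
    curveLength dist (γ.trans γ') ≤ curveLength dist γ + curveLength dist γ' := by
  simp only [curveLength_eq_eVariationOn]
  let h : I := ⟨1 / 2, by norm_num, by norm_num⟩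
  have hu : (univ : Set I) = Iic h ∪ Ici h := Iic_union_Ici.symm
  rw [hu, eVariationOn.union _ isGreatest_Iic isLeast_Ici, ← hu]
  have e1 : EqOn (γ.trans γ') (γ ∘ fun t : I => projIcc (0 : ℝ) 1 zero_le_one (2 * t)) (Iic h) := by
    intro t ht
    have ht' : (t : ℝ) ≤ 1 / 2 := ht
    simp only [Path.trans_apply, Function.comp]
    rw [dif_pos ht', projIcc_of_mem]
  have e2 : EqOn (γ.trans γ') (γ' ∘ fun t : I => projIcc (0 : ℝ) 1 zero_le_one (2 * t - 1))
      (Ici h) := by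
    intro t ht
    have ht' : 1 / 2 ≤ (t : ℝ) := ht
    simp only [Path.trans_apply, Function.comp]
    split_ifs with h2
    · have : (t : ℝ) = 1 / 2 := le_antisymm h2 ht'
      simp [this]
    · rw [projIcc_of_mem]
  rw [eVariationOn.eq_of_eqOn e1, eVariationOn.eq_of_eqOn e2]
  refine add_le_add ?_ ?_
  · refine eVariationOn.comp_le_of_monotoneOn _ _ ?_ (mapsTo_univ _ _)
    intro a _ b _ hab
    have : (a : ℝ) ≤ b := hab
    exact monotone_projIcc _ (by linarith)
  · refine eVariationOn.comp_le_of_monotoneOn _ _ ?_ (mapsTo_univ _ _)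
    intro a _ b _ hab
    have : (a : ℝ) ≤ b := hab
    exact monotone_projIcc _ (by linarith)

theorem innerDist_triangle (W : Set X) (x y z : X) :
    innerDist dist W x z ≤ innerDist dist W x y + innerDist dist W y z := by
  unfold innerDist
  simp only [ENNReal.iInf_add, ENNReal.add_iInf]
  refine le_iInf fun γ' => le_iInf fun hγ' => le_iInf fun γ => le_iInf fun hγ => ?_
  refine (iInf_le_of_le (γ.trans γ') (iInf_le_of_le (fun t => ?_) le_rfl)).trans
    (curveLength_trans_le γ γ')
  rw [Path.trans_apply]
  split_ifs
  exacts [hγ _, hγ' _]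

theorem innerDist_self {W : Set X} {x : X} (hx : x ∈ W) : innerDist dist W x x = 0 := by
  refine le_antisymm ?_ bot_le
  refine iInf_le_of_le (Path.refl x) (iInf_le_of_le (fun _ => hx) ?_)
  rw [curveLength_eq_eVariationOn]
  have : (Path.refl x : I → X) '' univ = {x} := by ext; simp [eq_comm]
  exact (eVariationOn.constant_on (this ▸ subsingleton_singleton)).le

/-- The initial segment of a curve. -/
def initialSegment {x y : X} (γ : Path x y) (s : I) : Path x (γ s) where
  toFun t := γ (t * s)
  continuous_toFun := by fun_prop
  source' := by simp
  target' := by simp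

theorem innerDist_le_curveLength {W : Set X} {x y : X} (γ : Path x y) (hγ : ∀ t, γ t ∈ W) (s : I) :
    innerDist dist W x (γ s) ≤ curveLength dist γ := by
  refine iInf_le_of_le (initialSegment γ s) (iInf_le_of_le (fun t => hγ _) ?_)
  simp only [curveLength_eq_eVariationOn]
  refine eVariationOn.comp_le_of_monotoneOn γ (fun t : I => t * s) ?_ (mapsTo_univ _ _)
  intro a _ b _ hab
  exact mul_le_mul_left hab s

/-- A metric space in which any two points are joined by almost geodesic curves. -/
def IsLengthSpace (X : Type*) [PseudoMetricSpace X] : Prop :=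
  ∀ x y : X, ∀ ε : ℝ, 0 < ε →
    ∃ γ : Path x y, curveLength dist γ ≤ ENNReal.ofReal (dist x y + ε)

/-- A curve from `x` of length less than `δ` cannot leave the `δ`-ball around `x`, so almost
geodesics to points of that ball already stay in `W`. -/
theorem innerDist_eq_edist (hX : IsLengthSpace X) {W : Set X} {x y : X} {δ : ℝ}
    (hW : Metric.ball x δ ⊆ W) (hxy : dist x y < δ) : innerDist dist W x y = edist x y := by
  refine le_antisymm ?_ (edist_le_innerDist _ _ _)
  refine ENNReal.le_of_forall_pos_le_add fun ε hε _ => ?_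
  obtain ⟨γ, hγ⟩ := hX x y (min (ε : ℝ) ((δ - dist x y) / 2))
    (lt_min (by exact_mod_cast hε) (by linarith))
  have hlt : curveLength dist γ < ENNReal.ofReal δ := by
    refine hγ.trans_lt ?_
    have := min_le_right (ε : ℝ) ((δ - dist x y) / 2)
    rw [ENNReal.ofReal_lt_ofReal_iff (lt_of_le_of_lt dist_nonneg hxy)]
    linarith
  refine iInf_le_of_le γ (iInf_le_of_le (fun t => hW ?_) ?_)
  · have h := (edist_le_curveLength γ t 0).trans_lt hlt
    rw [γ.source, edist_lt_ofReal] at h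
    exact h
  · refine hγ.trans ?_
    rw [ENNReal.ofReal_add dist_nonneg (le_min ε.coe_nonneg (by linarith)), ← edist_dist]
    gcongr
    exact (ENNReal.ofReal_le_ofReal (min_le_left _ _)).trans (by simp)

/-- A curve of finite length is approximated by a fine chain in a given dense set. -/
theorem exists_chain_near_path {Q : Set X} (hQ : Dense Q) {x y : X} (hx : x ∈ Q) (hy : y ∈ Q)
    (γ : Path x y) {L : ℝ} (hL : 0 ≤ L) (hγ : curveLength dist γ ≤ ENNReal.ofReal L) {δ η : ℝ}
    (hδ : 0 < δ) (hη : 0 < η) :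
    ∃ (n : ℕ) (q : ℕ → Q) (s : ℕ → I), q 0 = ⟨x, hx⟩ ∧ q n = ⟨y, hy⟩ ∧
      (∀ k, dist (q k : X) (γ (s k)) < δ) ∧ (∀ k, dist (q k : X) (q (k + 1)) < δ) ∧
      ∑ k ∈ Finset.range n, dist (q k : X) (q (k + 1)) ≤ L + η := by
  have huc : UniformContinuous γ := CompactSpace.uniformContinuous_of_continuous γ.continuous
  obtain ⟨ρ, hρ, hρ'⟩ := Metric.uniformContinuous_iff.1 huc (δ / 3) (by linarith)
  obtain ⟨n, hn⟩ := exists_nat_one_div_lt hρ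
  let N := n + 1
  have hN : (0 : ℝ) < N := by positivity
  let s : ℕ → I := fun k => projIcc (0 : ℝ) 1 zero_le_one (k / N)
  have hs : Monotone s := fun a b hab => monotone_projIcc _ (by gcongr)
  have hs1 : ∀ k, dist (γ (s k)) (γ (s (k + 1))) < δ / 3 := by
    intro k
    apply hρ'
    have h1 : dist (s k) (s (k + 1)) ≤ dist ((k : ℝ) / N) (((k + 1 : ℕ) : ℝ) / N) := by
      rw [Subtype.dist_eq, Real.dist_eq, Real.dist_eq]
      exact abs_projIcc_sub_projIcc zero_le_one
    refine h1.trans_lt ?_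
    rw [Real.dist_eq, abs_sub_comm]
    push_cast
    rw [add_div, add_sub_cancel_left, abs_of_nonneg (by positivity)]
    simpa [N] using hn
  set r := min (δ / 3) (η / (2 * N)) with hr
  have hr0 : 0 < r := lt_min (by linarith) (by positivity)
  have hch : ∀ k, ∃ p : Q, dist (p : X) (γ (s k)) < r ∧ (k = 0 → p = ⟨x, hx⟩) ∧
      (k = N → p = ⟨y, hy⟩) := by
    intro k
    by_cases h0 : k = 0
    · refine ⟨⟨x, hx⟩, ?_, fun _ => rfl, fun h => by simp [N] at h; omega⟩
      simp [h0, s, hr0]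
    by_cases h1 : k = N
    · refine ⟨⟨y, hy⟩, ?_, fun h => absurd h h0, fun _ => rfl⟩
      simp [h1, s, hN.ne', hr0]
    · obtain ⟨p, hp, hp'⟩ := hQ.exists_dist_lt (γ (s k)) hr0
      exact ⟨⟨p, hp⟩, by rwa [dist_comm], fun h => absurd h h0, fun h => absurd h h1⟩
  choose q hq hq0 hq1 using hch
  refine ⟨N, q, s, hq0 0 rfl, hq1 N rfl, fun k => ?_, fun k => ?_, ?_⟩
  · exact (hq k).trans_le ((min_le_left _ _).trans (by linarith))
  · have h1 := hq k
    have h2 := hq (k + 1)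
    have h3 := hs1 k
    have h4 := min_le_left (δ / 3) (η / (2 * N))
    have h5 := dist_triangle4 (q k : X) (γ (s k)) (γ (s (k + 1))) (q (k + 1))
    rw [dist_comm (γ (s (k + 1)))] at h5
    linarith
  · have hlen : ∑ k ∈ Finset.range N, dist (γ (s k)) (γ (s (k + 1))) ≤ L := by
      rw [← ENNReal.ofReal_le_ofReal_iff hL, ENNReal.ofReal_sum_of_nonneg fun _ _ => dist_nonneg]
      refine le_trans ?_ hγ
      rw [curveLength_eq_eVariationOn]
      refine le_trans (le_of_eq ?_) (eVariationOn.sum_le (n := N) hs fun _ => mem_univ _)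
      refine Finset.sum_congr rfl fun k _ => ?_
      rw [← edist_dist, edist_comm]
    calc ∑ k ∈ Finset.range N, dist (q k : X) (q (k + 1))
        ≤ ∑ k ∈ Finset.range N, (dist (γ (s k)) (γ (s (k + 1))) + η / N) := by
          refine Finset.sum_le_sum fun k _ => ?_
          have h1 := hq k
          have h2 := hq (k + 1)
          have h4 := min_le_right (δ / 3) (η / (2 * N))
          have h5 := dist_triangle4 (q k : X) (γ (s k)) (γ (s (k + 1))) (q (k + 1))
          rw [dist_comm (γ (s (k + 1)))] at h5
          have h6 : η / N = η / (2 * N) + η / (2 * N) := by field_simp; norm_num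
          linarith
      _ ≤ L + η := by
          rw [Finset.sum_add_distrib, Finset.sum_const, Finset.card_range, nsmul_eq_mul,
            mul_div_cancel₀ _ hN.ne']
          linarith

theorem exists_ball_subset_of_path {V : Set X} (hV : IsOpen V) {x y : X} (γ : Path x y)
    (hγ : ∀ t, γ t ∈ V) : ∃ δ > 0, ∀ t, Metric.ball (γ t) δ ⊆ V := by
  obtain ⟨δ, hδ, h⟩ := (isCompact_range γ.continuous).exists_thickening_subset_open hV
    (range_subset_iff.2 hγ)
  refine ⟨δ, hδ, fun t => ?_⟩
  exact (Metric.ball_subset_thickening (mem_range_self t) δ).trans h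

open Classical in
/-- The weight of a step which is certified to stay in the complement of `closure A`. -/
noncomputable def guardedWeight (A : Set X) (f : X → X → ℝ≥0∞) (p q : X) : ℝ≥0∞ :=
  if f p q < ⨅ a ∈ A, f p a then f p q else ⊤

/-- This rewrites an infimum over curves in `V` through countably many values of the internal metric
of the larger set `W` (when `Q` and `A` are countable), which yields measurability. The guard works
because a curve from `p` that meets the complement of `V` is at least as long as the `W`-distance
from `p` to `A`: an almost optimal curve for a guarded step thus stays in `V`. Conversely, a curve
in `V` keeps a positive distance from the complement, so fine chains along it pass the guard. -/
theorem innerDist_eq_chainInf (hX : IsLengthSpace X) {V W : Set X} (hV : IsOpen V) (hW : IsOpen W)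
    (hVW : V ⊆ W) {Q A : Set X} (hQ : Dense Q) (hA : A ⊆ Vᶜ) (hA' : Vᶜ ⊆ closure A) {x y : X}
    (hx : x ∈ V) (hxQ : x ∈ Q) (hyQ : y ∈ Q) :
    innerDist dist V x y = chainInf
      (fun p q : Q => guardedWeight A (innerDist dist W) (p : X) (q : X)) ⟨x, hxQ⟩ ⟨y, hyQ⟩ := by
  apply le_antisymm
  · refine le_chainInf (f := fun p q : Q => innerDist dist V (p : X) (q : X)) (a := ⟨x, hxQ⟩)
      (innerDist_self hx) (fun p q => innerDist_triangle V _ _ _) fun p q => ?_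
    rw [guardedWeight]
    split_ifs with hpq
    swap
    · exact le_top
    refine le_of_forall_gt fun c hc => ?_
    have hlt := lt_min hc hpq
    simp only [innerDist, iInf_lt_iff] at hlt
    obtain ⟨γ, hγ, hlt⟩ := hlt
    refine lt_of_le_of_lt (iInf_le_of_le γ (iInf_le_of_le (fun t => ?_) le_rfl))
      (hlt.trans_le (min_le_left _ _))
    by_contra hnot
    have hlt' := hlt.trans_le (min_le_right _ _)
    obtain ⟨e, he, he'⟩ := ENNReal.lt_iff_exists_add_pos_lt.1 hlt'
    -- If the curve left `V` at `γ t`, a nearby point `a` of `A` would be within the length of the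
    -- curve plus `e` of `p`, against the guard.
    obtain ⟨ρ, hρ, hρW⟩ := Metric.isOpen_iff.1 hW _ (hγ t)
    obtain ⟨a, haA, hda⟩ := Metric.mem_closure_iff.1 (hA' hnot) (min ρ e) (lt_min hρ he)
    have h1 : innerDist dist W (p : X) a ≤ curveLength dist γ + e := by
      refine (innerDist_triangle W _ (γ t) _).trans
        (add_le_add (innerDist_le_curveLength γ hγ t) ?_)
      rw [innerDist_eq_edist hX hρW (hda.trans_le (min_le_left _ _)), edist_dist]
      exact (ENNReal.ofReal_le_ofReal (hda.le.trans (min_le_right _ _))).trans (by simp)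
    exact absurd (he'.trans_le (iInf₂_le a haA)) (not_lt.2 h1)
  · refine le_iInf fun γ => le_iInf fun hγ => ?_
    by_cases htop : curveLength dist γ = ⊤
    · simp [htop]
    obtain ⟨δ, hδ, hball⟩ := exists_ball_subset_of_path hV γ hγ
    refine ENNReal.le_of_forall_pos_le_add fun ε hε _ => ?_
    obtain ⟨n, q, s, h0, h1, hnear, hstep, hsum⟩ := exists_chain_near_path hQ hxQ hyQ γ
      (L := (curveLength dist γ).toReal) ENNReal.toReal_nonneg (by rw [ENNReal.ofReal_toReal htop])
      (half_pos hδ) (η := ε) (by exact_mod_cast hε)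
    rw [← h0, ← h1]
    refine (chainInf_le_sum _ n q).trans ?_
    have hqball : ∀ k, Metric.ball (q k : X) (δ / 2) ⊆ V := fun k =>
      (Metric.ball_subset_ball' (by linarith [hnear k])).trans (hball (s k))
    have hterm : ∀ k, guardedWeight A (innerDist dist W) (q k : X) (q (k + 1)) =
        edist (q k : X) (q (k + 1)) := by
      intro k
      have he := innerDist_eq_edist hX ((hqball k).trans hVW) (hstep k)
      rw [guardedWeight, if_pos, he]
      rw [he]
      -- Steps are shorter than `δ / 2`, while the `δ / 2`-balls around the chain points lie in `V`
      -- and so miss `A`.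
      refine lt_of_lt_of_le (b := ENNReal.ofReal (δ / 2)) ?_ (le_iInf₂ fun a ha => ?_)
      · rw [edist_lt_ofReal]; exact hstep k
      · refine le_trans ?_ (edist_le_innerDist W _ _)
        rw [edist_dist]
        refine ENNReal.ofReal_le_ofReal ?_
        by_contra hlt
        exact hA ha (hqball k (by rw [Metric.mem_ball, dist_comm]; exact not_le.1 hlt))
    simp only [hterm, edist_dist]
    rw [← ENNReal.ofReal_sum_of_nonneg fun _ _ => dist_nonneg]
    refine (ENNReal.ofReal_le_ofReal hsum).trans ?_
    rw [ENNReal.ofReal_add ENNReal.toReal_nonneg ε.coe_nonneg, ENNReal.ofReal_toReal htop]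
    simp

end Length

/-! ### Internal metrics of subsets of `U` and their measurability. -/

section Transfer

/-- The metric space structure given by a continuous metric. -/
@[reducible]
noncomputable def IsContinuousMetric.toPseudoMetricSpace {X : Type*} [TopologicalSpace X]
    {d : X → X → ℝ} (hd : IsContinuousMetric d) : PseudoMetricSpace X :=
  PseudoMetricSpace.ofDistTopology d hd.dist_self hd.symm hd.triangle fun s => by
    rw [isOpen_iff_mem_nhds]
    refine forall₂_congr fun x _ => ?_
    rw [(hd.nhds_basis x).mem_iff]
    rfl

theorem IsContinuousLengthMetric.isLengthSpace {X : Type*} [TopologicalSpace X]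
    {d : X → X → ℝ} (hd : IsContinuousLengthMetric d) :
    @IsLengthSpace X hd.toIsContinuousMetric.toPseudoMetricSpace :=
  hd.exists_curve

variable {Ω : Type*} {U : Opens ℂ}

theorem internalMetric_eq_top_of_notMem (d : U → U → ℝ) {W : Set ℂ} {x y : U}
    (h : ¬((x : ℂ) ∈ W ∧ (y : ℂ) ∈ W)) : internalMetric d W x y = ⊤ := by
  simp only [internalMetric, iInf_eq_top]
  intro γ hγ
  exact absurd ⟨by simpa using hγ 0, by simpa using hγ 1⟩ h

theorem ofReal_le_internalMetric {d : U → U → ℝ} (hd : IsContinuousLengthMetric d) (W : Set ℂ)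
    (x y : U) : ENNReal.ofReal (d x y) ≤ internalMetric d W x y := by
  let _ := hd.toIsContinuousMetric.toPseudoMetricSpace
  have h := edist_le_innerDist (X := U) ((fun z : U => (z : ℂ)) ⁻¹' W) x y
  rw [edist_dist] at h
  exact h

theorem internalMetric_eq_ofReal {d : U → U → ℝ} (hd : IsContinuousLengthMetric d) {W : Set ℂ}
    {x y : U} {δ : ℝ} (hW : ∀ z : U, d x z < δ → (z : ℂ) ∈ W) (hxy : d x y < δ) :
    internalMetric d W x y = ENNReal.ofReal (d x y) := by
  let _ := hd.toIsContinuousMetric.toPseudoMetricSpace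
  have h := innerDist_eq_edist (X := U) hd.isLengthSpace (W := (fun z : U => (z : ℂ)) ⁻¹' W) (x := x) (y := y)
    (δ := δ) (fun z hz => hW z (by rw [Metric.mem_ball, dist_comm] at hz; exact hz)) hxy
  rw [edist_dist] at h
  exact h

theorem internalMetric_univ {d : U → U → ℝ} (hd : IsContinuousLengthMetric d) (x y : U) :
    internalMetric d U x y = ENNReal.ofReal (d x y) :=
  internalMetric_eq_ofReal hd (δ := d x y + 1) (fun z _ => z.2) (by linarith)

theorem internalMetric_eq_chainInf {d : U → U → ℝ} (hd : IsContinuousLengthMetric d)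
    {V W : Set ℂ} (hV : IsOpen V) (hW : IsOpen W) (hVW : V ⊆ W) {Q A : Set U} (hQ : Dense Q)
    (hA : ∀ a ∈ A, (a : ℂ) ∉ V) (hA' : ∀ z : U, (z : ℂ) ∉ V → z ∈ closure A) {x y : U}
    (hx : (x : ℂ) ∈ V) (hxQ : x ∈ Q) (hyQ : y ∈ Q) :
    internalMetric d V x y = chainInf
      (fun p q : Q => guardedWeight A (internalMetric d W) (p : U) (q : U))
      ⟨x, hxQ⟩ ⟨y, hyQ⟩ := by
  let _ := hd.toIsContinuousMetric.toPseudoMetricSpace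
  exact innerDist_eq_chainInf (X := U) hd.isLengthSpace (V := (fun z : U => (z : ℂ)) ⁻¹' V) (W := (fun z : U => (z : ℂ)) ⁻¹' W)
    (hV.preimage continuous_subtype_val) (hW.preimage continuous_subtype_val)
    (preimage_mono hVW) hQ hA hA' hx hxQ hyQ

theorem measurable_guardedWeight {X : Type*} {m : MeasurableSpace Ω} {A : Set X} (hA : A.Countable)
    {f : Ω → X → X → ℝ≥0∞} (hf : ∀ p q, Measurable fun ω => f ω p q) (p q : X) :
    Measurable fun ω => guardedWeight A (f ω) p q := by
  unfold guardedWeight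
  refine Measurable.ite (measurableSet_lt (hf p q) ?_) (hf p q) measurable_const
  exact Measurable.biInf A hA fun a _ => hf p a

/-- The defining infimum over curves is uncountable; the guarded chain formula with countable `Q`
and `A` replaces it. The points `x`, `y` are adjoined to `Q` so that chains can start and end there.
-/
theorem measurable_internalMetric_of_subset {m : MeasurableSpace Ω} {D : Ω → U → U → ℝ}
    (hD : ∀ ω, IsContinuousLengthMetric (D ω)) {V W : Set ℂ} (hV : IsOpen V) (hW : IsOpen W)
    (hVW : V ⊆ W) (hm : ∀ p q, Measurable fun ω => internalMetric (D ω) W p q) (x y : U) :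
    Measurable fun ω => internalMetric (D ω) V x y := by
  by_cases hx : (x : ℂ) ∈ V
  swap
  · simp_rw [internalMetric_eq_top_of_notMem _ (fun h => hx h.1)]
    exact measurable_const
  obtain ⟨Q, hQc, hQ⟩ := exists_countable_dense U
  obtain ⟨A, hAV, hAc, hA⟩ :=
    (IsSeparable.of_separableSpace ((↑) ⁻¹' Vᶜ : Set U)).exists_countable_dense_subset
  have hc : (insert x (insert y Q)).Countable := (hQc.insert _).insert _
  have := hc.to_subtype
  have heq := fun ω => internalMetric_eq_chainInf (hD ω) hV hW hVW
    (Q := insert x (insert y Q)) (A := A)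
    (hQ.mono ((subset_insert _ _).trans (subset_insert _ _))) (fun a ha => hAV ha)
    (fun z hz => hA hz) hx (mem_insert _ _) (mem_insert_of_mem _ (mem_insert _ _))
  simp_rw [heq]
  exact measurable_chainInf (fun p q => measurable_guardedWeight hAc hm _ _) _ _

theorem measurable_eval_comap {X Y β : Type*} [MeasurableSpace β] (F : Ω → X → Y → β) (x : X)
    (y : Y) : Measurable[MeasurableSpace.comap F inferInstance] fun ω => F ω x y := by
  have h : Measurable fun g : X → Y → β => g x y := by fun_prop
  exact h.comp (comap_measurable F)

theorem measurable_internalMetric_internalSigma (D : Ω → U → U → ℝ) (W : Set ℂ) (x y : U) :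
    Measurable[internalSigma D W] fun ω => internalMetric (D ω) W x y :=
  measurable_eval_comap (fun ω => internalMetric (D ω) W) x y

theorem internalSigma_le_iff {m : MeasurableSpace Ω} {D : Ω → U → U → ℝ} {W : Set ℂ} :
    internalSigma D W ≤ m ↔ ∀ x y, Measurable fun ω => internalMetric (D ω) W x y := by
  refine ⟨fun h x y => (measurable_internalMetric_internalSigma D W x y).mono h le_rfl,
    fun h => measurable_iff_comap_le.1 ?_⟩
  exact measurable_pi_iff.2 fun x => measurable_pi_iff.2 fun y => h x y

theorem internalSigma_mono {D : Ω → U → U → ℝ} (hD : ∀ ω, IsContinuousLengthMetric (D ω))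
    {V W : Set ℂ} (hV : IsOpen V) (hW : IsOpen W) (hVW : V ⊆ W) :
    internalSigma D V ≤ internalSigma D W :=
  internalSigma_le_iff.2 <| measurable_internalMetric_of_subset hD hV hW hVW
    (measurable_internalMetric_internalSigma D W)

theorem internalSigma_le_comap {D : Ω → U → U → ℝ} (hD : ∀ ω, IsContinuousLengthMetric (D ω))
    {V : Set ℂ} (hV : IsOpen V) (hVU : V ⊆ U) :
    internalSigma D V ≤ MeasurableSpace.comap D inferInstance := by
  refine internalSigma_le_iff.2 <|
    measurable_internalMetric_of_subset hD hV U.isOpen hVU fun p q => ?_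
  simp_rw [internalMetric_univ (hD _)]
  exact (measurable_eval_comap D p q).ennreal_ofReal

end Transfer

end LocalMetrics

namespace LocalMetrics

/-! ### Conditional independence and the Efron-Stein inequality. -/

section CondExp

variable {Ω : Type*} {m m' m₁ m₂ a b d l n t : MeasurableSpace Ω} {m₀ : MeasurableSpace Ω}
  {P : Measure Ω} [IsProbabilityMeasure P]

omit [IsProbabilityMeasure P] in
-- The sets `A ∩ B` form a π-system generating `a ⊔ b`, and the sets on which the integrals agree
-- are stable under complements and disjoint unions.
theorem setIntegral_eq_of_sup (ha : a ≤ m₀) (hb : b ≤ m₀)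
    {f g : Ω → ℝ} (hf : Integrable f P) (hg : Integrable g P)
    (h : ∀ A B, MeasurableSet[a] A → MeasurableSet[b] B →
      ∫ ω in A ∩ B, f ω ∂P = ∫ ω in A ∩ B, g ω ∂P) {S : Set Ω} (hS : MeasurableSet[a ⊔ b] S) :
    ∫ ω in S, f ω ∂P = ∫ ω in S, g ω ∂P := by
  have hgen : a ⊔ b = MeasurableSpace.generateFrom
      {S | ∃ A B, MeasurableSet[a] A ∧ MeasurableSet[b] B ∧ S = A ∩ B} := by
    apply le_antisymm
    · refine sup_le (fun A hA => ?_) (fun B hB => ?_)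
      · exact MeasurableSpace.measurableSet_generateFrom
          ⟨A, Set.univ, hA, MeasurableSet.univ, by simp⟩
      · exact MeasurableSpace.measurableSet_generateFrom
          ⟨Set.univ, B, MeasurableSet.univ, hB, by simp⟩
    · refine MeasurableSpace.generateFrom_le ?_
      rintro _ ⟨A, B, hA, hB, rfl⟩
      exact MeasurableSet.inter ((le_sup_left : a ≤ a ⊔ b) _ hA) ((le_sup_right : b ≤ a ⊔ b) _ hB)
  have huniv : ∫ ω, f ω ∂P = ∫ ω, g ω ∂P := by
    simpa using h Set.univ Set.univ MeasurableSet.univ MeasurableSet.univ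
  have hle : a ⊔ b ≤ m₀ := sup_le ha hb
  have hpi : IsPiSystem
      {S | ∃ A B, MeasurableSet[a] A ∧ MeasurableSet[b] B ∧ S = A ∩ B} := by
    rintro _ ⟨A, B, hA, hB, rfl⟩ _ ⟨A', B', hA', hB', rfl⟩ -
    exact ⟨A ∩ A', B ∩ B', hA.inter hA', hB.inter hB', Set.inter_inter_inter_comm _ _ _ _⟩
  induction S, hS using MeasurableSpace.induction_on_inter hgen hpi with
  | empty => simp
  | basic S hS => obtain ⟨A, B, hA, hB, rfl⟩ := hS; exact h A B hA hB
  | compl S hS ih =>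
    have h1 := integral_add_compl (hle _ hS) hf
    have h2 := integral_add_compl (hle _ hS) hg
    linarith
  | iUnion S hd hS ih =>
    rw [integral_iUnion (fun i => hle _ (hS i)) hd hf.integrableOn,
      integral_iUnion (fun i => hle _ (hS i)) hd hg.integrableOn]
    exact tsum_congr ih

theorem integral_mul_condExp (hm : m ≤ m₀) {u f : Ω → ℝ}
    (hu : StronglyMeasurable[m] u) (hu2 : MemLp u 2 P) (hf : MemLp f 2 P) :
    ∫ ω, u ω * f ω ∂P = ∫ ω, u ω * (P[f | m]) ω ∂P := by
  have h := condExp_mul_of_stronglyMeasurable_left (μ := P) hu (hu2.integrable_mul hf)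
    (hf.integrable one_le_two)
  rw [← integral_condExp hm (f := fun ω => u ω * f ω)]
  exact integral_congr_ae h

theorem memLp_indicator_one {A : Set Ω} (hA : MeasurableSet A) :
    MemLp (A.indicator fun _ => (1 : ℝ)) 2 P :=
  (memLp_const 1).indicator hA

omit [IsProbabilityMeasure P] in
theorem setIntegral_inter_eq_integral_mul {A B : Set Ω} (hA : MeasurableSet A)
    (hB : MeasurableSet B) (f : Ω → ℝ) :
    ∫ ω in B ∩ A, f ω ∂P = ∫ ω, B.indicator f ω * A.indicator (fun _ => (1 : ℝ)) ω ∂P := by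
  rw [← integral_indicator (hB.inter hA)]
  congr 1
  ext ω
  by_cases h1 : ω ∈ A <;> by_cases h2 : ω ∈ B <;> simp [h1, h2]

/-- Two integrable functions, one of them measurable for `a ⊔ b`, with the same integrals over the
sets `A ∩ B`. -/
theorem condExp_sup_eq (ha : a ≤ m₀) (hb : b ≤ m₀) {f g : Ω → ℝ}
    (hf : Integrable f P) (hg : Integrable g P) (hgm : StronglyMeasurable[a ⊔ b] g)
    (h : ∀ A B, MeasurableSet[a] A → MeasurableSet[b] B →
      ∫ ω in A ∩ B, f ω ∂P = ∫ ω in A ∩ B, g ω ∂P) : P[f | a ⊔ b] =ᵐ[P] g := by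
  refine (ae_eq_condExp_of_forall_setIntegral_eq (sup_le ha hb) hf (fun _ _ _ => hg.integrableOn)
    (fun S hS _ => ?_) hgm.aestronglyMeasurable).symm
  exact (setIntegral_eq_of_sup ha hb hf hg h hS).symm

omit [IsProbabilityMeasure P] in
theorem CondIndepGiven.symm (h : CondIndepGiven m m₁ m₂ P) :
    CondIndepGiven m m₂ m₁ P := fun A B hA hB => by
  rw [Set.inter_comm, mul_comm]
  exact h B A hB hA

/-- The product formula in the form used from here on: further conditioning on `m₂` does not change
the conditional probability of an event of `m₁`. -/
theorem CondIndepGiven.condExp_sup (h : CondIndepGiven m m₁ m₂ P)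
    (hm : m ≤ m₀) (h₁ : m₁ ≤ m₀) (h₂ : m₂ ≤ m₀) {A : Set Ω} (hA : MeasurableSet[m₁] A) :
    P⟦A | m ⊔ m₂⟧ =ᵐ[P] P⟦A | m⟧ := by
  have hA2 := memLp_indicator_one (P := P) (h₁ _ hA)
  have hα2 : MemLp (P⟦A | m⟧) 2 P := hA2.condExp one_le_two
  refine condExp_sup_eq hm h₂ (hA2.integrable one_le_two) integrable_condExp
    (stronglyMeasurable_condExp.mono le_sup_left) fun B₁ B₂ hB₁ hB₂ => ?_
  have e1 : ∫ ω in B₁ ∩ B₂, A.indicator (fun _ => (1 : ℝ)) ω ∂P =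
      ∫ ω in B₁, (A ∩ B₂).indicator (fun _ => (1 : ℝ)) ω ∂P := by
    rw [Set.inter_comm, ← Measure.restrict_restrict (h₂ _ hB₂), ← integral_indicator (h₂ _ hB₂)]
    refine integral_congr_ae (Filter.Eventually.of_forall fun ω => ?_)
    by_cases h1 : ω ∈ A <;> by_cases h2 : ω ∈ B₂ <;> simp [h1, h2]
  have hAB2 := memLp_indicator_one (P := P) ((h₁ _ hA).inter (h₂ _ hB₂))
  rw [e1, ← setIntegral_condExp hm (hAB2.integrable one_le_two) hB₁,
    setIntegral_inter_eq_integral_mul (h₂ _ hB₂) (hm _ hB₁),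
    integral_mul_condExp hm (stronglyMeasurable_condExp.indicator hB₁)
      (hα2.indicator (hm _ hB₁)) (memLp_indicator_one (h₂ _ hB₂)),
    ← integral_indicator (hm _ hB₁)]
  refine integral_congr_ae ?_
  filter_upwards [h A B₂ hA hB₂] with ω hω
  by_cases h1 : ω ∈ B₁ <;> simp [h1]
  exact hω

/-- If `a` is conditionally independent of `b` given `m`, then it is also independent of `b ⊔ t`,
for `t` conditionally independent of everything else given `m`. -/
theorem condExp_sup_sup_eq (hm : m ≤ m₀) (hd : d ≤ m₀)
    (ht : t ≤ m₀) (had : a ≤ d) (hbd : b ≤ d) (hdt : CondIndepGiven m d t P)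
    {A : Set Ω} (hA : MeasurableSet[a] A) (hab : P⟦A | m ⊔ b⟧ =ᵐ[P] P⟦A | m⟧) :
    P⟦A | (m ⊔ b) ⊔ t⟧ =ᵐ[P] P⟦A | m⟧ := by
  have hmb : m ⊔ b ≤ m₀ := sup_le hm (hbd.trans hd)
  have hmd : m ⊔ d ≤ m₀ := sup_le hm hd
  have hmbd : m ⊔ b ≤ m ⊔ d := sup_le_sup_left hbd m
  have hA0 : MeasurableSet A := (had.trans hd) _ hA
  have hA2 := memLp_indicator_one (P := P) hA0
  have hα2 : MemLp (P⟦A | m⟧) 2 P := hA2.condExp one_le_two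
  refine condExp_sup_eq hmb ht (hA2.integrable one_le_two) integrable_condExp
    (stronglyMeasurable_condExp.mono (le_sup_left.trans le_sup_left)) fun B T hB hT => ?_
  have hB0 := hmb _ hB
  have hT0 := ht _ hT
  have hT2 := memLp_indicator_one (P := P) hT0
  have hτ := hdt.symm.condExp_sup hm ht hd hT
  have hτ2 : MemLp (P⟦T | m⟧) 2 P := hT2.condExp one_le_two
  rw [setIntegral_inter_eq_integral_mul hT0 hB0, setIntegral_inter_eq_integral_mul hT0 hB0,
    integral_mul_condExp hmd ((stronglyMeasurable_const.indicator
      ((had.trans (le_sup_right : d ≤ m ⊔ d)) _ hA)).indicator (hmbd _ hB)) (hA2.indicator hB0) hT2,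
    integral_mul_condExp hmd ((stronglyMeasurable_condExp.mono le_sup_left).indicator (hmbd _ hB))
      (hα2.indicator hB0) hT2]
  -- The event `T` enters only through its conditional probability given `m ⊔ d`, which is
  -- `m`-measurable. With this factor moved to the other side, only conditioning of `A` on `m ⊔ b`
  -- remains.
  have e1 : ∀ f : Ω → ℝ, ∫ ω, B.indicator f ω * (P⟦T | m ⊔ d⟧) ω ∂P =
      ∫ ω, B.indicator (P⟦T | m⟧) ω * f ω ∂P := by
    intro f
    refine integral_congr_ae ?_
    filter_upwards [hτ] with ω hω
    by_cases h1 : ω ∈ B <;> simp [h1]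
    rw [hω, mul_comm]
  rw [e1, e1, integral_mul_condExp hmb
    ((stronglyMeasurable_condExp.mono le_sup_left).indicator hB) (hτ2.indicator hB0) hA2]
  refine integral_congr_ae ?_
  filter_upwards [hab] with ω hω
  rw [hω]

/-- Given `n`, the law of `a` depends only on `m ≤ l`, so `a` carries no information about an
`n`-measurable variable beyond `l`. It serves twice: to drop one patch in the Efron-Stein step, and
to drop `Dt` from the conditioning at the end. -/
theorem condExp_sup_eq_of_indep (hn : n ≤ m₀) (hml : m ≤ l)
    (hln : l ≤ n) (ha : a ≤ m₀)
    (hind : ∀ A, MeasurableSet[a] A → P⟦A | n⟧ =ᵐ[P] P⟦A | m⟧)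
    {Y : Ω → ℝ} (hY : StronglyMeasurable[n] Y) (hY2 : MemLp Y 2 P) :
    P[Y | l ⊔ a] =ᵐ[P] P[Y | l] := by
  have hl : l ≤ m₀ := hln.trans hn
  refine condExp_sup_eq hl ha (hY2.integrable one_le_two) integrable_condExp
    (stronglyMeasurable_condExp.mono le_sup_left) fun B A hB hA => ?_
  have hB0 := hl _ hB
  have hA0 := ha _ hA
  have hA2 := memLp_indicator_one (P := P) hA0
  have hα2 : MemLp (P⟦A | m⟧) 2 P := hA2.condExp one_le_two
  have hE2 : MemLp (P[Y | l]) 2 P := hY2.condExp one_le_two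
  rw [setIntegral_inter_eq_integral_mul hA0 hB0, setIntegral_inter_eq_integral_mul hA0 hB0,
    integral_mul_condExp hn (hY.indicator (hln _ hB)) (hY2.indicator hB0) hA2,
    integral_mul_condExp hn ((stronglyMeasurable_condExp.mono hln).indicator (hln _ hB))
      (hE2.indicator hB0) hA2]
  have e1 : ∀ f : Ω → ℝ, ∫ ω, B.indicator f ω * (P⟦A | n⟧) ω ∂P =
      ∫ ω, B.indicator (P⟦A | m⟧) ω * f ω ∂P := by
    intro f
    refine integral_congr_ae ?_
    filter_upwards [hind A hA] with ω hω
    by_cases h1 : ω ∈ B <;> simp [h1]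
    rw [hω, mul_comm]
  rw [e1, e1, integral_mul_condExp hl ((stronglyMeasurable_condExp.mono hml).indicator hB)
    (hα2.indicator hB0) hY2]

theorem integral_sq_sub_condExp (hm : m ≤ m₀) {f : Ω → ℝ}
    (hf : MemLp f 2 P) :
    ∫ ω, (f ω - (P[f | m]) ω) ^ 2 ∂P = ∫ ω, f ω ^ 2 ∂P - ∫ ω, (P[f | m]) ω ^ 2 ∂P := by
  have hE : MemLp (P[f | m]) 2 P := hf.condExp one_le_two
  have h := integral_mul_condExp hm stronglyMeasurable_condExp hE hf
  have e : ∀ ω, (f ω - (P[f | m]) ω) ^ 2 =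
      f ω ^ 2 - 2 * ((P[f | m]) ω * f ω) + (P[f | m]) ω ^ 2 := fun ω => by ring
  simp_rw [e]
  rw [integral_add, integral_sub, integral_const_mul, h]
  · simp_rw [← pow_two]; ring
  · exact hf.integrable_sq
  · exact (hE.integrable_mul hf).const_mul 2
  · exact hf.integrable_sq.sub ((hE.integrable_mul hf).const_mul 2)
  · exact hE.integrable_sq

theorem integral_condExp_sq_le (hm : m ≤ m₀) {f : Ω → ℝ}
    (hf : MemLp f 2 P) : ∫ ω, (P[f | m]) ω ^ 2 ∂P ≤ ∫ ω, f ω ^ 2 ∂P := by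
  have h := integral_sq_sub_condExp hm hf
  have h0 : 0 ≤ ∫ ω, (f ω - (P[f | m]) ω) ^ 2 ∂P := integral_nonneg fun _ => sq_nonneg _
  linarith

theorem integral_sq_sub_condExp_le (hm : m ≤ m₀) {f : Ω → ℝ}
    (hf : MemLp f 2 P) : ∫ ω, (f ω - (P[f | m]) ω) ^ 2 ∂P ≤ ∫ ω, f ω ^ 2 ∂P := by
  rw [integral_sq_sub_condExp hm hf]
  have h0 : 0 ≤ ∫ ω, (P[f | m]) ω ^ 2 ∂P := integral_nonneg fun _ => sq_nonneg _
  linarith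

theorem integral_sq_condExp_sub_condExp_le (hmm' : m ≤ m')
    (hm' : m' ≤ m₀) {f : Ω → ℝ} (hf : MemLp f 2 P) :
    ∫ ω, ((P[f | m']) ω - (P[f | m]) ω) ^ 2 ∂P ≤ ∫ ω, f ω ^ 2 ∂P := by
  have hE : MemLp (P[f | m']) 2 P := hf.condExp one_le_two
  refine le_trans (le_of_eq ?_)
    ((integral_sq_sub_condExp_le (hmm'.trans hm') hE).trans (integral_condExp_sq_le hm' hf))
  refine integral_congr_ae ?_
  filter_upwards [condExp_condExp_of_le (μ := P) (f := f) hmm' hm'] with ω hω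
  rw [hω]

/-- The **Efron-Stein inequality**, for σ-algebras `a i` which are conditionally independent
given `G`. -/
theorem integral_sq_condExp_sub_le_sum {ι : Type*} [DecidableEq ι] (s : Finset ι)
    {G : MeasurableSpace Ω} {a n : ι → MeasurableSpace Ω} (ha : ∀ i, a i ≤ m₀)
    (hn : ∀ i, n i ≤ m₀) (hGn : ∀ i, G ≤ n i) (han : ∀ i j, j ≠ i → a j ≤ n i)
    (hind : ∀ i, ∀ A, MeasurableSet[a i] A → P⟦A | n i⟧ =ᵐ[P] P⟦A | G⟧)
    {X : Ω → ℝ} (hX : MemLp X 2 P) {Y : ι → Ω → ℝ} (hY : ∀ i, StronglyMeasurable[n i] (Y i))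
    (hY2 : ∀ i, MemLp (Y i) 2 P) :
    ∫ ω, ((P[X | G ⊔ ⨆ i ∈ s, a i]) ω - (P[X | G]) ω) ^ 2 ∂P ≤
      ∑ i ∈ s, ∫ ω, (X ω - Y i ω) ^ 2 ∂P := by
  induction s using Finset.induction_on with
  | empty => simp
  | insert k s hk ih =>
    rw [Finset.sum_insert hk]
    set F := G ⊔ ⨆ i ∈ s, a i with hF
    have hF' : G ⊔ ⨆ i ∈ insert k s, a i = F ⊔ a k := by
      rw [Finset.iSup_insert, hF, sup_comm (a k), sup_assoc]
    have hFn : F ≤ n k := sup_le (hGn k) (iSup₂_le fun j hj =>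
      han k j (fun h => hk (h ▸ hj)))
    have hF0 : F ≤ m₀ := hFn.trans (hn k)
    have hF0' : F ⊔ a k ≤ m₀ := sup_le hF0 (ha k)
    rw [hF']
    have hY' := condExp_sup_eq_of_indep (hn k) le_sup_left hFn (ha k) (hind k) (hY k) (hY2 k)
    have hZ : MemLp (X - Y k) 2 P := hX.sub (hY2 k)
    have hX1 := hX.integrable one_le_two
    have hY1 := (hY2 k).integrable one_le_two
    -- By `hY'` the increment of the conditional expectation of `Y k` vanishes, so the increment for
    -- `X` is that for `X - Y k`.
    have hstep : ∫ ω, ((P[X | F ⊔ a k]) ω - (P[X | F]) ω) ^ 2 ∂P ≤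
        ∫ ω, (X ω - Y k ω) ^ 2 ∂P := by
      refine le_trans (le_of_eq ?_) (integral_sq_condExp_sub_condExp_le le_sup_left hF0' hZ)
      refine integral_congr_ae ?_
      filter_upwards [condExp_sub hX1 hY1 F, condExp_sub hX1 hY1 (F ⊔ a k), hY'] with ω h1 h2 h3
      change _ = ((P[X - Y k | F ⊔ a k]) ω - (P[X - Y k | F]) ω) ^ 2
      rw [h1, h2, Pi.sub_apply, Pi.sub_apply, h3]
      ring
    have hE1 : MemLp (P[X | F ⊔ a k]) 2 P := hX.condExp one_le_two
    have hE2 : MemLp (P[X | F]) 2 P := hX.condExp one_le_two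
    have hE3 : MemLp (P[X | G]) 2 P := hX.condExp one_le_two
    have hD : MemLp (P[X | F] - P[X | G]) 2 P := hE2.sub hE3
    -- Orthogonality of martingale increments: the sum of the earlier ones is `F`-measurable and the
    -- new one has zero conditional mean given `F`.
    have horth : ∫ ω, (P[X | F] - P[X | G]) ω * ((P[X | F ⊔ a k]) ω - (P[X | F]) ω) ∂P = 0 := by
      have hmeas : StronglyMeasurable[F] (P[X | F] - P[X | G]) :=
        stronglyMeasurable_condExp.sub (stronglyMeasurable_condExp.mono le_sup_left)
      have e1 := integral_mul_condExp hF0 hmeas hD hE1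
      have e2 : ∫ ω, (P[X | F] - P[X | G]) ω * (P[P[X | F ⊔ a k] | F]) ω ∂P =
          ∫ ω, (P[X | F] - P[X | G]) ω * (P[X | F]) ω ∂P := by
        refine integral_congr_ae ?_
        filter_upwards [condExp_condExp_of_le (μ := P) (f := X)
          (le_sup_left : F ≤ F ⊔ a k) hF0'] with ω hω
        rw [hω]
      simp_rw [mul_sub]
      have e3 := integral_sub (hD.integrable_mul hE1) (hD.integrable_mul hE2)
      refine e3.trans ?_
      simp only [Pi.mul_apply]
      rw [e1, e2, sub_self]
    have hexp : ∫ ω, ((P[X | F ⊔ a k]) ω - (P[X | G]) ω) ^ 2 ∂P =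
        ∫ ω, ((P[X | F ⊔ a k]) ω - (P[X | F]) ω) ^ 2 ∂P +
          ∫ ω, ((P[X | F]) ω - (P[X | G]) ω) ^ 2 ∂P := by
      have e : ∀ ω, ((P[X | F ⊔ a k]) ω - (P[X | G]) ω) ^ 2 =
          ((P[X | F ⊔ a k]) ω - (P[X | F]) ω) ^ 2 + ((P[X | F]) ω - (P[X | G]) ω) ^ 2 +
          2 * ((P[X | F] - P[X | G]) ω * ((P[X | F ⊔ a k]) ω - (P[X | F]) ω)) := fun ω => by
        simp only [Pi.sub_apply]; ring
      simp_rw [e]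
      rw [integral_add, integral_add, integral_const_mul, horth]
      · ring
      · exact (hE1.sub hE2).integrable_sq
      · exact hD.integrable_sq
      · exact (hE1.sub hE2).integrable_sq.add hD.integrable_sq
      · exact (hD.integrable_mul (hE1.sub hE2)).const_mul 2
    linarith

end CondExp

/-! ### Distances patched together from a reference weight and internal metrics. -/

section PatchedWeight

variable {U : Opens ℂ} {ι : Type*} [DecidableEq ι]

/-- The weight of a step from `p` to `q`, either measured by the reference weight `r`, or by the
internal metric of `d` on one of the sets `S i`, `i ∈ s`. -/
noncomputable def patchedWeight (r : U → U → ℝ≥0∞) (d : U → U → ℝ) (S : ι → Set ℂ) (s : Finset ι)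
    (p q : U) : ℝ≥0∞ :=
  min (r p q) (⨅ i ∈ s, internalMetric d (S i) p q)

/-- The chain distance with respect to the patched weights. -/
noncomputable def patchedDist (Q : Set U) (r : U → U → ℝ≥0∞) (d : U → U → ℝ) (S : ι → Set ℂ)
    (s : Finset ι) (x y : Q) : ℝ≥0∞ :=
  chainInf (fun p q : Q => patchedWeight r d S s p q) x y

variable {r : U → U → ℝ≥0∞} {d : U → U → ℝ} {S : ι → Set ℂ} {s : Finset ι} {Q : Set U}

omit [DecidableEq ι] in
theorem ofReal_le_patchedWeight (hd : IsContinuousLengthMetric d)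
    {p q : U} (hr : ENNReal.ofReal (d p q) ≤ r p q) :
    ENNReal.ofReal (d p q) ≤ patchedWeight r d S s p q :=
  le_min hr (le_iInf₂ fun _ _ => ofReal_le_internalMetric hd _ _ _)

omit [DecidableEq ι] in
theorem ofReal_le_patchedDist (hd : IsContinuousLengthMetric d)
    (hr : ∀ p q : Q, ENNReal.ofReal (d p q) ≤ r p q) (x y : Q) :
    ENNReal.ofReal (d x y) ≤ patchedDist Q r d S s x y := by
  refine le_chainInf (f := fun p q : Q => ENNReal.ofReal (d p q)) ?_ (fun p q => ?_) fun p q =>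
    ofReal_le_patchedWeight hd (hr p q)
  · simp [hd.dist_self]
  · exact (ENNReal.ofReal_le_ofReal (hd.triangle _ _ _)).trans ENNReal.ofReal_add_le

theorem patchedDist_le_erase (x y : Q) (i : ι) :
    patchedDist Q r d S s x y ≤ patchedDist Q r d S (s.erase i) x y := by
  refine chainInf_mono (fun p q => ?_) x y
  exact min_le_min le_rfl (biInf_mono fun j hj => Finset.mem_of_mem_erase hj)

omit [DecidableEq ι] in
theorem patchedDist_le (x y : Q) : patchedDist Q r d S s x y ≤ r x y :=
  (chainInf_le _ x y).trans (min_le_left _ _)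

/-- The total effect of omitting each one of the patches. -/
theorem sum_patchedDist_erase_sub_le (hd : IsContinuousLengthMetric d) {K : ℝ≥0∞} (hK : K ≠ ⊤)
    (hr : ∀ p q : Q, ENNReal.ofReal (d p q) ≤ r p q)
    (hr' : ∀ p q : Q, r p q ≤ K * ENNReal.ofReal (d p q)) (x y : Q) :
    ∑ i ∈ s, (patchedDist Q r d S (s.erase i) x y - patchedDist Q r d S s x y) ≤
      K * patchedDist Q r d S s x y := by
  set X := patchedDist Q r d S s x y with hX
  have hXtop : X ≠ ⊤ := ne_top_of_le_ne_top (ENNReal.mul_ne_top hK ENNReal.ofReal_ne_top)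
    ((patchedDist_le x y).trans (hr' x y))
  -- The infimum need not be attained, so the argument runs along a chain within `e` of optimal, and
  -- `e` is sent to zero at the end.
  have key : ∀ e : ℝ≥0∞, e ≠ 0 → e ≠ ⊤ →
      ∑ i ∈ s, (patchedDist Q r d S (s.erase i) x y - X) ≤ K * X + (s.card + K) * e := by
    intro e he he'
    obtain ⟨n, q, h0, h1, hlt⟩ := exists_chain_of_chainInf_lt
      (ENNReal.lt_add_right hXtop he : X < X + e)
    -- Each step is charged to at most one patch `τ`, the one realizing its weight. Erasing any
    -- other patch leaves the weight no larger; erasing `τ` allows the fallback `r ≤ K d`, at most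
    -- `K` times the old weight.
    have hτ : ∀ k, ∃ τ : Option ι, ∀ i, patchedWeight r d S (s.erase i) (q k) (q (k + 1)) ≤
        patchedWeight r d S s (q k) (q (k + 1)) +
          if τ = some i then K * patchedWeight r d S s (q k) (q (k + 1)) else 0 := by
      intro k
      rcases le_total (r (q k) (q (k + 1)))
        (⨅ i ∈ s, internalMetric d (S i) (q k : U) (q (k + 1))) with h | h
      · refine ⟨none, fun i => ?_⟩
        simp only [reduceCtorEq, if_false, add_zero]
        rw [patchedWeight, patchedWeight, min_eq_left h]
        exact min_le_left _ _
      · rcases s.eq_empty_or_nonempty with rfl | hs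
        · exact ⟨none, fun i => by simp⟩
        obtain ⟨j, hj, hjmin⟩ := s.exists_min_image
          (fun i => internalMetric d (S i) (q k : U) (q (k + 1))) hs
        have hw : patchedWeight r d S s (q k) (q (k + 1)) =
            internalMetric d (S j) (q k : U) (q (k + 1)) := by
          rw [patchedWeight, min_eq_right h]
          exact le_antisymm (iInf₂_le j hj) (le_iInf₂ hjmin)
        refine ⟨some j, fun i => ?_⟩
        split_ifs with hij
        · refine le_trans ?_ le_add_self
          refine (min_le_left _ _).trans ((hr' _ _).trans ?_)
          gcongr
          exact ofReal_le_patchedWeight hd (hr _ _)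
        · rw [add_zero, hw]
          refine (min_le_right _ _).trans (iInf₂_le j (Finset.mem_erase.2 ⟨?_, hj⟩))
          rintro rfl
          exact hij rfl
    choose τ hτ using hτ
    set W : ℕ → ℝ≥0∞ := fun k => patchedWeight r d S s (q k) (q (k + 1)) with hW
    have hY : ∀ i, patchedDist Q r d S (s.erase i) x y - X ≤
        e + ∑ k ∈ Finset.range n, if τ k = some i then K * W k else 0 := by
      intro i
      rw [tsub_le_iff_left, ← add_assoc]
      have h2 := chainInf_le_sum (fun p q : Q => patchedWeight r d S (s.erase i) p q) n q
      rw [h0, h1] at h2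
      refine h2.trans ((Finset.sum_le_sum fun k _ => hτ k i).trans ?_)
      rw [Finset.sum_add_distrib]
      gcongr
    calc ∑ i ∈ s, (patchedDist Q r d S (s.erase i) x y - X)
        ≤ ∑ i ∈ s, (e + ∑ k ∈ Finset.range n, if τ k = some i then K * W k else 0) :=
          Finset.sum_le_sum fun i _ => hY i
      _ = s.card * e + ∑ k ∈ Finset.range n, ∑ i ∈ s, if τ k = some i then K * W k else 0 := by
          rw [Finset.sum_add_distrib, Finset.sum_const, nsmul_eq_mul, Finset.sum_comm]
      -- After exchanging the sums, at most one index `i` contributes for each step `k`.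
      _ ≤ s.card * e + ∑ k ∈ Finset.range n, K * W k := by
          gcongr with k _
          rcases hk : τ k with _ | j
          · simp
          · simp only [Option.some.injEq, Finset.sum_ite_eq]
            split_ifs <;> simp
      _ ≤ s.card * e + K * (X + e) := by
          rw [← Finset.mul_sum]
          gcongr
      _ = K * X + (s.card + K) * e := by ring
  refine ENNReal.le_of_forall_pos_le_add fun ε hε _ => ?_
  have hc : (s.card + K : ℝ≥0∞) ≠ ⊤ := ENNReal.add_ne_top.2 ⟨ENNReal.natCast_ne_top _, hK⟩
  refine (key (ε / (s.card + K + 1)) ?_ ?_).trans ?_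
  · exact (ENNReal.div_pos (by exact_mod_cast hε.ne') (by finiteness)).ne'
  · exact ENNReal.div_ne_top ENNReal.coe_ne_top (by simp)
  · gcongr
    rw [← mul_div_assoc]
    refine ENNReal.div_le_of_le_mul ?_
    rw [mul_comm]
    exact mul_le_mul' le_rfl le_self_add

end PatchedWeight

/-! ### Truncation -/

/-- The truncation of an extended non-negative real number at `R`. -/
noncomputable def trunc (R : ℝ) (t : ℝ≥0∞) : ℝ := (min t (ENNReal.ofReal R)).toReal

section Trunc

variable {R : ℝ}

theorem measurable_trunc (R : ℝ) : Measurable (trunc R) :=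
  (measurable_id.min measurable_const).ennreal_toReal

theorem trunc_nonneg (t : ℝ≥0∞) : 0 ≤ trunc R t := ENNReal.toReal_nonneg

theorem trunc_le (hR : 0 ≤ R) (t : ℝ≥0∞) : trunc R t ≤ R := by
  refine (ENNReal.toReal_mono ENNReal.ofReal_ne_top (min_le_right _ _)).trans ?_
  rw [ENNReal.toReal_ofReal hR]

theorem trunc_mono {t u : ℝ≥0∞} (h : t ≤ u) : trunc R t ≤ trunc R u :=
  ENNReal.toReal_mono (ne_top_of_le_ne_top ENNReal.ofReal_ne_top (min_le_right _ _))
    (min_le_min_right _ h)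

theorem trunc_ofReal {t : ℝ} (ht : 0 ≤ t) (hR : 0 ≤ R) : trunc R (ENNReal.ofReal t) = min t R := by
  rw [trunc, ← ENNReal.ofReal_min, ENNReal.toReal_ofReal (le_min ht hR)]

theorem trunc_of_ge {t : ℝ≥0∞} (hR : 0 ≤ R) (ht : ENNReal.ofReal R ≤ t) : trunc R t = R := by
  rw [trunc, min_eq_right ht, ENNReal.toReal_ofReal hR]

theorem trunc_add_le {c : ℝ} {t u : ℝ≥0∞} (hc : 0 ≤ c) (h : t ≤ u + ENNReal.ofReal c) :
    trunc R t ≤ trunc R u + c := by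
  have h1 : min t (ENNReal.ofReal R) ≤ min u (ENNReal.ofReal R) + ENNReal.ofReal c := by
    rcases le_total u (ENNReal.ofReal R) with h' | h'
    · rw [min_eq_left h']; exact (min_le_left _ _).trans h
    · rw [min_eq_right h']; exact (min_le_right _ _).trans le_self_add
  have hfin : min u (ENNReal.ofReal R) ≠ ⊤ :=
    ne_top_of_le_ne_top ENNReal.ofReal_ne_top (min_le_right _ _)
  have h2 := ENNReal.toReal_mono (ENNReal.add_ne_top.2 ⟨hfin, ENNReal.ofReal_ne_top⟩) h1
  rwa [ENNReal.toReal_add hfin ENNReal.ofReal_ne_top, ENNReal.toReal_ofReal hc] at h2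

/-- A sum of squares is at most the maximum times the sum: each truncated difference is at most `c`,
and together they are at most `K X'`. If `X' ≥ R`, all truncations in the sum equal `R` and it
vanishes; otherwise `K X' ≤ K R`. -/
theorem sum_sq_trunc_le {ι : Type*} {s : Finset ι} {K c : ℝ} (hR : 0 ≤ R) (hK : 0 ≤ K)
    (hc : 0 ≤ c) {X X' : ℝ≥0∞} {Y : ι → ℝ≥0∞} (hX : X ≤ X') (hY : ∀ i ∈ s, X' ≤ Y i)
    (hsum : ∑ i ∈ s, (Y i - X') ≤ ENNReal.ofReal K * X')
    (h0 : trunc R X' ≤ trunc R X + c) (h : ∀ i ∈ s, trunc R (Y i) ≤ trunc R X + c) :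
    (trunc R X - trunc R X') ^ 2 + ∑ i ∈ s, (trunc R X' - trunc R (Y i)) ^ 2 ≤
      (R + K * R) * c := by
  have hXX := trunc_mono (R := R) hX
  have hX'R := trunc_le hR X'
  have hX0 := trunc_nonneg (R := R) X
  have h1 : (trunc R X - trunc R X') ^ 2 ≤ R * c := by nlinarith
  have h2 : ∑ i ∈ s, (trunc R X' - trunc R (Y i)) ^ 2 ≤ K * R * c := by
    rcases le_or_gt (ENNReal.ofReal R) X' with hge | hlt
    · have : ∑ i ∈ s, (trunc R X' - trunc R (Y i)) ^ 2 = 0 := by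
        refine Finset.sum_eq_zero fun i hi => ?_
        rw [trunc_of_ge hR hge, trunc_of_ge hR (hge.trans (hY i hi))]
        simp
      rw [this]
      positivity
    · have hX'top : X' ≠ ⊤ := (hlt.trans_le le_top).ne
      have hfin : ENNReal.ofReal K * X' ≠ ⊤ := ENNReal.mul_ne_top ENNReal.ofReal_ne_top hX'top
      have hYtop : ∀ i ∈ s, Y i - X' ≠ ⊤ := fun i hi =>
        ne_top_of_le_ne_top hfin ((Finset.single_le_sum (f := fun i => Y i - X')
          (fun _ _ => zero_le) hi).trans hsum)
      have hX'eq : trunc R X' = X'.toReal := by rw [trunc, min_eq_left hlt.le]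
      have hterm : ∀ i ∈ s, (trunc R X' - trunc R (Y i)) ^ 2 ≤ c * (Y i - X').toReal := by
        intro i hi
        have ha : trunc R (Y i) ≤ trunc R X' + (Y i - X').toReal := by
          refine trunc_add_le ENNReal.toReal_nonneg ?_
          rw [ENNReal.ofReal_toReal (hYtop i hi)]
          exact le_add_tsub
        have hb := h i hi
        have hc' := trunc_mono (R := R) (hY i hi)
        have hd : 0 ≤ (Y i - X').toReal := ENNReal.toReal_nonneg
        nlinarith
      refine (Finset.sum_le_sum hterm).trans ?_
      rw [← Finset.mul_sum, ← ENNReal.toReal_sum hYtop]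
      have h3 := ENNReal.toReal_mono hfin hsum
      rw [ENNReal.toReal_mul, ENNReal.toReal_ofReal hK, ← hX'eq] at h3
      calc c * (∑ i ∈ s, (Y i - X')).toReal ≤ c * (K * R) := by
            gcongr
            exact h3.trans (by gcongr)
        _ = K * R * c := by ring
  linarith

end Trunc

/-! ### Shifted grids of squares. -/

section Grid

/-- The spacing of the finest lines of the `n`-th family of grids. -/
noncomputable def gridSpacing (n : ℕ) : ℝ := 1 / ((n : ℝ) + 1) ^ 2

/-- The position of the `a`-th line of the `j`-th shift of the `n`-th grid. -/
noncomputable def gridLine (n j : ℕ) (a : ℤ) : ℝ := (j + a * ((n : ℝ) + 1)) * gridSpacing n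

/-- The squares of side `1 / (n + 1)`, intersected with `U`, of the `j`-th shift of the
`n`-th grid. -/
def gridSquare (U : Opens ℂ) (n j : ℕ) (i : ℤ × ℤ) : Set ℂ :=
  {z | z ∈ U ∧ (gridLine n j i.1 < z.re ∧ z.re < gridLine n j (i.1 + 1)) ∧
    (gridLine n j i.2 < z.im ∧ z.im < gridLine n j (i.2 + 1))}

/-- The indices of the squares in a large box. -/
noncomputable def gridBox (n : ℕ) : Finset (ℤ × ℤ) :=
  Finset.Icc (-((n : ℤ) + 1) ^ 2) (((n : ℤ) + 1) ^ 2) ×ˢ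
    Finset.Icc (-((n : ℤ) + 1) ^ 2) (((n : ℤ) + 1) ^ 2)

/-- The number `u` is close to a line of the `j`-th shift of the `n`-th grid. -/
def NearGridLine (n j : ℕ) (u : ℝ) : Prop := ∃ a : ℤ, |u - gridLine n j a| ≤ gridSpacing n / 4

variable {U : Opens ℂ} {n j : ℕ}

theorem gridSpacing_pos (n : ℕ) : 0 < gridSpacing n := by unfold gridSpacing; positivity

theorem gridLine_succ (n j : ℕ) (a : ℤ) : gridLine n j (a + 1) = gridLine n j a + 1 / (n + 1) := by
  unfold gridLine gridSpacing
  push_cast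
  field_simp
  ring

theorem gridLine_mono (n j : ℕ) : Monotone (gridLine n j) := by
  intro a b hab
  have hab' : (a : ℝ) ≤ b := by exact_mod_cast hab
  have := (gridSpacing_pos n).le
  unfold gridLine
  gcongr

theorem isOpen_gridSquare (U : Opens ℂ) (n j : ℕ) (i : ℤ × ℤ) : IsOpen (gridSquare U n j i) := by
  refine U.isOpen.inter (IsOpen.inter (IsOpen.inter ?_ ?_) (IsOpen.inter ?_ ?_))
  · exact isOpen_lt continuous_const Complex.continuous_re
  · exact isOpen_lt Complex.continuous_re continuous_const
  · exact isOpen_lt continuous_const Complex.continuous_im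
  · exact isOpen_lt Complex.continuous_im continuous_const

theorem gridSquare_subset (U : Opens ℂ) (n j : ℕ) (i : ℤ × ℤ) : gridSquare U n j i ⊆ U :=
  fun _ h => h.1

theorem disjoint_gridSquare {i i' : ℤ × ℤ} (h : i ≠ i') :
    Disjoint (gridSquare U n j i) (gridSquare U n j i') := by
  have key : ∀ {a b : ℤ} {u : ℝ}, gridLine n j a < u → u < gridLine n j (a + 1) →
      gridLine n j b < u → u < gridLine n j (b + 1) → a = b := by
    intro a b u h1 h2 h3 h4
    by_contra hne
    rcases lt_or_gt_of_ne hne with hlt | hlt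
    · exact absurd (h2.trans_le (gridLine_mono n j (by omega : a + 1 ≤ b))) h3.not_gt
    · exact absurd (h4.trans_le (gridLine_mono n j (by omega : b + 1 ≤ a))) h1.not_gt
  rw [Set.disjoint_left]
  rintro z ⟨-, ⟨h1, h2⟩, h3, h4⟩ ⟨-, ⟨h1', h2'⟩, h3', h4'⟩
  exact h (Prod.ext (key h1 h2 h1' h2') (key h3 h4 h3' h4'))

theorem norm_sub_le_of_mem_gridSquare {i : ℤ × ℤ} {z w : ℂ} (hz : z ∈ gridSquare U n j i)
    (hw : w ∈ gridSquare U n j i) : ‖z - w‖ ≤ 2 / ((n : ℝ) + 1) := by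
  obtain ⟨-, ⟨h1, h2⟩, h3, h4⟩ := hz
  obtain ⟨-, ⟨h1', h2'⟩, h3', h4'⟩ := hw
  rw [gridLine_succ] at h2 h4 h2' h4'
  have e : (2 : ℝ) / ((n : ℝ) + 1) = 1 / ((n : ℝ) + 1) + 1 / ((n : ℝ) + 1) := by ring
  refine (Complex.norm_le_abs_re_add_abs_im _).trans ?_
  rw [e, Complex.sub_re, Complex.sub_im]
  refine add_le_add (abs_le.2 ⟨?_, ?_⟩) (abs_le.2 ⟨?_, ?_⟩) <;> linarith

open Classical in
-- The lines of all shifts sit at integer multiples `j + a (n + 1)` of the spacing, and this integer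
-- modulo `n + 1` recovers `j`. Two lines within a quarter spacing of `u` are less than one spacing
-- apart, so they coincide.
theorem card_nearGridLine_le_one (n : ℕ) (u : ℝ) :
    ((Finset.range (n + 1)).filter fun j => NearGridLine n j u).card ≤ 1 := by
  rw [Finset.card_le_one]
  intro j hj j' hj'
  simp only [Finset.mem_filter, Finset.mem_range] at hj hj'
  obtain ⟨hjn, a, ha⟩ := hj
  obtain ⟨hjn', a', ha'⟩ := hj'
  have hρ := gridSpacing_pos n
  have h1 : |gridLine n j a - gridLine n j' a'| ≤ gridSpacing n / 2 := by
    rw [abs_le] at *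
    constructor <;> linarith [ha.1, ha.2, ha'.1, ha'.2]
  have h2 : gridLine n j a - gridLine n j' a' =
      (((j + a * (n + 1) - (j' + a' * (n + 1)) : ℤ)) : ℝ) * gridSpacing n := by
    unfold gridLine; push_cast; ring
  rw [h2, abs_mul, abs_of_pos hρ] at h1
  have h3 : |(((j + a * (n + 1) - (j' + a' * (n + 1)) : ℤ)) : ℝ)| < 1 := by
    by_contra hcon
    have := mul_le_mul_of_nonneg_right (not_lt.1 hcon) hρ.le
    linarith
  have h4 : |(j + a * (n + 1) - (j' + a' * (n + 1)) : ℤ)| < 1 := by exact_mod_cast h3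
  rw [Int.abs_lt_one_iff] at h4
  have h5 : (j : ℤ) % ((n + 1 : ℕ) : ℤ) = (j' : ℤ) % ((n + 1 : ℕ) : ℤ) := by
    have : (j : ℤ) = j' + (a' - a) * ((n + 1 : ℕ) : ℤ) := by push_cast; linarith
    rw [this, Int.add_mul_emod_self_right]
  rw [Int.emod_eq_of_lt (by omega) (by omega), Int.emod_eq_of_lt (by omega) (by omega)] at h5
  exact_mod_cast h5

theorem exists_gridInterval {u B : ℝ} (hu : ¬NearGridLine n j u) (hj : j ≤ n) (hB : |u| ≤ B)
    (hBn : B + 3 ≤ (n : ℝ) + 1) :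
    ∃ a ∈ Finset.Icc (-((n : ℤ) + 1) ^ 2) (((n : ℤ) + 1) ^ 2), ∀ v : ℝ,
      |v - u| < gridSpacing n / 4 → gridLine n j a < v ∧ v < gridLine n j (a + 1) := by
  have hρ := gridSpacing_pos n
  have hn : (0 : ℝ) < (n : ℝ) + 1 := by positivity
  simp only [NearGridLine, not_exists, not_le] at hu
  -- The coordinate in units of the side of the squares; its integer part is the index sought.
  set x : ℝ := (u - j * gridSpacing n) * (n + 1) with hx
  have hline : ∀ a : ℤ, gridLine n j a = j * gridSpacing n + a / (n + 1) := by
    intro a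
    unfold gridLine gridSpacing
    field_simp
  have hux : u = j * gridSpacing n + x / (n + 1) := by rw [hx]; field_simp; ring
  have h1 : gridLine n j ⌊x⌋ ≤ u := by
    rw [hline]; conv_rhs => rw [hux]
    gcongr
    exact Int.floor_le x
  have h2 : u < gridLine n j (⌊x⌋ + 1) := by
    rw [hline]; conv_lhs => rw [hux]
    gcongr
    push_cast
    exact Int.lt_floor_add_one x
  have h3 := hu ⌊x⌋
  have h4 := hu (⌊x⌋ + 1)
  rw [abs_of_nonneg (by linarith)] at h3
  rw [abs_of_neg (by linarith)] at h4
  refine ⟨⌊x⌋, ?_, fun v hv => ?_⟩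
  · have hjρ : 0 ≤ j * gridSpacing n := by positivity
    have hjρ' : j * gridSpacing n ≤ 1 := by
      have hjn : (j : ℝ) ≤ n := by exact_mod_cast hj
      unfold gridSpacing
      rw [mul_one_div, div_le_one (by positivity)]
      nlinarith [Nat.cast_nonneg (α := ℝ) n]
    -- In the margin `B + 3 ≤ n + 1`, one unit absorbs the shift and the other two keep the index
    -- inside the box.
    have hub : |u - j * gridSpacing n| ≤ (n : ℝ) + 1 - 2 := by
      rw [abs_le] at *
      constructor <;> linarith [hB.1, hB.2]
    have hxb : |x| ≤ ((n : ℝ) + 1) ^ 2 - 1 := by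
      rw [hx, abs_mul, abs_of_pos hn]
      nlinarith [Nat.cast_nonneg (α := ℝ) n]
    rw [abs_le] at hxb
    rw [Finset.mem_Icc]
    constructor
    · have : (-((n : ℝ) + 1) ^ 2) ≤ x := by linarith [hxb.1]
      rw [Int.le_floor]
      push_cast
      exact this
    · have : x < (((n : ℤ) + 1) ^ 2 : ℤ) := by push_cast; linarith [hxb.2]
      exact (Int.floor_lt.2 this).le
  · rw [abs_lt] at hv
    constructor <;> linarith [hv.1, hv.2]

theorem exists_gridSquare {z : ℂ} {B : ℝ} (hre : ¬NearGridLine n j z.re)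
    (him : ¬NearGridLine n j z.im) (hj : j ≤ n) (hB : ‖z‖ ≤ B) (hBn : B + 3 ≤ (n : ℝ) + 1) :
    ∃ i ∈ gridBox n, ∀ w ∈ U, ‖w - z‖ < gridSpacing n / 4 → w ∈ gridSquare U n j i := by
  obtain ⟨a, ha, ha'⟩ := exists_gridInterval hre hj ((Complex.abs_re_le_norm z).trans hB) hBn
  obtain ⟨b, hb, hb'⟩ := exists_gridInterval him hj ((Complex.abs_im_le_norm z).trans hB) hBn
  refine ⟨(a, b), Finset.mem_product.2 ⟨ha, hb⟩, fun w hw hwz => ⟨hw, ha' _ ?_, hb' _ ?_⟩⟩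
  · rw [← Complex.sub_re]; exact (Complex.abs_re_le_norm _).trans_lt hwz
  · rw [← Complex.sub_im]; exact (Complex.abs_im_le_norm _).trans_lt hwz

end Grid

/-! ### Almost geodesic chains. -/

section AlmostGeodesic

variable {X : Type*} [PseudoMetricSpace X]

/-- A part of an almost geodesic chain is almost geodesic. -/
theorem sum_Ico_dist_le_of_almost_geodesic {q : ℕ → X} {n : ℕ} {e : ℝ}
    (h : ∑ k ∈ Finset.range n, dist (q k) (q (k + 1)) ≤ dist (q 0) (q n) + e) {a b : ℕ}
    (hab : a ≤ b) (hbn : b ≤ n) :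
    ∑ k ∈ Finset.Ico a b, dist (q k) (q (k + 1)) ≤ dist (q a) (q b) + e := by
  have h1 : ∑ k ∈ Finset.range n, dist (q k) (q (k + 1)) =
      ∑ k ∈ Finset.Ico 0 a, dist (q k) (q (k + 1)) + ∑ k ∈ Finset.Ico a b, dist (q k) (q (k + 1))
        + ∑ k ∈ Finset.Ico b n, dist (q k) (q (k + 1)) := by
    rw [Finset.sum_Ico_consecutive _ (Nat.zero_le a) hab,
      Finset.sum_Ico_consecutive _ (Nat.zero_le b) hbn, Finset.range_eq_Ico]
  have h2 := dist_le_Ico_sum_dist q (Nat.zero_le a)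
  have h3 := dist_le_Ico_sum_dist q hbn
  have h4 := dist_triangle4 (q 0) (q a) (q b) (q n)
  linarith

open Classical in
/-- The steps of an almost geodesic chain which start in a set of small diameter. -/
theorem sum_dist_of_mem_le {q : ℕ → X} {n : ℕ} {e r δ : ℝ} (hδ : ∀ k, dist (q k) (q (k + 1)) ≤ δ)
    (h : ∑ k ∈ Finset.range n, dist (q k) (q (k + 1)) ≤ dist (q 0) (q n) + e) (he : 0 ≤ e)
    (hr : 0 ≤ r) {p : ℕ → Prop} (hp : ∀ a b, p a → p b → dist (q a) (q b) ≤ r) :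
    ∑ k ∈ Finset.range n, (if p k then dist (q k) (q (k + 1)) else 0) ≤ r + δ + e := by
  have hδ0 : 0 ≤ δ := dist_nonneg.trans (hδ 0)
  rw [← Finset.sum_filter]
  rcases (Finset.filter p (Finset.range n)).eq_empty_or_nonempty with h0 | h0
  · rw [h0, Finset.sum_empty]; positivity
  -- All relevant steps lie between the first and the last visit to the set, and that portion of the
  -- chain is itself almost geodesic between points at distance at most `r`, up to one last step.
  set a := (Finset.filter p (Finset.range n)).min' h0
  set b := (Finset.filter p (Finset.range n)).max' h0
  have ha := Finset.mem_filter.1 (Finset.min'_mem _ h0)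
  have hb := Finset.mem_filter.1 (Finset.max'_mem _ h0)
  have hab : a ≤ b := Finset.min'_le_max' _ h0
  have hbn : b < n := Finset.mem_range.1 hb.1
  calc ∑ k ∈ Finset.range n with p k, dist (q k) (q (k + 1))
      ≤ ∑ k ∈ Finset.Ico a (b + 1), dist (q k) (q (k + 1)) := by
        refine Finset.sum_le_sum_of_subset_of_nonneg (fun k hk => ?_) fun _ _ _ => dist_nonneg
        exact Finset.mem_Ico.2 ⟨Finset.min'_le _ _ hk, Nat.lt_succ_of_le (Finset.le_max' _ _ hk)⟩
    _ ≤ dist (q a) (q (b + 1)) + e :=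
        sum_Ico_dist_le_of_almost_geodesic h (by omega) (by omega)
    _ ≤ r + δ + e := by
        have := dist_triangle (q a) (q b) (q (b + 1))
        linarith [hp a b ha.2 hb.2, hδ b]

end AlmostGeodesic

/-! ### Erasing one square of a fine grid has a small effect. -/

section FineChain

/-- Almost geodesic chains in `Q` from `x` to `y`, with arbitrarily small steps but with uniform
control on the comparison of the distance with the one which is induced by `f`. -/
theorem exists_fine_chain {X : Type*} [PseudoMetricSpace X] (hX : IsLengthSpace X) {f : X → ℂ}
    (hf : Continuous f) (hinj : Function.Injective f) {Q : Set X} (hQ : Dense Q) (x y : Q) {η : ℝ}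
    (hη : 0 < η) :
    ∃ B ε : ℝ, 0 < ε ∧ ∀ ρ > 0, ∃ (n : ℕ) (q : ℕ → Q), q 0 = x ∧ q n = y ∧
      ∑ k ∈ Finset.range n, dist (q k : X) (q (k + 1)) ≤ dist (x : X) y + η ∧
      (∀ k, dist (q k : X) (q (k + 1)) ≤ η) ∧ (∀ k, ‖f (q k)‖ ≤ B) ∧
      (∀ k l, ‖f (q k) - f (q l)‖ < ε → dist (q k : X) (q l) ≤ η) ∧
      ∀ k, ∃ δ, dist (q k : X) (q (k + 1)) < δ ∧ ∀ z, dist (q k : X) z < δ → ‖f z - f (q k)‖ < ρ := by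
  obtain ⟨γ, hγ⟩ := hX x y (η / 2) (by linarith)
  obtain ⟨B, hB⟩ := (isCompact_range (hf.comp γ.continuous)).isBounded.exists_norm_le
  have hB' : ∀ s, ‖f (γ s)‖ ≤ B := fun s => hB _ ⟨s, rfl⟩
  -- By injectivity of `f` and compactness, the image distance has a positive minimum over the pairs
  -- of points of the curve that are at least `η / 3` apart. The resulting `ε` depends on the curve
  -- only, not on the scale `ρ` chosen afterwards.
  obtain ⟨ε, hε, hε'⟩ : ∃ ε > 0, ∀ s t, ‖f (γ s) - f (γ t)‖ < ε → dist (γ s) (γ t) < η / 3 := by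
    let T : Set (I × I) := {p | η / 3 ≤ dist (γ p.1) (γ p.2)}
    have hT : IsCompact T := by
      refine IsClosed.isCompact (isClosed_le continuous_const ?_)
      exact (γ.continuous.comp continuous_fst).dist (γ.continuous.comp continuous_snd)
    have hcont : Continuous fun p : I × I => ‖f (γ p.1) - f (γ p.2)‖ :=
      ((hf.comp (γ.continuous.comp continuous_fst)).sub
        (hf.comp (γ.continuous.comp continuous_snd))).norm
    rcases T.eq_empty_or_nonempty with h0 | h0
    · refine ⟨1, one_pos, fun s t _ => ?_⟩
      by_contra hcon
      have : (s, t) ∈ T := not_lt.1 hcon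
      rw [h0] at this
      exact this
    · obtain ⟨p, hp, hmin⟩ := hT.exists_isMinOn h0 hcont.continuousOn
      refine ⟨‖f (γ p.1) - f (γ p.2)‖, ?_, fun s t hst => ?_⟩
      · refine norm_pos_iff.2 (sub_ne_zero.2 fun h => ?_)
        have h1 := hinj h
        have h2 : η / 3 ≤ dist (γ p.1) (γ p.2) := hp
        rw [h1, dist_self] at h2
        linarith
      · by_contra hcon
        exact absurd hst (not_lt.2 (hmin (show (s, t) ∈ T from not_lt.1 hcon)))
  refine ⟨B + 1, ε / 2, by linarith, fun ρ hρ => ?_⟩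
  set ρ' := min (ρ / 2) (min (ε / 4) 1) with hρ'
  have hρ0 : 0 < ρ' := lt_min (by linarith) (lt_min (by linarith) one_pos)
  have hρ1 : ρ' ≤ ρ / 2 := min_le_left _ _
  have hρ2 : ρ' ≤ ε / 4 := (min_le_right _ _).trans (min_le_left _ _)
  have hρ3 : ρ' ≤ 1 := (min_le_right _ _).trans (min_le_right _ _)
  obtain ⟨δ₁, hδ₁, hδ'⟩ : ∃ δ > 0, ∀ t z, dist (γ t) z < δ → ‖f z - f (γ t)‖ < ρ' := by
    have h := (isCompact_range γ.continuous).uniformContinuousAt_of_continuousAt f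
      (fun a _ => hf.continuousAt) (Metric.dist_mem_uniformity hρ0)
    obtain ⟨δ, hδ, h⟩ := Metric.mem_uniformity_dist.1 h
    refine ⟨δ, hδ, fun t z hz => ?_⟩
    have := h hz ⟨t, rfl⟩
    rwa [Set.mem_ofPred_eq, dist_comm, dist_eq_norm] at this
  set δ := min (δ₁ / 2) (η / 3) with hδdef
  have hδ0 : 0 < δ := lt_min (by linarith) (by linarith)
  have hδ1 : δ ≤ δ₁ / 2 := min_le_left _ _
  have hδ2 : δ ≤ η / 3 := min_le_right _ _
  obtain ⟨n, q, s, h0, h1, hnear, hstep, hsum⟩ := exists_chain_near_path hQ x.2 y.2 γ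
    (L := dist (x : X) y + η / 2) (by positivity) hγ hδ0 (half_pos hη)
  have hfq : ∀ k, ‖f (q k) - f (γ (s k))‖ < ρ' := fun k =>
    hδ' _ _ (by rw [dist_comm]; linarith [hnear k])
  refine ⟨n, q, h0, h1, by linarith, fun k => by linarith [hstep k], fun k => ?_,
    fun k l hkl => ?_, fun k => ⟨δ, hstep k, fun z hz => ?_⟩⟩
  · have := norm_add_le (f (q k) - f (γ (s k))) (f (γ (s k)))
    rw [sub_add_cancel] at this
    linarith [hB' (s k), hfq k]
  · have h2 : ‖f (γ (s k)) - f (γ (s l))‖ < ε := by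
      have e : f (γ (s k)) - f (γ (s l)) = (f (q k) - f (q l)) - (f (q k) - f (γ (s k))) +
        (f (q l) - f (γ (s l))) := by ring
      rw [e]
      refine (norm_add_le _ _).trans_lt ?_
      linarith [norm_sub_le (f (q k) - f (q l)) (f (q k) - f (γ (s k))), hfq k, hfq l]
    have h3 := dist_triangle4 (q k : X) (γ (s k)) (γ (s l)) (q l)
    have h4 := hnear l
    rw [dist_comm] at h4
    linarith [hε' _ _ h2, hnear k]
  · have h2 : ‖f z - f (γ (s k))‖ < ρ' := by
      refine hδ' _ _ ?_
      have h3 := dist_triangle (γ (s k)) (q k) z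
      have h4 := hnear k
      rw [dist_comm] at h4
      linarith
    have e : f z - f (q k) = (f z - f (γ (s k))) - (f (q k) - f (γ (s k))) := by ring
    rw [e]
    refine (norm_sub_le _ _).trans_lt ?_
    linarith [hfq k]

variable {U : Opens ℂ} {r : U → U → ℝ≥0∞} {d : U → U → ℝ} {Q : Set U}

open Classical in
/-- Omitting one of the squares of a fine grid hardly changes the patched distances, up to an error
which is small for most of the shifts of the grid. -/
theorem exists_patchedDist_erase_le (hd : IsContinuousLengthMetric d) (hQ : Dense Q) {K : ℝ}
    (hK : 0 ≤ K) (hr : ∀ p q : Q, r p q ≤ ENNReal.ofReal K * ENNReal.ofReal (d p q)) (x y : Q)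
    {η : ℝ} (hη : 0 < η) :
    ∃ n₀ : ℕ, ∀ n ≥ n₀, ∃ bad : ℕ → ℝ, (∀ j, 0 ≤ bad j) ∧
      ∑ j ∈ Finset.range (n + 1), bad j ≤ 2 * (d x y + η) ∧
      ∀ j ≤ n, ∀ i, patchedDist Q r d (gridSquare U n j) ((gridBox n).erase i) x y ≤
        ENNReal.ofReal (d x y + η + K * (bad j + η)) := by
  have hd0 : ∀ p q, 0 ≤ d p q := fun p q => by
    have h := hd.triangle p q p
    rw [hd.dist_self, hd.symm q p] at h
    linarith
  obtain ⟨B, ε, hε, hchain⟩ := @exists_fine_chain U hd.toIsContinuousMetric.toPseudoMetricSpace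
    hd.isLengthSpace (fun z : U => (z : ℂ)) continuous_subtype_val Subtype.val_injective Q hQ x y
    (η / 3) (by linarith)
  obtain ⟨n₁, hn₁⟩ := exists_nat_gt (B + 3)
  obtain ⟨n₂, hn₂⟩ := exists_nat_gt (2 / ε)
  refine ⟨max n₁ n₂, fun n hn => ?_⟩
  have hBn : B + 3 ≤ (n : ℝ) + 1 := by
    have : (n₁ : ℝ) ≤ n := by exact_mod_cast (le_max_left _ _).trans hn
    linarith
  have hεn : 2 / ((n : ℝ) + 1) < ε := by
    have : (n₂ : ℝ) ≤ n := by exact_mod_cast (le_max_right _ _).trans hn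
    rw [div_lt_iff₀ hε] at hn₂
    rw [div_lt_iff₀ (by positivity)]
    nlinarith
  -- At this scale, a step that starts away from all lines of the grid has a `d`-ball around its
  -- start, containing its end, inside a single square.
  obtain ⟨N, q, h0, h1, hsum, hstep, hqB, hqε, hqδ⟩ := hchain (gridSpacing n / 4)
    (by linarith [gridSpacing_pos n])
  set δ : ℕ → ℝ := fun k => d (q k) (q (k + 1)) with hδ
  have hδ0 : ∀ k, 0 ≤ δ k := fun k => hd0 _ _
  replace hsum : ∑ k ∈ Finset.range N, δ k ≤ d x y + η / 3 := hsum
  let near : ℕ → ℕ → Prop := fun j k =>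
    NearGridLine n j (q k : ℂ).re ∨ NearGridLine n j (q k : ℂ).im
  refine ⟨fun j => ∑ k ∈ Finset.range N, if near j k then δ k else 0,
    fun j => Finset.sum_nonneg fun k _ => by split_ifs <;> [exact hδ0 k; rfl], ?_, ?_⟩
  · rw [Finset.sum_comm]
    have hk : ∀ k, ∑ j ∈ Finset.range (n + 1), (if near j k then δ k else 0) ≤ 2 * δ k := by
      intro k
      rw [← Finset.sum_filter, Finset.sum_const, nsmul_eq_mul]
      refine mul_le_mul_of_nonneg_right ?_ (hδ0 k)
      have hc := Finset.card_union_le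
        ((Finset.range (n + 1)).filter fun j => NearGridLine n j (q k : ℂ).re)
        ((Finset.range (n + 1)).filter fun j => NearGridLine n j (q k : ℂ).im)
      rw [← Finset.filter_or] at hc
      have h2 := card_nearGridLine_le_one n (q k : ℂ).re
      have h3 := card_nearGridLine_le_one n (q k : ℂ).im
      have : ((Finset.range (n + 1)).filter fun j => near j k).card ≤ 2 := by
        simp only [near]; omega
      exact_mod_cast this
    refine (Finset.sum_le_sum fun k _ => hk k).trans ?_
    rw [← Finset.mul_sum]
    linarith
  · intro j hj i
    -- Chain points in a common square are Euclidean-close, hence `d`-close, so the almost geodesic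
    -- chain can have only little length there.
    have hin : ∑ k ∈ Finset.range N,
        (if ((q k : U) : ℂ) ∈ gridSquare U n j i then δ k else 0) ≤ η / 3 + η / 3 + η / 3 := by
      refine @sum_dist_of_mem_le U hd.toIsContinuousMetric.toPseudoMetricSpace
        (fun k => (q k : U)) N (η / 3) (η / 3) (η / 3) hstep ?_ (by linarith) (by linarith)
        (fun k => ((q k : U) : ℂ) ∈ gridSquare U n j i) fun a b ha hb => ?_
      · have e : d (q 0) (q N) = d x y := by rw [h0, h1]
        exact hsum.trans (by rw [← e]; exact le_rfl)
      · exact hqε a b ((norm_sub_le_of_mem_gridSquare ha hb).trans_lt hεn)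
    -- Steps near a grid line or starting in the erased square are paid with `r ≤ K d`; every other
    -- step lies in a remaining square whose internal metric gives exactly `d`.
    have hw : ∀ k, patchedWeight r d (gridSquare U n j) ((gridBox n).erase i) (q k) (q (k + 1)) ≤
        ENNReal.ofReal (δ k + K * ((if near j k then δ k else 0) +
          if ((q k : U) : ℂ) ∈ gridSquare U n j i then δ k else 0)) := by
      intro k
      have hbad : patchedWeight r d (gridSquare U n j) ((gridBox n).erase i) (q k) (q (k + 1)) ≤
          ENNReal.ofReal (K * δ k) := by
        rw [ENNReal.ofReal_mul hK]
        exact (min_le_left _ _).trans (hr _ _)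
      by_cases hnear : near j k
      · refine hbad.trans (ENNReal.ofReal_le_ofReal ?_)
        rw [if_pos hnear]
        have : 0 ≤ if ((q k : U) : ℂ) ∈ gridSquare U n j i then δ k else 0 := by
          split_ifs <;> [exact hδ0 k; rfl]
        nlinarith [hδ0 k]
      by_cases hi : ((q k : U) : ℂ) ∈ gridSquare U n j i
      · refine hbad.trans (ENNReal.ofReal_le_ofReal ?_)
        rw [if_pos hi, if_neg hnear]
        nlinarith [hδ0 k]
      · rw [if_neg hi, if_neg hnear, add_zero, mul_zero, add_zero]
        obtain ⟨i', hi', hsq⟩ := exists_gridSquare (U := U) (fun h => hnear (Or.inl h))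
          (fun h => hnear (Or.inr h)) hj (hqB k) hBn
        obtain ⟨δ', hlt, hball⟩ := hqδ k
        have hmem : ∀ z : U, d (q k) z < δ' → (z : ℂ) ∈ gridSquare U n j i' := fun z hz =>
          hsq z z.2 (hball z hz)
        refine (min_le_right _ _).trans ((iInf₂_le i' (Finset.mem_erase.2 ⟨?_, hi'⟩)).trans ?_)
        · rintro rfl
          exact hi (hmem _ (by rw [hd.dist_self]; exact (hδ0 k).trans_lt hlt))
        · exact (internalMetric_eq_ofReal hd hmem hlt).le
    have h2 := chainInf_le_sum
      (fun p q : Q => patchedWeight r d (gridSquare U n j) ((gridBox n).erase i) p q) N q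
    rw [h0, h1] at h2
    refine h2.trans ((Finset.sum_le_sum fun k _ => hw k).trans ?_)
    rw [← ENNReal.ofReal_sum_of_nonneg]
    · refine ENNReal.ofReal_le_ofReal ?_
      rw [Finset.sum_add_distrib, ← Finset.mul_sum, Finset.sum_add_distrib]
      have h3 := mul_le_mul_of_nonneg_left hin hK
      nlinarith
    · intro k _
      have h4 : 0 ≤ if near j k then δ k else 0 := by split_ifs <;> [exact hδ0 k; rfl]
      have h5 : 0 ≤ if ((q k : U) : ℂ) ∈ gridSquare U n j i then δ k else 0 := by
        split_ifs <;> [exact hδ0 k; rfl]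
      have := hδ0 k
      positivity

/-- The sum of the squared truncated effects of omitting the squares, averaged over the shifts
of the grid. -/
noncomputable def gridError (R : ℝ) (Q : Set U) (r : U → U → ℝ≥0∞) (d : U → U → ℝ) (n : ℕ)
    (x y : Q) : ℝ :=
  1 / ((n : ℝ) + 1) * ∑ j ∈ Finset.range (n + 1),
    ((trunc R (ENNReal.ofReal (d x y)) -
        trunc R (patchedDist Q r d (gridSquare U n j) (gridBox n) x y)) ^ 2 +
      ∑ i ∈ gridBox n, (trunc R (patchedDist Q r d (gridSquare U n j) (gridBox n) x y) -
        trunc R (patchedDist Q r d (gridSquare U n j) ((gridBox n).erase i) x y)) ^ 2)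

theorem gridError_nonneg (R : ℝ) (n : ℕ) (x y : Q) : 0 ≤ gridError R Q r d n x y := by
  unfold gridError
  exact mul_nonneg (by positivity) (Finset.sum_nonneg fun j _ =>
    add_nonneg (sq_nonneg _) (Finset.sum_nonneg fun i _ => sq_nonneg _))

theorem gridError_le_of_forall {R K : ℝ} (hR : 0 ≤ R) (hK : 0 ≤ K)
    (hd : IsContinuousLengthMetric d)
    (hr : ∀ p q : Q, ENNReal.ofReal (d p q) ≤ r p q)
    (hr' : ∀ p q : Q, r p q ≤ ENNReal.ofReal K * ENNReal.ofReal (d p q)) {n : ℕ} {x y : Q}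
    {c : ℕ → ℝ} (hc : ∀ j, 0 ≤ c j)
    (h : ∀ j ≤ n, ∀ i, trunc R (patchedDist Q r d (gridSquare U n j) ((gridBox n).erase i) x y) ≤
      trunc R (ENNReal.ofReal (d x y)) + c j) :
    gridError R Q r d n x y ≤
      (R + K * R) * (1 / ((n : ℝ) + 1) * ∑ j ∈ Finset.range (n + 1), c j) := by
  have hstep : ∀ j ∈ Finset.range (n + 1), (trunc R (ENNReal.ofReal (d x y)) -
        trunc R (patchedDist Q r d (gridSquare U n j) (gridBox n) x y)) ^ 2 +
      ∑ i ∈ gridBox n, (trunc R (patchedDist Q r d (gridSquare U n j) (gridBox n) x y) -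
        trunc R (patchedDist Q r d (gridSquare U n j) ((gridBox n).erase i) x y)) ^ 2 ≤
      (R + K * R) * c j := by
    intro j hj
    have hjn : j ≤ n := Nat.lt_succ_iff.1 (Finset.mem_range.1 hj)
    refine sum_sq_trunc_le hR hK (hc j) (ofReal_le_patchedDist hd hr x y)
      (fun i _ => patchedDist_le_erase x y i)
      (sum_patchedDist_erase_sub_le hd ENNReal.ofReal_ne_top hr hr' x y) ?_ fun i _ => h j hjn i
    -- The index `0` is arbitrary: erasing any patch only increases the distance.
    exact (trunc_mono (patchedDist_le_erase x y 0)).trans (h j hjn 0)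
  unfold gridError
  calc _ ≤ 1 / ((n : ℝ) + 1) * ∑ j ∈ Finset.range (n + 1), (R + K * R) * c j := by
        gcongr with j hj
        exact hstep j hj
    _ = _ := by rw [← Finset.mul_sum]; ring

/-- The crude choice `c = R`; it provides the dominating constant for the limit in expectation. -/
theorem gridError_le {R K : ℝ} (hR : 0 ≤ R) (hK : 0 ≤ K) (hd : IsContinuousLengthMetric d)
    (hr : ∀ p q : Q, ENNReal.ofReal (d p q) ≤ r p q)
    (hr' : ∀ p q : Q, r p q ≤ ENNReal.ofReal K * ENNReal.ofReal (d p q)) (n : ℕ) (x y : Q) :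
    gridError R Q r d n x y ≤ (R + K * R) * R := by
  refine (gridError_le_of_forall hR hK hd hr hr' (c := fun _ => R) (fun _ => hR)
    fun j _ i => ?_).trans (le_of_eq ?_)
  · exact (trunc_le hR _).trans (le_add_of_nonneg_left (trunc_nonneg _))
  · rw [Finset.sum_const, Finset.card_range, nsmul_eq_mul]
    push_cast
    field_simp

/-- The lengths `bad j` have a bounded sum over all `n + 1` shifts, so their average is of order `1
/ n`; what remains is proportional to the arbitrary `η`. -/
theorem tendsto_gridError {R K : ℝ} (hR : 0 ≤ R) (hK : 0 ≤ K) (hd : IsContinuousLengthMetric d)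
    (hQ : Dense Q) (hr : ∀ p q : Q, ENNReal.ofReal (d p q) ≤ r p q)
    (hr' : ∀ p q : Q, r p q ≤ ENNReal.ofReal K * ENNReal.ofReal (d p q)) (x y : Q) :
    Filter.Tendsto (fun n => gridError R Q r d n x y) Filter.atTop (nhds 0) := by
  have hd0 : 0 ≤ d x y := by
    have h := hd.triangle x y x
    rw [hd.dist_self, hd.symm y x] at h
    linarith
  set M := (R + K * R) * (1 + K + 2 * K * (d x y + 1)) with hM
  have hM0 : 0 ≤ M := by positivity
  rw [Metric.tendsto_atTop]
  intro e he
  set η := min 1 (e / (2 * (M + 1))) with hη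
  have hη0 : 0 < η := lt_min one_pos (by positivity)
  have hη1 : η ≤ 1 := min_le_left _ _
  obtain ⟨n₀, hn₀⟩ := exists_patchedDist_erase_le hd hQ hK hr' x y hη0
  obtain ⟨n₁, hn₁⟩ := exists_nat_gt (1 / η)
  refine ⟨max n₀ n₁, fun n hn => ?_⟩
  obtain ⟨bad, hbad0, hbad, hle⟩ := hn₀ n ((le_max_left _ _).trans hn)
  rw [Real.dist_eq, sub_zero, abs_of_nonneg (gridError_nonneg R n x y)]
  have hnη : 1 / ((n : ℝ) + 1) ≤ η := by
    have : (n₁ : ℝ) ≤ n := by exact_mod_cast (le_max_right _ _).trans hn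
    rw [div_lt_iff₀ hη0] at hn₁
    rw [div_le_iff₀ (by positivity)]
    nlinarith
  have h1 := gridError_le_of_forall hR hK hd hr hr' (n := n) (x := x) (y := y)
    (c := fun j => η + K * (bad j + η)) (fun j => by have := hbad0 j; positivity)
    fun j hj i => by
      refine trunc_add_le (by have := hbad0 j; positivity) ((hle j hj i).trans ?_)
      rw [← ENNReal.ofReal_add hd0 (by have := hbad0 j; positivity), add_assoc]
  have h2 : 1 / ((n : ℝ) + 1) * ∑ j ∈ Finset.range (n + 1), (η + K * (bad j + η)) ≤
      η * (1 + K + 2 * K * (d x y + 1)) := by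
    have e1 : ∑ j ∈ Finset.range (n + 1), (η + K * (bad j + η)) =
        ((n : ℝ) + 1) * (η + K * η) + K * ∑ j ∈ Finset.range (n + 1), bad j := by
      simp only [mul_add, Finset.sum_add_distrib, Finset.sum_const, Finset.card_range,
        nsmul_eq_mul, ← Finset.mul_sum]
      push_cast
      ring
    rw [e1, mul_add, ← mul_assoc, one_div_mul_cancel (by positivity), one_mul]
    have h3 : 1 / ((n : ℝ) + 1) * (K * ∑ j ∈ Finset.range (n + 1), bad j) ≤
        η * (K * (2 * (d x y + 1))) := by
      refine mul_le_mul hnη ?_ (mul_nonneg hK (Finset.sum_nonneg fun j _ => hbad0 j)) hη0.le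
      exact mul_le_mul_of_nonneg_left (by linarith) hK
    nlinarith
  calc gridError R Q r d n x y
      ≤ (R + K * R) * (η * (1 + K + 2 * K * (d x y + 1))) := h1.trans (by gcongr)
    _ = M * η := by rw [hM]; ring
    _ ≤ M * (e / (2 * (M + 1))) := by gcongr; exact min_le_right _ _
    _ < e := by
      rw [mul_div_assoc', div_lt_iff₀ (by positivity)]
      nlinarith

end FineChain

/-! ### A Poincaré inequality -/

section Poincare

theorem sq_integral_mul_le {α : Type*} {m : MeasurableSpace α} {μ : Measure α} {f g : α → ℝ}
    (hf : MemLp f 2 μ) (hg : MemLp g 2 μ) :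
    (∫ x, f x * g x ∂μ) ^ 2 ≤ (∫ x, f x ^ 2 ∂μ) * ∫ x, g x ^ 2 ∂μ := by
  have h : ∀ t : ℝ, 0 ≤ (∫ x, g x ^ 2 ∂μ) * (t * t) + (-2 * ∫ x, f x * g x ∂μ) * t +
      ∫ x, f x ^ 2 ∂μ := by
    intro t
    have h0 : 0 ≤ ∫ x, (f x - t * g x) ^ 2 ∂μ := integral_nonneg fun _ => sq_nonneg _
    have e : ∀ x, (f x - t * g x) ^ 2 = f x ^ 2 - 2 * t * (f x * g x) + t * t * g x ^ 2 :=
      fun x => by ring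
    simp_rw [e] at h0
    have hfg : Integrable (fun x => f x * g x) μ := hf.integrable_mul hg
    have h1 : Integrable (fun x => f x ^ 2 - 2 * t * (f x * g x)) μ :=
      hf.integrable_sq.sub (hfg.const_mul _)
    rw [integral_add h1 (hg.integrable_sq.const_mul _),
      integral_sub hf.integrable_sq (hfg.const_mul _), integral_const_mul,
      integral_const_mul] at h0
    linarith
  have := discrim_le_zero h
  rw [discrim] at this
  linarith

theorem sq_sub_le_integral_fderiv {u : ℂ → ℝ} (hu : ContDiff ℝ 1 u) (z w : ℂ) :
    (u z - u w) ^ 2 ≤ ‖z - w‖ ^ 2 * ∫ t in (0 : ℝ)..1, ‖fderiv ℝ u (w + t • (z - w))‖ ^ 2 := by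
  have hder : ∀ t : ℝ, HasDerivAt (fun t : ℝ => u (w + t • (z - w)))
      (fderiv ℝ u (w + t • (z - w)) (z - w)) t := by
    intro t
    have h1 : HasDerivAt (fun t : ℝ => w + t • (z - w)) (z - w) t := by
      simpa using ((hasDerivAt_id t).smul_const (z - w)).const_add w
    exact ((hu.differentiable (by simp) _).hasFDerivAt).comp_hasDerivAt t h1
  have hcD : Continuous fun t : ℝ => fderiv ℝ u (w + t • (z - w)) :=
    (hu.continuous_fderiv (by simp)).comp (by fun_prop)
  have hcg : Continuous fun t : ℝ => fderiv ℝ u (w + t • (z - w)) (z - w) :=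
    hcD.clm_apply continuous_const
  have hint := intervalIntegral.integral_eq_sub_of_hasDerivAt (fun t _ => hder t)
    (hcg.intervalIntegrable 0 1)
  have hmem : ∀ f : ℝ → ℝ, Continuous f → MemLp f 2 (volume.restrict (Set.Ioc (0 : ℝ) 1)) := by
    intro f hf
    obtain ⟨C, hC⟩ := (isCompact_Icc (a := (0 : ℝ)) (b := 1)).exists_bound_of_continuousOn
      hf.continuousOn
    refine MemLp.of_bound hf.aestronglyMeasurable C ?_
    filter_upwards [ae_restrict_mem measurableSet_Ioc] with t ht
    exact hC t ⟨ht.1.le, ht.2⟩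
  have hcs := sq_integral_mul_le (hmem (fun _ => (1 : ℝ)) continuous_const) (hmem _ hcg)
  simp only [one_mul, one_pow, integral_const, measureReal_restrict_apply, MeasurableSet.univ,
    Set.univ_inter, Real.volume_real_Ioc, sub_zero, zero_le_one, sup_of_le_left, smul_eq_mul,
    mul_one] at hcs
  rw [← intervalIntegral.integral_of_le zero_le_one,
    ← intervalIntegral.integral_of_le zero_le_one, hint] at hcs
  simp only [one_smul, zero_smul, add_zero, add_sub_cancel] at hcs
  refine hcs.trans ?_
  rw [← intervalIntegral.integral_const_mul]
  refine intervalIntegral.integral_mono_on zero_le_one ((hcg.pow 2).intervalIntegrable _ _)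
    ((continuous_const.mul (hcD.norm.pow 2)).intervalIntegrable _ _) fun t _ => ?_
  have h := (fderiv ℝ u (w + t • (z - w))).le_opNorm (z - w)
  calc _ = ‖fderiv ℝ u (w + t • (z - w)) (z - w)‖ ^ 2 := by rw [Real.norm_eq_abs, sq_abs]
    _ ≤ (‖fderiv ℝ u (w + t • (z - w))‖ * ‖z - w‖) ^ 2 := by gcongr
    _ = _ := by ring

theorem lintegral_comp_smul_add {G : ℂ → ℝ≥0∞} {s : ℝ} (hs : 1 / 2 ≤ s)
    (v : ℂ) : ∫⁻ z, G (s • z + v) ≤ 4 * ∫⁻ z, G z := by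
  have hs0 : s ≠ 0 := by linarith
  have h1 : ∫⁻ z, G (s • z + v) = ∫⁻ z, G (z + v) ∂(Measure.map (s • ·) volume) :=
    ((MeasurableEquiv.smul₀ (G₀ := ℝ) (α := ℂ) s hs0).measurableEmbedding.lintegral_map
      (fun z => G (z + v))).symm
  rw [h1, Measure.map_addHaar_smul _ hs0, lintegral_smul_measure, lintegral_add_right_eq_self,
    Complex.finrank_real_complex, smul_eq_mul]
  gcongr
  rw [abs_inv, abs_of_pos (by positivity)]
  have h2 : (s ^ 2)⁻¹ ≤ 4 := by
    rw [inv_le_comm₀ (by positivity) (by norm_num)]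
    nlinarith
  exact (ENNReal.ofReal_le_ofReal h2).trans (by norm_num)

/-- Integrating first over `z` if `t ≥ 1 / 2` and over `w` if `t ≤ 1 / 2` makes the change of
variables a dilation by a factor at least `1 / 2`, with Jacobian cost at most `4` in the plane. -/
theorem lintegral_segment_le {G : ℂ → ℝ≥0∞} (hG : Measurable G) (B : Set ℂ) :
    ∫⁻ z in B, ∫⁻ w in B, ∫⁻ t in Set.Ioc (0 : ℝ) 1, G (w + t • (z - w)) ≤
      4 * volume B * ∫⁻ z, G z := by
  have hm : Measurable fun p : (ℂ × ℂ) × ℝ => G (p.1.2 + p.2 • (p.1.1 - p.1.2)) :=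
    hG.comp (by fun_prop)
  have hswap : ∫⁻ z in B, ∫⁻ w in B, ∫⁻ t in Set.Ioc (0 : ℝ) 1, G (w + t • (z - w)) =
      ∫⁻ t in Set.Ioc (0 : ℝ) 1, ∫⁻ z in B, ∫⁻ w in B, G (w + t • (z - w)) := by
    have e1 : ∀ z : ℂ, ∫⁻ w in B, ∫⁻ t in Set.Ioc (0 : ℝ) 1, G (w + t • (z - w)) =
        ∫⁻ t in Set.Ioc (0 : ℝ) 1, ∫⁻ w in B, G (w + t • (z - w)) := by
      intro z
      refine lintegral_lintegral_swap (Measurable.aemeasurable ?_)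
      exact hG.comp (by fun_prop)
    simp_rw [e1]
    refine lintegral_lintegral_swap (Measurable.aemeasurable ?_)
    refine Measurable.lintegral_prod_right'
      (f := fun p : (ℂ × ℝ) × ℂ => G (p.2 + p.1.2 • (p.1.1 - p.2))) ?_
    exact hG.comp (by fun_prop)
  have hbound : ∀ t ∈ Set.Ioc (0 : ℝ) 1,
      ∫⁻ z in B, ∫⁻ w in B, G (w + t • (z - w)) ≤ 4 * volume B * ∫⁻ z, G z := by
    intro t ht
    have hconst : ∫⁻ _ in B, 4 * ∫⁻ z, G z = 4 * volume B * ∫⁻ z, G z := by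
      rw [setLIntegral_const]; ring
    rcases le_total (1 / 2) t with h | h
    · have hm' : Measurable (Function.uncurry fun z w : ℂ => G (w + t • (z - w))) :=
        hG.comp (by fun_prop)
      rw [lintegral_lintegral_swap hm'.aemeasurable]
      rw [← hconst]
      refine lintegral_mono fun w => (setLIntegral_le_lintegral _ _).trans ?_
      have := lintegral_comp_smul_add (G := G) h ((1 - t) • w)
      refine le_trans (le_of_eq ?_) this
      refine lintegral_congr fun z => ?_
      congr 1
      simp only [Complex.real_smul]
      push_cast
      ring
    · rw [← hconst]
      refine lintegral_mono fun z => (setLIntegral_le_lintegral _ _).trans ?_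
      have := lintegral_comp_smul_add (G := G) (s := 1 - t) (by linarith) (t • z)
      refine le_trans (le_of_eq ?_) this
      refine lintegral_congr fun w => ?_
      congr 1
      simp only [Complex.real_smul]
      push_cast
      ring
  rw [hswap]
  calc _ ≤ ∫⁻ _ in Set.Ioc (0 : ℝ) 1, 4 * volume B * ∫⁻ z, G z :=
        setLIntegral_mono measurable_const hbound
    _ = _ := by rw [setLIntegral_const]; simp

/-- A form of the Poincaré inequality on a ball. -/
theorem lintegral_lintegral_sq_sub_le {u : ℂ → ℝ} (hu : ContDiff ℝ 1 u) (z₀ : ℂ) (r : ℝ) :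
    ∫⁻ z in Metric.closedBall z₀ r, ∫⁻ w in Metric.closedBall z₀ r,
      ENNReal.ofReal ((u z - u w) ^ 2) ≤
    ENNReal.ofReal ((2 * r) ^ 2) * (4 * volume (Metric.closedBall z₀ r) *
      ∫⁻ z, ENNReal.ofReal (‖fderiv ℝ u z‖ ^ 2)) := by
  have hcF : Continuous fun z => ‖fderiv ℝ u z‖ ^ 2 := (hu.continuous_fderiv (by simp)).norm.pow 2
  have hcG : Measurable fun z => ENNReal.ofReal (‖fderiv ℝ u z‖ ^ 2) :=
    hcF.measurable.ennreal_ofReal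
  set B := Metric.closedBall z₀ r
  have hpt : ∀ z ∈ B, ∀ w ∈ B, ENNReal.ofReal ((u z - u w) ^ 2) ≤ ENNReal.ofReal ((2 * r) ^ 2) *
      ∫⁻ t in Set.Ioc (0 : ℝ) 1, ENNReal.ofReal (‖fderiv ℝ u (w + t • (z - w))‖ ^ 2) := by
    intro z hz w hw
    have hc : Continuous fun t : ℝ => ‖fderiv ℝ u (w + t • (z - w))‖ ^ 2 := hcF.comp (by fun_prop)
    have hi : IntegrableOn (fun t : ℝ => ‖fderiv ℝ u (w + t • (z - w))‖ ^ 2) (Set.Ioc 0 1) :=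
      (hc.integrableOn_Icc (a := 0) (b := 1)).mono_set Set.Ioc_subset_Icc_self
    rw [← ofReal_integral_eq_lintegral_ofReal hi (Filter.Eventually.of_forall fun _ => sq_nonneg _),
      ← ENNReal.ofReal_mul (sq_nonneg _)]
    refine ENNReal.ofReal_le_ofReal ((sq_sub_le_integral_fderiv hu z w).trans ?_)
    rw [intervalIntegral.integral_of_le zero_le_one]
    have h1 : ‖z - w‖ ≤ 2 * r := by
      rw [← dist_eq_norm]
      have h2 := dist_triangle_right z w z₀
      have h3 := Metric.mem_closedBall.1 hz
      have h4 := Metric.mem_closedBall.1 hw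
      linarith
    refine mul_le_mul_of_nonneg_right (by gcongr) (integral_nonneg fun _ => sq_nonneg _)
  calc _ ≤ ∫⁻ z in B, ∫⁻ w in B, ENNReal.ofReal ((2 * r) ^ 2) *
        ∫⁻ t in Set.Ioc (0 : ℝ) 1, ENNReal.ofReal (‖fderiv ℝ u (w + t • (z - w))‖ ^ 2) := by
        refine setLIntegral_mono' Metric.isClosed_closedBall.measurableSet fun z hz => ?_
        exact setLIntegral_mono' Metric.isClosed_closedBall.measurableSet fun w hw => hpt z hz w hw
    _ = ENNReal.ofReal ((2 * r) ^ 2) * ∫⁻ z in B, ∫⁻ w in B,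
        ∫⁻ t in Set.Ioc (0 : ℝ) 1, ENNReal.ofReal (‖fderiv ℝ u (w + t • (z - w))‖ ^ 2) := by
        simp_rw [lintegral_const_mul' _ _ ENNReal.ofReal_ne_top]
    _ ≤ _ := by gcongr; exact lintegral_segment_le hcG B

end Poincare

/-! ### Variance of the field against the `L²`-norm of the test function. -/

section LocalBound

variable {U : Opens ℂ}

theorem memLp_test (φ : 𝓓(U, ℝ)) : MemLp φ 2 volume :=
  φ.continuous.memLp_of_hasCompactSupport φ.hasCompactSupport

theorem memLp_restrict_compact {u : ℂ → ℝ} (hu : Continuous u) {B : Set ℂ} (hB : IsCompact B) :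
    MemLp u 2 (volume.restrict B) := by
  obtain ⟨C, hC⟩ := hB.exists_bound_of_continuousOn hu.continuousOn
  have : IsFiniteMeasure (volume.restrict B) := ⟨by simpa using hB.measure_lt_top⟩
  refine MemLp.of_bound hu.aestronglyMeasurable C ?_
  filter_upwards [ae_restrict_mem hB.measurableSet] with t ht
  exact hC t ht

/-- Since `φ` has integral one, `u z` is the `φ`-average of `u z - u w` plus the pairing of `φ` with
`u`. Cauchy-Schwarz and the Poincaré inequality bound the first term, and `a` the second. -/
theorem lintegral_sq_closedBall_le {u : ℂ → ℝ} (hu : ContDiff ℝ 1 u) {z₀ : ℂ} {r : ℝ}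
    (φ : 𝓓(U, ℝ)) (hφ : tsupport φ ⊆ Metric.closedBall z₀ r) (hφ1 : ∫ z, φ z = 1) {a : ℝ}
    (ha : |∫ z, φ z * u z| ≤ a) :
    ∫⁻ z in Metric.closedBall z₀ r, ENNReal.ofReal (u z ^ 2) ≤
      ENNReal.ofReal (2 * ∫ z, φ z ^ 2) * (ENNReal.ofReal ((2 * r) ^ 2) *
        (4 * volume (Metric.closedBall z₀ r) * ∫⁻ z, ENNReal.ofReal (‖fderiv ℝ u z‖ ^ 2))) +
      ENNReal.ofReal (2 * a ^ 2) * volume (Metric.closedBall z₀ r) := by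
  set B := Metric.closedBall z₀ r with hB
  have hBc : IsCompact B := isCompact_closedBall z₀ r
  have hφB : ∀ g : ℂ → ℝ, ∫ w in B, φ w * g w = ∫ w, φ w * g w := fun g => by
    refine setIntegral_eq_integral_of_forall_compl_eq_zero fun w hw => ?_
    rw [image_eq_zero_of_notMem_tsupport (fun h => hw (hφ h)), zero_mul]
  have hφu : Integrable fun w => φ w * u w :=
    (φ.continuous.mul hu.continuous).integrable_of_hasCompactSupport φ.hasCompactSupport.mul_right
  have hpt : ∀ z, ENNReal.ofReal (u z ^ 2) ≤ ENNReal.ofReal (2 * ∫ z, φ z ^ 2) *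
      (∫⁻ w in B, ENNReal.ofReal ((u z - u w) ^ 2)) + ENNReal.ofReal (2 * a ^ 2) := by
    intro z
    have hc : Continuous fun w => u z - u w := continuous_const.sub hu.continuous
    have hml := memLp_restrict_compact hc hBc
    have hcs := sq_integral_mul_le ((memLp_test φ).restrict B) hml
    rw [hφB] at hcs
    have e1 : ∫ w, φ w * (u z - u w) = u z - ∫ w, φ w * u w := by
      simp_rw [mul_sub]
      rw [integral_sub ((integrable_test φ).mul_const _) hφu, integral_mul_const, hφ1, one_mul]
    rw [e1] at hcs
    have e2 : ∫ w in B, φ w ^ 2 ≤ ∫ w, φ w ^ 2 :=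
      setIntegral_le_integral (memLp_test φ).integrable_sq
        (Filter.Eventually.of_forall fun _ => sq_nonneg _)
    have h0 : 0 ≤ ∫ w in B, (u z - u w) ^ 2 := integral_nonneg fun _ => sq_nonneg _
    have h1 : 0 ≤ ∫ w, φ w ^ 2 := integral_nonneg fun _ => sq_nonneg _
    have h2 : u z ^ 2 ≤ 2 * (∫ w, φ w ^ 2) * (∫ w in B, (u z - u w) ^ 2) + 2 * a ^ 2 := by
      have h3 := hcs.trans (mul_le_mul_of_nonneg_right e2 h0)
      have h4 : (∫ w, φ w * u w) ^ 2 ≤ a ^ 2 := sq_le_sq' (abs_le.1 ha).1 (abs_le.1 ha).2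
      nlinarith [sq_nonneg (u z - 2 * ∫ w, φ w * u w)]
    rw [← ofReal_integral_eq_lintegral_ofReal hml.integrable_sq
      (Filter.Eventually.of_forall fun _ => sq_nonneg _), ← ENNReal.ofReal_mul (by positivity),
      ← ENNReal.ofReal_add (by positivity) (by positivity)]
    exact ENNReal.ofReal_le_ofReal h2
  calc ∫⁻ z in B, ENNReal.ofReal (u z ^ 2)
      ≤ ∫⁻ z in B, (ENNReal.ofReal (2 * ∫ z, φ z ^ 2) *
        (∫⁻ w in B, ENNReal.ofReal ((u z - u w) ^ 2)) + ENNReal.ofReal (2 * a ^ 2)) :=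
        lintegral_mono fun z => hpt z
    _ = ENNReal.ofReal (2 * ∫ z, φ z ^ 2) *
        (∫⁻ z in B, ∫⁻ w in B, ENNReal.ofReal ((u z - u w) ^ 2)) +
        ENNReal.ofReal (2 * a ^ 2) * volume B := by
        rw [lintegral_add_right _ measurable_const, lintegral_const_mul' _ _ ENNReal.ofReal_ne_top,
          setLIntegral_const]
    _ ≤ _ := by
        gcongr
        exact lintegral_lintegral_sq_sub_le hu z₀ r

/-- If the Dirichlet energy of the functions `u v` is controlled by a seminorm, and if the pairings
with fixed test functions are continuous, then they are locally bounded in `L²`. -/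
theorem exists_local_L2_bound {V : Type*} {N : V → ℝ} {u : V → ℂ → ℝ}
    (hu : ∀ v, ContDiff ℝ 1 (u v)) {c : ℝ} (hc : 0 ≤ c)
    (hgrad : ∀ v, ∫⁻ z, ENNReal.ofReal (‖fderiv ℝ (u v) z‖ ^ 2) ≤ ENNReal.ofReal (c * N v ^ 2))
    (hA : ∀ φ : 𝓓(U, ℝ), ∃ A, ∀ v, |∫ z, φ z * u v z| ≤ A * N v) {K : Set ℂ} (hK : IsCompact K)
    (hKU : K ⊆ U) :
    ∃ C, 0 ≤ C ∧ ∀ φ : 𝓓(U, ℝ), tsupport φ ⊆ K → ∀ v,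
      (∫ z, φ z * u v z) ^ 2 ≤ C * N v ^ 2 * ∫ z, φ z ^ 2 := by
  have hloc : ∃ C, 0 ≤ C ∧ ∀ v, ∫⁻ z in K, ENNReal.ofReal (u v z ^ 2) ≤
      ENNReal.ofReal (C * N v ^ 2) := by
    refine hK.induction_on (p := fun s => ∃ C, 0 ≤ C ∧ ∀ v, ∫⁻ z in s, ENNReal.ofReal (u v z ^ 2) ≤
      ENNReal.ofReal (C * N v ^ 2)) ⟨0, le_rfl, fun v => by simp⟩ ?_ ?_ ?_
    · rintro s t hst ⟨C, hC, h⟩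
      exact ⟨C, hC, fun v => (lintegral_mono_set hst).trans (h v)⟩
    · rintro s t ⟨C, hC, h⟩ ⟨C', hC', h'⟩
      refine ⟨C + C', add_nonneg hC hC', fun v => (lintegral_union_le _ _ _).trans ?_⟩
      rw [add_mul, ENNReal.ofReal_add (by positivity) (by positivity)]
      exact add_le_add (h v) (h' v)
    · intro z hz
      obtain ⟨r, hr, hrU⟩ := Metric.nhds_basis_closedBall.mem_iff.1 (U.isOpen.mem_nhds (hKU hz))
      refine ⟨Metric.closedBall z r, mem_nhdsWithin_of_mem_nhds (Metric.closedBall_mem_nhds z hr),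
        ?_⟩
      let f : ContDiffBump z := ⟨r / 2, r, by linarith, by linarith⟩
      have hts : tsupport (f.normed volume) = Metric.closedBall z r := f.tsupport_normed_eq
      let φ : 𝓓(U, ℝ) := ⟨f.normed volume, f.contDiff_normed, f.hasCompactSupport_normed,
        hts ▸ hrU⟩
      have hφ1 : ∫ z, φ z = 1 := f.integral_normed
      obtain ⟨A, hA⟩ := hA φ
      set vB := (volume (Metric.closedBall z r)).toReal
      have hvB : volume (Metric.closedBall z r) = ENNReal.ofReal vB :=
        (ENNReal.ofReal_toReal (isCompact_closedBall z r).measure_lt_top.ne).symm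
      have hφ0 : 0 ≤ ∫ z, φ z ^ 2 := integral_nonneg fun _ => sq_nonneg _
      have hvB0 : 0 ≤ vB := ENNReal.toReal_nonneg
      refine ⟨2 * (∫ z, φ z ^ 2) * ((2 * r) ^ 2 * (4 * vB * c)) + 2 * A ^ 2 * vB,
        by positivity, fun v => ?_⟩
      refine (lintegral_sq_closedBall_le (hu v) φ (hts ▸ le_rfl) hφ1 (hA v)).trans ?_
      rw [hvB]
      calc _ ≤ ENNReal.ofReal (2 * ∫ z, φ z ^ 2) * (ENNReal.ofReal ((2 * r) ^ 2) *
          (ENNReal.ofReal 4 * ENNReal.ofReal vB * ENNReal.ofReal (c * N v ^ 2))) +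
          ENNReal.ofReal (2 * (A * N v) ^ 2) * ENNReal.ofReal vB := by
            gcongr
            · simp
            · exact hgrad v
        _ = _ := by
          rw [← ENNReal.ofReal_mul (by norm_num), ← ENNReal.ofReal_mul (by positivity),
            ← ENNReal.ofReal_mul (by positivity), ← ENNReal.ofReal_mul (by positivity),
            ← ENNReal.ofReal_mul (by positivity), ← ENNReal.ofReal_add (by positivity)
              (by positivity)]
          congr 1
          ring
  obtain ⟨C, hC, h⟩ := hloc
  refine ⟨C, hC, fun φ hφ v => ?_⟩
  have hml := memLp_restrict_compact (hu v).continuous hK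
  have hcs := sq_integral_mul_le ((memLp_test φ).restrict K) hml
  have e1 : ∫ w in K, φ w * u v w = ∫ w, φ w * u v w := by
    refine setIntegral_eq_integral_of_forall_compl_eq_zero fun w hw => ?_
    rw [image_eq_zero_of_notMem_tsupport (fun h => hw (hφ h)), zero_mul]
  have e2 : ∫ w in K, φ w ^ 2 ≤ ∫ w, φ w ^ 2 :=
    setIntegral_le_integral (memLp_test φ).integrable_sq
      (Filter.Eventually.of_forall fun _ => sq_nonneg _)
  have e3 : ∫ w in K, u v w ^ 2 ≤ C * N v ^ 2 := by
    rw [← ENNReal.ofReal_le_ofReal_iff (by positivity), ofReal_integral_eq_lintegral_ofReal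
      hml.integrable_sq (Filter.Eventually.of_forall fun _ => sq_nonneg _)]
    exact h v
  rw [e1] at hcs
  have h0 : 0 ≤ ∫ w in K, φ w ^ 2 := integral_nonneg fun _ => sq_nonneg _
  have h1 : 0 ≤ C * N v ^ 2 := by positivity
  calc _ ≤ _ := hcs
    _ ≤ (∫ w, φ w ^ 2) * (C * N v ^ 2) := mul_le_mul e2 e3
        (integral_nonneg fun _ => sq_nonneg _) (h0.trans e2)
    _ = _ := mul_comm _ _

theorem norm_gradient (f : ℂ → ℝ) (z : ℂ) : ‖gradient f z‖ = ‖fderiv ℝ f z‖ := by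
  rw [gradient, LinearIsometryEquiv.norm_map]

theorem lintegral_fderiv_test (ψ : DirichletTestSpace U) :
    ∫⁻ z, ENNReal.ofReal (‖fderiv ℝ (ofDirichlet ψ) z‖ ^ 2) =
      ENNReal.ofReal (2 * Real.pi * ‖ψ‖ ^ 2) := by
  have e : ‖ψ‖ ^ 2 = 1 / (2 * Real.pi) * ∫ z, ‖fderiv ℝ (ofDirichlet ψ) z‖ ^ 2 := by
    rw [← real_inner_self_eq_norm_sq]
    change dirichletInner (ofDirichlet ψ) (ofDirichlet ψ) = _
    unfold dirichletInner
    simp_rw [real_inner_self_eq_norm_sq, norm_gradient]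
  have hi : Integrable fun z => ‖fderiv ℝ (ofDirichlet ψ) z‖ ^ 2 := by
    have := integrable_inner_gradient (ofDirichlet ψ) (ofDirichlet ψ)
    simp_rw [real_inner_self_eq_norm_sq, norm_gradient] at this
    exact this
  rw [e, ← mul_assoc, mul_one_div_cancel (by positivity), one_mul,
    ofReal_integral_eq_lintegral_ofReal hi (Filter.Eventually.of_forall fun _ => sq_nonneg _)]

/-- The norm of an element of a completion is determined by the pairings with the elements of the
original space. -/
theorem norm_sq_le_of_forall_inner {E : Type*} [SeminormedAddCommGroup E] [InnerProductSpace ℝ E]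
    {f : Completion E} {b : ℝ} (hb : 0 ≤ b)
    (h : ∀ ψ : E, (inner ℝ f (ψ : Completion E)) ^ 2 ≤ b * ‖ψ‖ ^ 2) :
    ‖f‖ ^ 2 ≤ b := by
  have hall : ∀ g : Completion E, (inner ℝ f g : ℝ) ^ 2 ≤ b * ‖g‖ ^ 2 := by
    intro g
    induction g using Completion.induction_on with
    | hp => exact isClosed_le (by fun_prop) (by fun_prop)
    | ih a => simpa using h a
  have := hall f
  rw [real_inner_self_eq_norm_sq] at this
  rcases (sq_nonneg ‖f‖).eq_or_lt with h0 | h0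
  · exact h0 ▸ hb
  · nlinarith

/-- The norm of `G φ` is that of the functional `v ↦ ∫ φ u v`, up to a constant. Its mere finiteness
for each `φ` gives the bounds `A` in `exists_local_L2_bound`, which upgrades them to a bound uniform
over `φ` supported in `K`. -/
theorem exists_norm_sq_le {E : Type*} [SeminormedAddCommGroup E] [InnerProductSpace ℝ E]
    {u : E → ℂ → ℝ} (hu : ∀ v, ContDiff ℝ 1 (u v)) {c : ℝ} (hc : 0 ≤ c)
    (hgrad : ∀ v, ∫⁻ z, ENNReal.ofReal (‖fderiv ℝ (u v) z‖ ^ 2) ≤ ENNReal.ofReal (c * ‖v‖ ^ 2))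
    {G : 𝓓(U, ℝ) → Completion E} (hG : ∀ φ (v : E), inner ℝ (G φ) (v : Completion E) =
      -(1 / (2 * Real.pi)) * ∫ z, φ z * u v z) {K : Set ℂ} (hK : IsCompact K) (hKU : K ⊆ U) :
    ∃ C, 0 ≤ C ∧ ∀ φ : 𝓓(U, ℝ), tsupport φ ⊆ K →
      (2 * Real.pi) ^ 2 * ‖G φ‖ ^ 2 ≤ C * ∫ z, φ z ^ 2 := by
  have hπ : 0 < 2 * Real.pi := by positivity
  have hG' : ∀ φ v, ∫ z, φ z * u v z = -(2 * Real.pi) * inner ℝ (G φ) (v : Completion E) := by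
    intro φ v
    rw [hG]
    field_simp
  obtain ⟨C, hC, h⟩ := exists_local_L2_bound (U := U) (N := fun v : E => ‖v‖) hu hc hgrad
    (fun φ => ⟨2 * Real.pi * ‖G φ‖, fun v => by
      rw [hG', abs_mul, abs_neg, abs_of_pos hπ, mul_assoc (2 * Real.pi)]
      have := abs_real_inner_le_norm (G φ) (v : Completion E)
      rw [Completion.norm_coe] at this
      exact mul_le_mul_of_nonneg_left this hπ.le⟩) hK hKU
  refine ⟨C, hC, fun φ hφ => ?_⟩
  have h0 : 0 ≤ ∫ z, φ z ^ 2 := integral_nonneg fun _ => sq_nonneg _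
  have := norm_sq_le_of_forall_inner (f := G φ) (b := C * (∫ z, φ z ^ 2) / (2 * Real.pi) ^ 2)
    (by positivity) fun v => by
      have h1 := h φ hφ v
      rw [hG'] at h1
      rw [div_mul_eq_mul_div, le_div_iff₀ (by positivity)]
      linarith
  rwa [le_div_iff₀ (by positivity), mul_comm] at this

/-- The variance of the pairings of a Gaussian free field with test functions supported in a
compact set is bounded by their `L²`-norm. -/
theorem IsGFF.exists_integral_sq_le {Ω : Type*} [MeasurableSpace Ω] {P : Measure Ω}
    {h : Ω → 𝓓'(U, ℝ)} (hh : IsGFF P h) {K : Set ℂ} (hK : IsCompact K) (hKU : K ⊆ U) :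
    ∃ C, 0 ≤ C ∧ ∀ φ : 𝓓(U, ℝ), tsupport φ ⊆ K → ∫ ω, h ω φ ^ 2 ∂P ≤ C * ∫ z, φ z ^ 2 := by
  rcases hh with hh | ⟨z₀, r, -, hh⟩
  · obtain ⟨G, hG, hcov⟩ := hh.covariance
    obtain ⟨C, hC, H⟩ := exists_norm_sq_le (E := DirichletTestSpace U)
      (u := fun ψ => (ofDirichlet ψ : ℂ → ℝ)) (fun ψ => (ofDirichlet ψ).contDiff.of_le (by simp))
      (c := 2 * Real.pi) (by positivity) (fun ψ => (lintegral_fderiv_test ψ).le) (G := G)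
      (fun φ ψ => hG φ (ofDirichlet ψ)) hK hKU
    refine ⟨C, hC, fun φ hφ => ?_⟩
    have := hcov φ φ
    simp_rw [← pow_two, real_inner_self_eq_norm_sq] at this
    rw [this]
    exact H φ hφ
  · obtain ⟨G, hG, hcov⟩ := hh.covariance
    -- Subtracting the circle average turns the normalized pairing into an ordinary integral against
    -- `φ` and does not change the gradient.
    obtain ⟨C, hC, H⟩ := exists_norm_sq_le (E := meanZeroTestSpace)
      (u := fun ψ z => ofDirichlet (ψ : DirichletTestSpace ⊤) z -
        Real.circleAverage (ofDirichlet (ψ : DirichletTestSpace ⊤)) z₀ r)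
      (fun ψ => ((ofDirichlet (ψ : DirichletTestSpace ⊤)).contDiff.of_le (by simp)).sub
        contDiff_const) (c := 2 * Real.pi) (by positivity)
      (fun ψ => by
        simp_rw [fderiv_sub_const]
        exact (lintegral_fderiv_test (ψ : DirichletTestSpace ⊤)).le) (G := G)
      (fun φ ψ => by
        rw [hG φ ψ]
        congr 1
        simp_rw [mul_sub]
        rw [integral_sub _ ((integrable_test φ).mul_const _), integral_mul_const]
        exact (φ.continuous.mul (ofDirichlet (ψ : DirichletTestSpace ⊤)).continuous
          ).integrable_of_hasCompactSupport φ.hasCompactSupport.mul_right) hK hKU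
    refine ⟨C, hC, fun φ hφ => ?_⟩
    have := hcov φ φ
    simp_rw [← pow_two] at this
    rw [this]
    refine le_trans (le_of_eq ?_) (H φ hφ)
    congr 1
    exact real_inner_self_eq_norm_sq (G φ)

theorem IsGFF.isCenteredGaussianDistribution {Ω : Type*} [MeasurableSpace Ω] {P : Measure Ω}
    {h : Ω → 𝓓'(U, ℝ)} (hh : IsGFF P h) : IsCenteredGaussianDistribution P h := by
  rcases hh with hh | ⟨z₀, r, -, hh⟩
  · exact hh.toIsCenteredGaussianDistribution
  · exact hh.toIsCenteredGaussianDistribution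

theorem IsGFF.memLp {Ω : Type*} [MeasurableSpace Ω] {P : Measure Ω}
    {h : Ω → 𝓓'(U, ℝ)} (hh : IsGFF P h) (φ : 𝓓(U, ℝ)) : MemLp (fun ω => h ω φ) 2 P :=
  (hh.isCenteredGaussianDistribution.gaussian.hasGaussianLaw_eval φ).memLp_two

end LocalBound

/-! ### Splitting the field between an open set and its complement. -/

section FieldSigma

theorem exists_ae_tendsto_of_integral_sq_sub_le {Ω : Type*} [MeasurableSpace Ω] {P : Measure Ω}
    {f : ℕ → Ω → ℝ} (hf : ∀ k, MemLp (f k) 2 P) {b : ℕ → ℝ}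
    (hb : Filter.Tendsto b Filter.atTop (nhds 0))
    (h : ∀ k l, ∫ ω, (f k ω - f l ω) ^ 2 ∂P ≤ b k + b l) :
    ∃ (ns : ℕ → ℕ) (g : Ω → ℝ), StrictMono ns ∧
      ∀ᵐ ω ∂P, Filter.Tendsto (fun i => f (ns i) ω) Filter.atTop (nhds (g ω)) := by
  have hd : ∀ k l, dist ((hf k).toLp) ((hf l).toLp) ^ 2 = ∫ ω, (f k ω - f l ω) ^ 2 ∂P := by
    intro k l
    rw [dist_eq_norm, ← MemLp.toLp_sub (hf k) (hf l), Lp.norm_toLp,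
      eLpNorm_eq_lintegral_rpow_enorm_toReal two_ne_zero ENNReal.ofNat_ne_top]
    have e : ∫⁻ ω, ‖(f k - f l) ω‖ₑ ^ (2 : ℝ≥0∞).toReal ∂P =
        ENNReal.ofReal (∫ ω, (f k ω - f l ω) ^ 2 ∂P) := by
      rw [ofReal_integral_eq_lintegral_ofReal (f := fun ω => (f k ω - f l ω) ^ 2)
        ((hf k).sub (hf l)).integrable_sq (Filter.Eventually.of_forall fun _ => sq_nonneg _)]
      refine lintegral_congr fun ω => ?_
      rw [ENNReal.toReal_ofNat, ENNReal.rpow_ofNat, ← sq_abs, Pi.sub_apply,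
        ENNReal.ofReal_pow (abs_nonneg _), Real.enorm_eq_ofReal_abs]
    have h0 : 0 ≤ ∫ ω, (f k ω - f l ω) ^ 2 ∂P := integral_nonneg fun _ => sq_nonneg _
    rw [e, ENNReal.ofReal_rpow_of_nonneg h0 (by positivity),
      ENNReal.toReal_ofReal (by positivity), ENNReal.toReal_ofNat, ← Real.sqrt_eq_rpow,
      Real.sq_sqrt h0]
  have hc : CauchySeq fun k => (hf k).toLp := by
    rw [Metric.cauchySeq_iff]
    intro ε hε
    obtain ⟨N, hN⟩ := Filter.eventually_atTop.1
      (hb.eventually (gt_mem_nhds (show 0 < ε ^ 2 / 2 by positivity)))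
    refine ⟨N, fun k hk l hl => ?_⟩
    refine lt_of_pow_lt_pow_left₀ 2 hε.le ?_
    rw [hd]
    linarith [h k l, hN k hk, hN l hl]
  obtain ⟨g, hg⟩ := cauchySeq_tendsto_of_complete hc
  obtain ⟨ns, hns, hae⟩ := (tendstoInMeasure_of_tendsto_Lp hg).exists_seq_tendsto_ae
  refine ⟨ns, g, hns, ?_⟩
  filter_upwards [hae, ae_all_iff.2 fun k => (hf k).coeFn_toLp] with ω h1 h2
  simpa only [h2] using h1

variable {Ω : Type*} {U : Opens ℂ}

theorem measurable_pairing_fieldSigma {h : Ω → 𝓓'(U, ℝ)} {V : Set ℂ} {φ : 𝓓(U, ℝ)}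
    (hφ : tsupport φ ⊆ V) : Measurable[fieldSigma h V] fun ω => h ω φ := by
  rw [measurable_iff_comap_le]
  exact le_iSup₂_of_le φ hφ le_rfl

theorem comap_field (h : Ω → 𝓓'(U, ℝ)) : MeasurableSpace.comap h inferInstance =
    ⨆ φ : 𝓓(U, ℝ), MeasurableSpace.comap (fun ω => h ω φ) inferInstance := by
  change MeasurableSpace.comap h (⨆ φ : 𝓓(U, ℝ), _) = _
  simp_rw [MeasurableSpace.comap_iSup, MeasurableSpace.comap_comp]
  rfl

theorem fieldSigma_le (h : Ω → 𝓓'(U, ℝ)) (V : Set ℂ) :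
    fieldSigma h V ≤ MeasurableSpace.comap h inferInstance := by
  rw [comap_field]
  exact iSup_mono fun φ => iSup_le fun _ => le_rfl

theorem fieldSigmaClosed_le (h : Ω → 𝓓'(U, ℝ)) (K : Set ℂ) :
    fieldSigmaClosed h K ≤ MeasurableSpace.comap h inferInstance :=
  (iInf₂_le 1 one_pos).trans (fieldSigma_le h _)

/-- The product of a test function and a smooth function. -/
noncomputable def mulTest (χ : ℂ → ℝ) (hχ : ContDiff ℝ (⊤ : ℕ∞) χ) (φ : 𝓓(U, ℝ)) : 𝓓(U, ℝ) :=
  ⟨fun z => χ z * φ z, hχ.mul φ.contDiff, φ.hasCompactSupport.mul_left,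
    (tsupport_mul_subset_right).trans φ.tsupport_subset⟩

/-- Smooth cutoff functions of a compact part of an open set. -/
theorem exists_cutoff {V s : Set ℂ} (hV : IsOpen V) (hs : IsClosed s) (hsV : s ⊆ V) :
    ∃ χ : ℂ → ℝ, ContDiff ℝ (⊤ : ℕ∞) χ ∧ (∀ z, χ z ∈ Set.Icc 0 1) ∧ tsupport χ ⊆ V ∧
      ∀ z ∈ s, z ∉ tsupport fun w => 1 - χ w := by
  obtain ⟨f, h0, h1, h01⟩ := exists_contMDiffMap_zero_one_nhds_of_isClosed
    (modelWithCornersSelf ℝ ℂ) (n := (⊤ : ℕ∞)) hV.isClosed_compl hs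
    (Set.disjoint_left.2 fun z hz hz' => hz (hsV hz'))
  refine ⟨f, f.contMDiff.contDiff, h01, fun z hz => ?_, fun z hz => ?_⟩
  · by_contra hzV
    rw [notMem_tsupport_iff_eventuallyEq.2 (h0.filter_mono (nhds_le_nhdsSet hzV)) |> eq_false] at hz
    exact hz
  · rw [notMem_tsupport_iff_eventuallyEq]
    filter_upwards [h1.filter_mono (nhds_le_nhdsSet hz)] with w hw
    simp [hw]

/-- Multiply `φ` by `χ k` and `1 - χ k`, where `χ k` is supported in `V` and equals one near the
part of the support of `φ` outside the `1 / (k + 1)`-neighbourhood of `U \ V`. -/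
theorem exists_cutoff_seq {V : Set ℂ} (hV : IsOpen V) (φ : 𝓓(U, ℝ)) :
    ∃ φ₁ φ₂ : ℕ → 𝓓(U, ℝ), (∀ k z, φ₁ k z + φ₂ k z = φ z) ∧ (∀ k z, |φ₁ k z| ≤ |φ z|) ∧
      (∀ k, tsupport (φ₁ k) ⊆ V) ∧ (∀ k, tsupport (φ₁ k) ⊆ tsupport φ) ∧
      (∀ k : ℕ, tsupport (φ₂ k) ⊆ Metric.thickening (1 / ((k : ℝ) + 1)) (U \ V)) ∧
      ∀ z, Filter.Tendsto (fun k => φ₁ k z) Filter.atTop (nhds (V.indicator φ z)) := by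
  have hcl : ∀ k : ℕ, IsClosed (tsupport φ \ Metric.thickening (1 / ((k : ℝ) + 1)) (U \ V)) :=
    fun k => (isClosed_tsupport _).sdiff Metric.isOpen_thickening
  have hsub : ∀ k : ℕ, tsupport φ \ Metric.thickening (1 / ((k : ℝ) + 1)) (U \ V) ⊆ V := by
    intro k z hz
    by_contra hzV
    exact hz.2 (Metric.self_subset_thickening (by positivity) _ ⟨φ.tsupport_subset hz.1, hzV⟩)
  choose χ hχ h01 hχV hχ1 using fun k => exists_cutoff hV (hcl k) (hsub k)
  refine ⟨fun k => mulTest (χ k) (hχ k) φ,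
    fun k => mulTest (fun z => 1 - χ k z) (contDiff_const.sub (hχ k)) φ, fun k z => ?_,
    fun k z => ?_, fun k => ?_, fun k => ?_, fun k => ?_, fun z => ?_⟩
  · change χ k z * φ z + (1 - χ k z) * φ z = φ z
    ring
  · change |χ k z * φ z| ≤ |φ z|
    rw [abs_mul, abs_of_nonneg (h01 k z).1]
    exact mul_le_of_le_one_left (abs_nonneg _) (h01 k z).2
  · exact (tsupport_mul_subset_left).trans (hχV k)
  · exact tsupport_mul_subset_right
  · intro z hz
    by_contra hz'
    exact hχ1 k z ⟨tsupport_mul_subset_right hz, hz'⟩ (tsupport_mul_subset_left hz)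
  · change Filter.Tendsto (fun k => χ k z * φ z) _ _
    by_cases hzφ : z ∈ tsupport φ
    · by_cases hzV : z ∈ V
      · rw [Set.indicator_of_mem hzV]
        refine tendsto_const_nhds.congr' ?_
        obtain ⟨r, hr, hrV⟩ := Metric.isOpen_iff.1 hV z hzV
        filter_upwards [(tendsto_one_div_add_atTop_nhds_zero_nat (𝕜 := ℝ)).eventually
          (gt_mem_nhds hr)] with k hk
        have hz : z ∈ tsupport φ \ Metric.thickening (1 / ((k : ℝ) + 1)) (U \ V) := by
          refine ⟨hzφ, fun hz => ?_⟩
          obtain ⟨w, hw, hzw⟩ := Metric.mem_thickening_iff.1 hz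
          exact hw.2 (hrV (by rw [Metric.mem_ball, dist_comm]; exact hzw.trans hk))
        have := image_eq_zero_of_notMem_tsupport (hχ1 k z hz)
        rw [← sub_eq_zero.1 this, one_mul]
      · rw [Set.indicator_of_notMem hzV]
        simp_rw [image_eq_zero_of_notMem_tsupport (fun h => hzV (hχV _ h)), zero_mul]
        exact tendsto_const_nhds
    · have h0 := image_eq_zero_of_notMem_tsupport hzφ
      have : V.indicator φ z = 0 := by
        by_cases hzV : z ∈ V <;> simp [hzV, h0]
      rw [this, h0]
      simp

theorem tendsto_integral_sq_sub {V : Set ℂ} (hV : IsOpen V) {φ : 𝓓(U, ℝ)} {φ₁ : ℕ → 𝓓(U, ℝ)}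
    (hle : ∀ k z, |φ₁ k z| ≤ |φ z|)
    (hlim : ∀ z, Filter.Tendsto (fun k => φ₁ k z) Filter.atTop (nhds (V.indicator φ z))) :
    Filter.Tendsto (fun k => ∫ z, (φ₁ k z - V.indicator φ z) ^ 2) Filter.atTop (nhds 0) := by
  have := tendsto_integral_of_dominated_convergence (μ := volume) (F := fun k z =>
    (φ₁ k z - V.indicator φ z) ^ 2) (f := fun _ => 0) (fun z => 4 * φ z ^ 2) (fun k =>
      (((φ₁ k).continuous.measurable.sub (φ.continuous.measurable.indicator
        hV.measurableSet)).pow_const 2).aestronglyMeasurable)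
    ((memLp_test φ).integrable_sq.const_mul 4)
    (fun k => Filter.Eventually.of_forall fun z => ?_)
    (Filter.Eventually.of_forall fun z => ?_)
  · simpa using this
  · have h1 : |φ₁ k z - V.indicator φ z| ≤ 2 * |φ z| := by
      have h2 : |V.indicator φ z| ≤ |φ z| := by
        by_cases hz : z ∈ V <;> simp [hz]
      linarith [abs_sub (φ₁ k z) (V.indicator φ z), hle k z]
    rw [Real.norm_eq_abs, abs_pow]
    calc _ ≤ (2 * |φ z|) ^ 2 := by gcongr
      _ = _ := by rw [mul_pow, sq_abs]; norm_num
  · have := ((hlim z).sub_const (V.indicator φ z)).pow 2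
    simpa using this

variable [MeasurableSpace Ω] {P : Measure Ω}

/-- The variables `Z₁` and `Z₂` play the role of the field paired with `φ` cut off sharply to `V`
and to its complement. The smooth cutoffs converge in `L²(dz)`, so by the variance bound their
pairings converge in `L²(P)`, and almost surely along a subsequence. -/
theorem IsGFF.exists_ae_eq_add {h : Ω → 𝓓'(U, ℝ)} (hh : IsGFF P h) {V : Set ℂ} (hV : IsOpen V)
    (φ : 𝓓(U, ℝ)) :
    ∃ Z₁ Z₂ : Ω → ℝ, Measurable[fieldSigma h V] Z₁ ∧ Measurable[fieldSigmaClosed h (U \ V)] Z₂ ∧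
      (fun ω => h ω φ) =ᵐ[P] Z₁ + Z₂ := by
  obtain ⟨φ₁, φ₂, hadd, hle, hV₁, hφ₁, hV₂, hlim⟩ := exists_cutoff_seq hV φ
  have hadd' : ∀ k, φ₁ k + φ₂ k = φ := fun k => by ext z; exact hadd k z
  obtain ⟨C, hC, hvar⟩ := hh.exists_integral_sq_le φ.hasCompactSupport φ.tsupport_subset
  have hb := (tendsto_integral_sq_sub hV hle hlim).const_mul (2 * C)
  rw [mul_zero] at hb
  have hml : ∀ k, MemLp (fun z => φ₁ k z - V.indicator φ z) 2 volume := fun k =>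
    (memLp_test (φ₁ k)).sub ((memLp_test φ).indicator hV.measurableSet)
  obtain ⟨ns, g, hns, hae⟩ := exists_ae_tendsto_of_integral_sq_sub_le
    (fun k => hh.memLp (φ₁ k)) hb fun k l => by
      have h1 := hvar (φ₁ k - φ₁ l) ((tsupport_sub _ _).trans (Set.union_subset (hφ₁ k) (hφ₁ l)))
      have h2 : ∀ ω, h ω (φ₁ k - φ₁ l) = h ω (φ₁ k) - h ω (φ₁ l) := fun ω => map_sub (h ω) _ _
      simp_rw [h2] at h1
      refine h1.trans ?_
      rw [← mul_add, mul_comm 2 C, mul_assoc]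
      refine mul_le_mul_of_nonneg_left ?_ hC
      rw [← integral_add (hml k).integrable_sq (hml l).integrable_sq, ← integral_const_mul]
      refine integral_mono (memLp_test _).integrable_sq
        (((hml k).integrable_sq.add (hml l).integrable_sq).const_mul 2) fun z => ?_
      change (φ₁ k z - φ₁ l z) ^ 2 ≤ _
      nlinarith [sq_nonneg (φ₁ k z - V.indicator φ z + (φ₁ l z - V.indicator φ z))]
  -- The upper limits agree a.s. with the limits and are measurable for the small σ-algebras
  -- themselves, not just up to null sets.
  refine ⟨fun ω => Filter.limsup (fun i => h ω (φ₁ (ns i))) Filter.atTop,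
    fun ω => Filter.limsup (fun i => h ω (φ₂ (ns i))) Filter.atTop, ?_, ?_, ?_⟩
  · exact Measurable.limsup fun i => measurable_pairing_fieldSigma (hV₁ _)
  · rw [measurable_iff_comap_le]
    refine le_iInf₂ fun ε hε => ?_
    rw [← measurable_iff_comap_le]
    obtain ⟨k, hk⟩ := exists_nat_one_div_lt hε
    -- Dropping finitely many terms leaves only test functions supported in the `ε`-neighbourhood,
    -- for each `ε`.
    have e : (fun ω => Filter.limsup (fun i => h ω (φ₂ (ns i))) Filter.atTop) =
        fun ω => Filter.limsup (fun i => h ω (φ₂ (ns (i + k)))) Filter.atTop := by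
      ext ω
      exact (Filter.limsup_nat_add (fun i => h ω (φ₂ (ns i))) k).symm
    rw [e]
    refine Measurable.limsup fun i => measurable_pairing_fieldSigma ((hV₂ _).trans
      (Metric.thickening_mono ?_ _))
    refine le_trans ?_ hk.le
    have h1 : k ≤ ns (i + k) := le_trans (Nat.le_add_left k i) (hns.id_le _)
    have h2 : (k : ℝ) ≤ ns (i + k) := by exact_mod_cast h1
    gcongr
  · filter_upwards [hae] with ω hω
    have h2 : ∀ i, h ω (φ₂ (ns i)) = h ω φ - h ω (φ₁ (ns i)) := fun i => by
      rw [← hadd' (ns i), map_add]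
      ring
    simp only [Pi.add_apply, h2]
    rw [hω.limsup_eq, (tendsto_const_nhds.sub hω).limsup_eq]
    ring

/-- The field is determined by its restrictions to an open set and to the complement. -/
theorem IsGFF.comap_le_eventuallyMeasurableSpace {h : Ω → 𝓓'(U, ℝ)} (hh : IsGFF P h) {V : Set ℂ}
    (hV : IsOpen V) : MeasurableSpace.comap h inferInstance ≤
      @eventuallyMeasurableSpace Ω (fieldSigma h V ⊔ fieldSigmaClosed h (U \ V)) (ae P) _ := by
  rw [comap_field]
  refine iSup_le fun φ => ?_
  obtain ⟨Z₁, Z₂, h₁, h₂, hZ⟩ := hh.exists_ae_eq_add hV φ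
  rintro _ ⟨B, hB, rfl⟩
  refine ⟨(Z₁ + Z₂) ⁻¹' B, ?_, ?_⟩
  · have h₁' : Measurable[fieldSigma h V ⊔ fieldSigmaClosed h (U \ V)] Z₁ :=
      h₁.mono le_sup_left le_rfl
    have h₂' : Measurable[fieldSigma h V ⊔ fieldSigmaClosed h (U \ V)] Z₂ :=
      h₂.mono le_sup_right le_rfl
    exact Measurable.add (m := fieldSigma h V ⊔ fieldSigmaClosed h (U \ V)) h₁' h₂' hB
  · filter_upwards [hZ] with ω hω
    change (h ω φ ∈ B) = ((Z₁ + Z₂) ω ∈ B)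
    rw [hω]

end FieldSigma

/-! ### Null sets and exchangeability. -/

section Glue

variable {Ω : Type*} {m m' l : MeasurableSpace Ω} {m₀ : MeasurableSpace Ω}
  {P : Measure Ω} [IsProbabilityMeasure P]

theorem condExp_eq_of_le_eventuallyMeasurableSpace (hm' : m' ≤ m₀) (hl : l ≤ m₀)
    (hlm : l ≤ @eventuallyMeasurableSpace Ω m' (ae P) _) {f g : Ω → ℝ} (hf : Integrable f P)
    (hg : StronglyMeasurable[l] g) (hfg : P[f | m'] =ᵐ[P] g) : P[f | l] =ᵐ[P] g := by
  have hgi : Integrable g P := integrable_condExp.congr hfg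
  refine (ae_eq_condExp_of_forall_setIntegral_eq hl hf (fun _ _ _ => hgi.integrableOn)
    (fun S hS _ => ?_) hg.aestronglyMeasurable).symm
  obtain ⟨T, hT, hST⟩ := hlm _ hS
  rw [setIntegral_congr_set hST, setIntegral_congr_set hST, ← setIntegral_condExp hm' hf hT]
  exact integral_congr_ae (ae_restrict_of_ae hfg.symm)

/-- Both sides are the integral over `B` of the product of the conditional probabilities of `X ⁻¹'
A₁` and `X ⁻¹' A₂`, which is symmetric. -/
theorem IsCondIIDGiven.measure_inter_swap {S : Type*} [MeasurableSpace S] {X Y : Ω → S}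
    (h : IsCondIIDGiven m P X Y) (hm : m ≤ m₀) (hX : Measurable X) (hY : Measurable Y)
    {B : Set Ω} (hB : MeasurableSet[m] B) {A₁ A₂ : Set S} (h₁ : MeasurableSet A₁)
    (h₂ : MeasurableSet A₂) :
    P (B ∩ (X ⁻¹' A₁ ∩ Y ⁻¹' A₂)) = P (B ∩ (X ⁻¹' A₂ ∩ Y ⁻¹' A₁)) := by
  have key : ∀ A₁ A₂ : Set S, MeasurableSet A₁ → MeasurableSet A₂ →
      P.real (B ∩ (X ⁻¹' A₁ ∩ Y ⁻¹' A₂)) =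
        ∫ ω in B, (P⟦X ⁻¹' A₁ | m⟧) ω * (P⟦X ⁻¹' A₂ | m⟧) ω ∂P := by
    intro A₁ A₂ h₁ h₂
    have hA : MeasurableSet (X ⁻¹' A₁ ∩ Y ⁻¹' A₂) := (hX h₁).inter (hY h₂)
    have e1 : P.real (B ∩ (X ⁻¹' A₁ ∩ Y ⁻¹' A₂)) =
        ∫ ω in B, (P⟦X ⁻¹' A₁ ∩ Y ⁻¹' A₂ | m⟧) ω ∂P := by
      rw [setIntegral_condExp hm ((memLp_indicator_one hA).integrable one_le_two) hB,
        setIntegral_indicator hA, setIntegral_const, smul_eq_mul, mul_one]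
    rw [e1]
    refine integral_congr_ae (ae_restrict_of_ae ?_)
    filter_upwards [h.indep _ _ ⟨A₁, h₁, rfl⟩ ⟨A₂, h₂, rfl⟩, h.same_law A₂ h₂] with ω e2 e3
    rw [e2, e3]
    rfl
  rw [← measureReal_eq_measureReal_iff, key _ _ h₁ h₂, key _ _ h₂ h₁]
  simp_rw [mul_comm]

/-- Conditionally i.i.d. random variables can be exchanged. -/
theorem IsCondIIDGiven.ae_swap {S : Type*} [MeasurableSpace S] {X Y : Ω → S}
    (h : IsCondIIDGiven m P X Y) (hm : m ≤ m₀) (hX : Measurable X) (hY : Measurable Y)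
    {c : Ω → ℝ} (hc : Measurable[m] c) {u : S → ℝ} (hu : Measurable u) {E : Set (ℝ × ℝ × ℝ)}
    (hE : MeasurableSet E) (hae : ∀ᵐ ω ∂P, (c ω, u (X ω), u (Y ω)) ∈ E) :
    ∀ᵐ ω ∂P, (c ω, u (Y ω), u (X ω)) ∈ E := by
  have hc' : Measurable c := hc.mono hm le_rfl
  have h1 : Measurable fun ω => (c ω, u (X ω), u (Y ω)) :=
    hc'.prodMk ((hu.comp hX).prodMk (hu.comp hY))
  have h2 : Measurable fun ω => (c ω, u (Y ω), u (X ω)) :=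
    hc'.prodMk ((hu.comp hY).prodMk (hu.comp hX))
  have e : P.map (fun ω => (c ω, u (X ω), u (Y ω))) =
      P.map (fun ω => (c ω, u (Y ω), u (X ω))) := by
    have := Measure.isFiniteMeasure_map P fun ω => (c ω, u (X ω), u (Y ω))
    refine Measure.ext_prod₃ fun {s t v} hs ht hv => ?_
    rw [Measure.map_apply h1 (hs.prod (ht.prod hv)), Measure.map_apply h2 (hs.prod (ht.prod hv))]
    refine Eq.trans (h.measure_inter_swap hm hX hY (hc hs) (hu ht) (hu hv)) (congrArg P ?_)
    rw [Set.inter_comm (X ⁻¹' _)]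
    rfl
  have h3 := (ae_map_iff h1.aemeasurable hE).2 hae
  rw [e] at h3
  exact (ae_map_iff h2.aemeasurable hE).1 h3

end Glue

/-! ### Locality given the field and the second metric. -/

section Locality

variable {Ω : Type*} [MeasurableSpace Ω] {P : Measure Ω} [IsProbabilityMeasure P] {U : Opens ℂ}
  {h : Ω → 𝓓'(U, ℝ)} {D Dt : Ω → U → U → ℝ}

/-- Given the field and a conditionally independent copy of the metric, the internal metrics in
`V` and in the complement of its closure are independent. -/
theorem IsLocalMetric.condExp_sup_internalSigma (hlocal : IsLocalMetric P h D) (hh : IsGFF P h)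
    (hD : IsRandomContinuousLengthMetric D) (hDt : Measurable Dt)
    (hind : CondIndepGiven (MeasurableSpace.comap h inferInstance)
      (MeasurableSpace.comap D inferInstance) (MeasurableSpace.comap Dt inferInstance) P)
    {V : Set ℂ} (hV : IsOpen V) (hVU : V ⊆ U) {A : Set Ω} (hA : MeasurableSet[internalSigma D V] A) :
    P⟦A | (MeasurableSpace.comap h inferInstance ⊔ MeasurableSpace.comap Dt inferInstance) ⊔
      internalSigma D (U \ closure V)⟧ =ᵐ[P]
    P⟦A | MeasurableSpace.comap h inferInstance ⊔ MeasurableSpace.comap Dt inferInstance⟧ := by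
  have hh0 := hh.isCenteredGaussianDistribution.measurable.comap_le
  have hD0 := hD.measurable.comap_le
  have ht0 := hDt.comap_le
  have hVD := internalSigma_le_comap hD.isContinuousLengthMetric hV hVU
  have hWD := internalSigma_le_comap (V := (U : Set ℂ) \ closure V) hD.isContinuousLengthMetric
    (U.isOpen.sdiff isClosed_closure) Set.sdiff_subset
  have hF0 := (fieldSigma_le h V).trans hh0
  have hFc0 := (fieldSigmaClosed_le h (U \ V)).trans hh0
  have h1 := (hlocal V hV hVU).condExp_sup hF0 (hVD.trans hD0) (sup_le hFc0 (hWD.trans hD0)) hA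
  have hev : MeasurableSpace.comap h inferInstance ≤ @eventuallyMeasurableSpace Ω
      (fieldSigma h V ⊔ (fieldSigmaClosed h (U \ V) ⊔ internalSigma D (U \ closure V))) (ae P) _ := by
    refine (hh.comap_le_eventuallyMeasurableSpace hV).trans ?_
    rintro S ⟨T, hT, hST⟩
    exact ⟨T, (sup_le_sup_left le_sup_left _ : fieldSigma h V ⊔ fieldSigmaClosed h (U \ V) ≤ _) _ hT,
      hST⟩
  have hev' : MeasurableSpace.comap h inferInstance ⊔ internalSigma D (U \ closure V) ≤
      @eventuallyMeasurableSpace Ω (fieldSigma h V ⊔ (fieldSigmaClosed h (U \ V) ⊔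
        internalSigma D (U \ closure V))) (ae P) _ :=
    sup_le hev fun S hS =>
      ⟨S, (le_sup_right.trans le_sup_right : internalSigma D (U \ closure V) ≤ fieldSigma h V ⊔
        (fieldSigmaClosed h (U \ V) ⊔ internalSigma D (U \ closure V))) _ hS, Filter.EventuallyEq.rfl⟩
  have hA1 : Integrable (A.indicator fun _ => (1 : ℝ)) P :=
    (memLp_indicator_one ((hVD.trans hD0) _ hA)).integrable one_le_two
  have hsup0 := sup_le hF0 (sup_le hFc0 (hWD.trans hD0))
  -- The conditional probabilities of `A` given `h`, and given `h` together with the metric outside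
  -- `closure V`, both equal the one given `h|_V`, since both σ-algebras lie, up to null sets, in
  -- the one appearing in locality.
  have h2 := condExp_eq_of_le_eventuallyMeasurableSpace hsup0 hh0 hev hA1
    (stronglyMeasurable_condExp.mono (fieldSigma_le h V)) h1
  have h3 := condExp_eq_of_le_eventuallyMeasurableSpace hsup0 (sup_le hh0 (hWD.trans hD0)) hev' hA1
    (stronglyMeasurable_condExp.mono ((fieldSigma_le h V).trans le_sup_left)) h1
  -- Adjoining `Dt` changes neither conditional probability, because `Dt` is conditionally
  -- independent of all of `D` given `h`.
  have h4 := condExp_sup_sup_eq hh0 hD0 ht0 hVD hWD hind hA (h3.trans h2.symm)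
  have h5 := hind.condExp_sup hh0 hD0 ht0 (hVD _ hA)
  rw [sup_right_comm]
  exact h4.trans h5.symm

end Locality

/-! ### Vanishing of the conditional variance. -/

section Resampling

variable {Ω : Type*} {U : Opens ℂ} {D Dt : Ω → U → U → ℝ}

theorem measurable_patchedDist {ι : Type*} [DecidableEq ι] {Q : Set U} (hQ : Q.Countable)
    {m : MeasurableSpace Ω} {r : Ω → U → U → ℝ≥0∞} (hr : ∀ p q, Measurable fun ω => r ω p q)
    {S : ι → Set ℂ} {s : Finset ι} (hS : ∀ i ∈ s, internalSigma D (S i) ≤ m) (x y : Q) :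
    Measurable fun ω => patchedDist Q (r ω) (D ω) S s x y := by
  have := hQ.to_subtype
  refine measurable_chainInf (ι := Q) (w := fun ω p q => patchedWeight (r ω) (D ω) S s p q)
    (fun p q => (hr p q).min ?_) x y
  exact Measurable.biInf (s : Set ι) s.countable_toSet fun i hi => internalSigma_le_iff.1 (hS i hi) p q

theorem gridSquare_subset_sdiff_closure {n j : ℕ} {i i' : ℤ × ℤ} (h : i' ≠ i) :
    gridSquare U n j i' ⊆ U \ closure (gridSquare U n j i) := fun _ hz =>
  ⟨hz.1, fun hz' => Set.disjoint_left.1 ((disjoint_gridSquare h).closure_right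
    (isOpen_gridSquare U n j i')) hz hz'⟩

variable {G : MeasurableSpace Ω} {m₀ : MeasurableSpace Ω} {P : Measure Ω} [IsProbabilityMeasure P]

/-- The conditional variance of a truncated distance is bounded by the effect of resampling the
metric in the squares of a grid. -/
theorem integral_sq_sub_condExp_le_of_grid (hG : G ≤ m₀)
    (hD : IsRandomContinuousLengthMetric D) {Q : Set U} (hQ : Q.Countable)
    (hind : ∀ V : Set ℂ, IsOpen V → V ⊆ U → ∀ A, MeasurableSet[internalSigma D V] A →
      P⟦A | G ⊔ internalSigma D (U \ closure V)⟧ =ᵐ[P] P⟦A | G⟧)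
    {r : Ω → U → U → ℝ≥0∞} (hr : ∀ p q, Measurable[G] fun ω => r ω p q)
    {c : Ω → ℝ} (hc : Measurable[G] c) (hc01 : ∀ ω, c ω = 0 ∨ c ω = 1) {R : ℝ} (hR : 0 ≤ R)
    (x y : Q) (n j : ℕ) {X : Ω → ℝ} (hX : X = fun ω => c ω * trunc R (ENNReal.ofReal (D ω x y))) :
    ∃ T : Ω → ℝ, Integrable T P ∧ ∫ ω, (X ω - (P[X | G]) ω) ^ 2 ∂P ≤ 2 * ∫ ω, T ω ∂P ∧
      T = fun ω => c ω * ((trunc R (ENNReal.ofReal (D ω x y)) -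
        trunc R (patchedDist Q (r ω) (D ω) (gridSquare U n j) (gridBox n) x y)) ^ 2 +
      ∑ i ∈ gridBox n, (trunc R (patchedDist Q (r ω) (D ω) (gridSquare U n j) (gridBox n) x y) -
        trunc R (patchedDist Q (r ω) (D ω) (gridSquare U n j) ((gridBox n).erase i) x y)) ^ 2) := by
  set S := gridSquare U n j with hS
  set B := gridBox n with hB
  have hD0 := hD.measurable.comap_le
  have hS0 : ∀ i, internalSigma D (S i) ≤ m₀ := fun i =>
    (internalSigma_le_comap hD.isContinuousLengthMetric (isOpen_gridSquare U n j i)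
      (gridSquare_subset U n j i)).trans hD0
  have hopen : ∀ i, IsOpen ((U : Set ℂ) \ closure (S i)) := fun i =>
    U.isOpen.sdiff isClosed_closure
  have hW0 : ∀ i, internalSigma D (U \ closure (S i)) ≤ m₀ := fun i =>
    (internalSigma_le_comap hD.isContinuousLengthMetric (hopen i) Set.sdiff_subset).trans hD0
  have hSW : ∀ i k, k ≠ i → internalSigma D (S k) ≤ internalSigma D (U \ closure (S i)) :=
    fun i k hk => internalSigma_mono hD.isContinuousLengthMetric (isOpen_gridSquare U n j k)
      (hopen i) (gridSquare_subset_sdiff_closure hk)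
  have hcn : ∀ ω, ‖c ω‖ ≤ 1 := fun ω => by rcases hc01 ω with h | h <;> simp [h]
  have hcsq : ∀ ω, c ω ^ 2 = c ω := fun ω => by rcases hc01 ω with h | h <;> simp [h]
  have hml : ∀ f : Ω → ℝ≥0∞, Measurable f → MemLp (fun ω => c ω * trunc R (f ω)) 2 P := by
    intro f hf
    refine MemLp.of_bound (((hc.mono hG le_rfl).mul
      ((measurable_trunc R).comp hf)).aestronglyMeasurable) (1 * R) (ae_of_all _ fun ω => ?_)
    rw [norm_mul, Real.norm_of_nonneg (trunc_nonneg _)]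
    exact mul_le_mul (hcn ω) (trunc_le hR _) (trunc_nonneg _) zero_le_one
  -- With the square `i` erased, only squares disjoint from its closure are used, and `D` in these
  -- is determined by `D` outside that closure.
  have hYm : ∀ i, Measurable[G ⊔ internalSigma D (U \ closure (S i))] fun ω =>
      patchedDist Q (r ω) (D ω) S (B.erase i) x y := fun i =>
    measurable_patchedDist (m := G ⊔ internalSigma D (U \ closure (S i))) hQ
      (fun p q => (hr p q).mono le_sup_left le_rfl)
      (fun k hk => (hSW i k (Finset.ne_of_mem_erase hk)).trans le_sup_right) x y
  have hXm : Measurable[G ⊔ ⨆ i ∈ B, internalSigma D (S i)] fun ω =>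
      patchedDist Q (r ω) (D ω) S B x y :=
    measurable_patchedDist (m := G ⊔ ⨆ i ∈ B, internalSigma D (S i)) hQ
      (fun p q => (hr p q).mono le_sup_left le_rfl)
      (fun k hk => le_sup_of_le_right (le_iSup₂ (f := fun i (_ : i ∈ B) => internalSigma D (S i)) k hk)) x y
  have hsup0 : G ⊔ ⨆ i ∈ B, internalSigma D (S i) ≤ m₀ := sup_le hG (iSup₂_le fun i _ => hS0 i)
  have hX0 : MemLp X 2 P := by
    rw [hX]
    exact hml _ ((measurable_eval_comap D (x : U) (y : U)).mono hD0 le_rfl).ennreal_ofReal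
  set X' : Ω → ℝ := fun ω => c ω * trunc R (patchedDist Q (r ω) (D ω) S B x y) with hX'
  set Y : ℤ × ℤ → Ω → ℝ := fun i ω => c ω * trunc R (patchedDist Q (r ω) (D ω) S (B.erase i) x y)
    with hY
  have hX'2 : MemLp X' 2 P := hml _ (hXm.mono hsup0 le_rfl)
  have hY2 : ∀ i, MemLp (Y i) 2 P := fun i =>
    hml _ ((hYm i).mono (sup_le hG (hW0 i)) le_rfl)
  have hES := integral_sq_condExp_sub_le_sum (P := P) B (G := G)
    (a := fun i => internalSigma D (S i)) (n := fun i => G ⊔ internalSigma D (U \ closure (S i)))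
    hS0 (fun i => sup_le hG (hW0 i)) (fun i => le_sup_left)
    (fun i k hk => (hSW i k hk).trans le_sup_right)
    (fun i A hA => hind _ (isOpen_gridSquare U n j i) (gridSquare_subset U n j i) A hA) hX'2
    (Y := Y) (fun i => Measurable.stronglyMeasurable ((hc.mono le_sup_left le_rfl).mul
      ((measurable_trunc R).comp (hYm i)))) hY2
  rw [condExp_of_stronglyMeasurable (f := X') hsup0 (Measurable.stronglyMeasurable
    ((hc.mono le_sup_left le_rfl).mul ((measurable_trunc R).comp hXm)))
    (hX'2.integrable one_le_two)] at hES
  have hf2 : MemLp (X - X') 2 P := hX0.sub hX'2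
  have h1 := integral_sq_sub_condExp_le hG hf2
  have hE : MemLp (P[X' | G]) 2 P := hX'2.condExp one_le_two
  have hEf : MemLp (P[X - X' | G]) 2 P := hf2.condExp one_le_two
  have i1 : Integrable (fun ω => ((X - X') ω - (P[X - X' | G]) ω) ^ 2) P :=
    (hf2.sub hEf).integrable_sq
  have i2 : Integrable (fun ω => (X' ω - (P[X' | G]) ω) ^ 2) P := (hX'2.sub hE).integrable_sq
  -- The factor `2` comes from splitting `X` as `(X - X') + X'`; only `X'` is subject to
  -- Efron-Stein.
  have h2 : ∫ ω, (X ω - (P[X | G]) ω) ^ 2 ∂P ≤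
      2 * (∫ ω, ((X - X') ω - (P[X - X' | G]) ω) ^ 2 ∂P +
        ∫ ω, (X' ω - (P[X' | G]) ω) ^ 2 ∂P) := by
    rw [← integral_add i1 i2, ← integral_const_mul]
    refine integral_mono_ae (hX0.sub (hX0.condExp one_le_two)).integrable_sq
      ((i1.add i2).const_mul 2) ?_
    filter_upwards [condExp_sub (hX0.integrable one_le_two) (hX'2.integrable one_le_two) G]
      with ω hω
    rw [Pi.sub_apply] at hω
    simp only [hω, Pi.sub_apply]
    nlinarith [sq_nonneg ((X ω - X' ω - ((P[X | G]) ω - (P[X' | G]) ω)) -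
      (X' ω - (P[X' | G]) ω))]
  have iY : ∀ i ∈ B, Integrable (fun ω => (X' ω - Y i ω) ^ 2) P := fun i _ =>
    (hX'2.sub (hY2 i)).integrable_sq
  refine ⟨fun ω => (X - X') ω ^ 2 + ∑ i ∈ B, (X' ω - Y i ω) ^ 2,
    hf2.integrable_sq.add (integrable_finsetSum _ iY),
    h2.trans (mul_le_mul_of_nonneg_left ?_ zero_le_two), ?_⟩
  · rw [integral_add hf2.integrable_sq (integrable_finsetSum _ iY), integral_finsetSum _ iY]
    exact add_le_add h1 hES
  · ext ω
    simp only [Pi.sub_apply, hX, hX', hY, ← mul_sub, mul_pow, hcsq, ← Finset.mul_sum, ← mul_add]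

/-- The variance on the left of each grid bound does not depend on the grid, so the bounds can be
averaged over the shifts and passed to the limit. The indicator `c` of a `G`-measurable event
confines the random `K` to a bounded range, as domination requires. -/
theorem ae_eq_condExp_of_tendsto_gridError (hG : G ≤ m₀)
    (hD : IsRandomContinuousLengthMetric D) {Q : Set U} (hQ : Q.Countable) (hQd : Dense Q)
    (hind : ∀ V : Set ℂ, IsOpen V → V ⊆ U → ∀ A, MeasurableSet[internalSigma D V] A →
      P⟦A | G ⊔ internalSigma D (U \ closure V)⟧ =ᵐ[P] P⟦A | G⟧)
    {r : Ω → U → U → ℝ≥0∞} (hr : ∀ p q, Measurable[G] fun ω => r ω p q) {K : Ω → ℝ}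
    (hDr : ∀ᵐ ω ∂P, ∀ p q : Q, ENNReal.ofReal (D ω p q) ≤ r ω p q)
    (hrD : ∀ᵐ ω ∂P, ∀ p q : Q, r ω p q ≤ ENNReal.ofReal (K ω) * ENNReal.ofReal (D ω p q))
    (hK : ∀ ω, 0 ≤ K ω)
    {c : Ω → ℝ} (hc : Measurable[G] c) (hc01 : ∀ ω, c ω = 0 ∨ c ω = 1) {M : ℝ}
    (hcK : ∀ ω, c ω = 1 → K ω ≤ M) {R : ℝ} (hR : 0 ≤ R) (x y : Q) :
    (fun ω => c ω * trunc R (ENNReal.ofReal (D ω x y))) =ᵐ[P]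
      P[fun ω => c ω * trunc R (ENNReal.ofReal (D ω x y)) | G] := by
  set X : Ω → ℝ := fun ω => c ω * trunc R (ENNReal.ofReal (D ω x y)) with hX
  have hXm : Measurable X := (hc.mono hG le_rfl).mul ((measurable_trunc R).comp
    ((measurable_eval_comap D (x : U) (y : U)).mono hD.measurable.comap_le le_rfl).ennreal_ofReal)
  have hX2 : MemLp X 2 P := by
    refine MemLp.of_bound hXm.aestronglyMeasurable R (ae_of_all _ fun ω => ?_)
    rcases hc01 ω with h | h
    · simpa [hX, h] using hR
    · simpa [hX, h, abs_of_nonneg (trunc_nonneg _)] using trunc_le hR _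
  have hle : ∀ n, Integrable (fun ω => c ω * gridError R Q (r ω) (D ω) n x y) P ∧
      ∫ ω, (X ω - (P[X | G]) ω) ^ 2 ∂P ≤
        2 * ∫ ω, c ω * gridError R Q (r ω) (D ω) n x y ∂P := by
    intro n
    choose T hT hTle hTeq using fun j =>
      integral_sq_sub_condExp_le_of_grid hG hD hQ hind hr hc hc01 hR x y n j hX
    have e : (fun ω => c ω * gridError R Q (r ω) (D ω) n x y) =
        fun ω => 1 / ((n : ℝ) + 1) * ∑ j ∈ Finset.range (n + 1), T j ω := by
      ext ω
      simp only [hTeq, gridError]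
      rw [mul_left_comm, Finset.mul_sum]
    rw [e]
    refine ⟨(integrable_finsetSum _ fun j _ => hT j).const_mul _, ?_⟩
    rw [integral_const_mul, integral_finsetSum _ fun j _ => hT j]
    have hs := Finset.sum_le_sum fun j (_ : j ∈ Finset.range (n + 1)) => hTle j
    rw [Finset.sum_const, Finset.card_range, nsmul_eq_mul, ← Finset.mul_sum] at hs
    push_cast at hs
    rw [mul_left_comm, one_div, ← div_eq_inv_mul, le_div_iff₀ (by positivity)]
    linarith
  have hlim : Filter.Tendsto (fun n => ∫ ω, c ω * gridError R Q (r ω) (D ω) n x y ∂P)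
      Filter.atTop (nhds (∫ _, (0 : ℝ) ∂P)) := by
    refine tendsto_integral_of_dominated_convergence (fun _ => (R + |M| * R) * R)
      (fun n => (hle n).1.aestronglyMeasurable) (integrable_const _) (fun n => ?_) ?_
    · filter_upwards [hDr, hrD] with ω h1 h2
      rcases hc01 ω with h | h
      · rw [h, zero_mul, norm_zero]
        positivity
      · rw [h, one_mul, Real.norm_of_nonneg (gridError_nonneg _ _ _ _)]
        refine (gridError_le hR (hK ω) (hD.isContinuousLengthMetric ω) h1 h2 n x y).trans ?_
        have := (hcK ω h).trans (le_abs_self M)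
        gcongr
    · filter_upwards [hDr, hrD] with ω h1 h2
      simpa using (tendsto_gridError hR (hK ω) (hD.isContinuousLengthMetric ω) hQd h1 h2
        x y).const_mul (c ω)
  have h0 : ∫ ω, (X ω - (P[X | G]) ω) ^ 2 ∂P = 0 := by
    refine le_antisymm ?_ (integral_nonneg fun _ => sq_nonneg _)
    refine ge_of_tendsto' (f := fun n => 2 * ∫ ω, c ω * gridError R Q (r ω) (D ω) n x y ∂P)
      (by simpa using hlim.const_mul 2) fun n => (hle n).2
  rw [integral_eq_zero_iff_of_nonneg (f := fun ω => (X ω - (P[X | G]) ω) ^ 2) (fun _ => sq_nonneg _)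
    (hX2.sub (hX2.condExp one_le_two)).integrable_sq] at h0
  filter_upwards [h0] with ω hω
  exact sub_eq_zero.1 (pow_eq_zero_iff two_ne_zero |>.1 hω)

end Resampling

theorem IsContinuousMetric.tendsto {X : Type*} [TopologicalSpace X] {d : X → X → ℝ}
    (hd : IsContinuousMetric d) {x y : X} {u v : ℕ → X}
    (hu : Filter.Tendsto u Filter.atTop (nhds x)) (hv : Filter.Tendsto v Filter.atTop (nhds y)) :
    Filter.Tendsto (fun n => d (u n) (v n)) Filter.atTop (nhds (d x y)) := by
  let _ := hd.toPseudoMetricSpace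
  exact hu.dist hv

/-! ### Measurability of the distances with respect to the field. -/

section Main

variable {Ω : Type*} [MeasurableSpace Ω] {P : Measure Ω} [IsProbabilityMeasure P] {U : Opens ℂ}
  {h : Ω → 𝓓'(U, ℝ)} {D Dt : Ω → U → U → ℝ}

theorem IsCondIIDGiven.ae_le_mul_of_ae_le_mul
    (hiid : IsCondIIDGiven (MeasurableSpace.comap h inferInstance) P D Dt) (hh : Measurable h)
    (hD : Measurable D) (hDt : Measurable Dt) {C : 𝓓'(U, ℝ) → ℝ} (hC : Measurable C)
    (hle : ∀ᵐ ω ∂P, ∀ z w : U, Dt ω z w ≤ C (h ω) * D ω z w) (z w : U) :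
    ∀ᵐ ω ∂P, D ω z w ≤ C (h ω) * Dt ω z w := by
  refine hiid.ae_swap (c := fun ω => C (h ω)) (u := fun d => d z w)
    (E := {t | t.2.2 ≤ t.1 * t.2.1}) hh.comap_le hD hDt (hC.comp (comap_measurable h))
    (by fun_prop) ?_ ?_
  · exact measurableSet_le (by fun_prop) (by fun_prop)
  · filter_upwards [hle] with ω hω
    exact hω z w

/-- The distance of two points is measurable with respect to the field. -/
theorem exists_measurable_ae_eq (hh : IsGFF P h) (hD : IsRandomContinuousLengthMetric D)
    (hDt : IsRandomContinuousLengthMetric Dt) (hlocal : IsLocalMetric P h D)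
    (hiid : IsCondIIDGiven (MeasurableSpace.comap h inferInstance) P D Dt) {C : 𝓓'(U, ℝ) → ℝ}
    (hC : Measurable C) (hC1 : ∀ T, 1 < C T)
    (hle : ∀ᵐ ω ∂P, ∀ z w : U, Dt ω z w ≤ C (h ω) * D ω z w) {Q : Set U} (hQ : Q.Countable)
    (hQd : Dense Q) (x y : Q) :
    ∃ f : 𝓓'(U, ℝ) → ℝ, Measurable f ∧ ∀ᵐ ω ∂P, D ω x y = f (h ω) := by
  have hhm := hh.isCenteredGaussianDistribution.measurable
  have hh0 := hhm.comap_le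
  have hD0 := hD.measurable.comap_le
  have ht0 := hDt.measurable.comap_le
  have := hQ.to_subtype
  have hDr : ∀ᵐ ω ∂P, ∀ p q : Q, ENNReal.ofReal (D ω p q) ≤
      ENNReal.ofReal (C (h ω) * Dt ω p q) := by
    refine ae_all_iff.2 fun p => ae_all_iff.2 fun q => ?_
    filter_upwards [hiid.ae_le_mul_of_ae_le_mul hhm hD.measurable hDt.measurable hC hle p q]
      with ω hω
    exact ENNReal.ofReal_le_ofReal hω
  have hrD : ∀ᵐ ω ∂P, ∀ p q : Q, ENNReal.ofReal (C (h ω) * Dt ω p q) ≤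
      ENNReal.ofReal (C (h ω) ^ 2) * ENNReal.ofReal (D ω p q) := by
    filter_upwards [hle] with ω hω p q
    rw [← ENNReal.ofReal_mul (sq_nonneg _), pow_two, mul_assoc]
    exact ENNReal.ofReal_le_ofReal (mul_le_mul_of_nonneg_left (hω p q)
      (zero_le_one.trans (hC1 _).le))
  have hCh : Measurable[MeasurableSpace.comap h inferInstance] fun ω => C (h ω) :=
    hC.comp (comap_measurable h)
  have hr : ∀ p q : U, Measurable[MeasurableSpace.comap h inferInstance ⊔
      MeasurableSpace.comap Dt inferInstance] fun ω => ENNReal.ofReal (C (h ω) * Dt ω p q) :=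
    fun p q => ((hCh.mono le_sup_left le_rfl).mul
      ((measurable_eval_comap Dt p q).mono le_sup_right le_rfl)).ennreal_ofReal
  -- The same `k` bounds the constant `C` and truncates the distance.
  let c : ℕ → Ω → ℝ := fun k => {ω | C (h ω) ≤ k}.indicator fun _ => 1
  have hc : ∀ k, Measurable[MeasurableSpace.comap h inferInstance] (c k) := fun k =>
    Measurable.indicator measurable_const (measurableSet_le hCh measurable_const)
  have hc01 : ∀ k ω, c k ω = 0 ∨ c k ω = 1 := fun k ω => by
    by_cases hω : C (h ω) ≤ k <;> simp [c, hω]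
  have hcK : ∀ k ω, c k ω = 1 → C (h ω) ^ 2 ≤ (k : ℝ) ^ 2 := fun k ω hω => by
    by_cases hω' : C (h ω) ≤ k
    · have := hC1 (h ω)
      gcongr
    · simp [c, hω'] at hω
  let X : ℕ → Ω → ℝ := fun k ω => c k ω * trunc k (ENNReal.ofReal (D ω x y))
  have hX : ∀ k, X k =ᵐ[P] P[X k | MeasurableSpace.comap h inferInstance] := by
    intro k
    have h1 : X k =ᵐ[P] _ := ae_eq_condExp_of_tendsto_gridError (sup_le hh0 ht0) hD hQ hQd
      (fun V hV hVU A hA => hlocal.condExp_sup_internalSigma hh hD hDt.measurable hiid.indep hV hVU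
        hA) hr hDr hrD (fun ω => sq_nonneg _) ((hc k).mono le_sup_left le_rfl) (hc01 k) (hcK k)
      k.cast_nonneg x y
    have hXm : Measurable[MeasurableSpace.comap h inferInstance ⊔
        MeasurableSpace.comap D inferInstance] (X k) :=
      ((hc k).mono le_sup_left le_rfl).mul ((measurable_trunc _).comp
        ((measurable_eval_comap D (x : U) (y : U)).mono le_sup_right le_rfl).ennreal_ofReal)
    have hX2 : MemLp (X k) 2 P := by
      refine MemLp.of_bound (hXm.mono (sup_le hh0 hD0) le_rfl).aestronglyMeasurable k
        (ae_of_all _ fun ω => ?_)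
      rcases hc01 k ω with h0 | h0
      · simp [X, h0]
      · simpa [X, h0, abs_of_nonneg (trunc_nonneg _)] using trunc_le k.cast_nonneg _
    -- This removes `Dt` from the conditioning: given `h` and `D`, the law of `Dt` depends on `h`
    -- only.
    exact h1.trans (condExp_sup_eq_of_indep (sup_le hh0 hD0) le_rfl le_sup_left ht0
      (fun A hA => hiid.indep.symm.condExp_sup hh0 ht0 hD0 hA) hXm.stronglyMeasurable hX2)
  -- For each `ω`, `X k ω` equals `D ω x y` as soon as `k` exceeds both `C (h ω)` and the distance,
  -- so the upper limit recovers the distance.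
  have hg : Measurable[MeasurableSpace.comap h inferInstance] fun ω => Filter.limsup (fun k =>
      (P[X k | MeasurableSpace.comap h inferInstance]) ω) Filter.atTop :=
    Measurable.limsup fun k => stronglyMeasurable_condExp.measurable
  obtain ⟨f, hf, hfg⟩ := hg.exists_eq_measurable_comp
  refine ⟨f, hf, ?_⟩
  filter_upwards [ae_all_iff.2 hX] with ω hω
  change _ = (f ∘ h) ω
  rw [← hfg]
  simp_rw [← hω]
  refine (Filter.Tendsto.limsup_eq (tendsto_const_nhds.congr' ?_)).symm
  have hd0 : 0 ≤ D ω x y := by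
    have hd := hD.isContinuousLengthMetric ω
    have := hd.triangle x y x
    rw [hd.dist_self, hd.symm y x] at this
    linarith
  filter_upwards [tendsto_natCast_atTop_atTop.eventually_ge_atTop (C (h ω)),
    tendsto_natCast_atTop_atTop.eventually_ge_atTop (D ω x y)] with k h1 h2
  simp [X, c, h1, trunc_ofReal hd0 k.cast_nonneg, h2]

end Main

end LocalMetrics

open LocalMetrics
theorem theorem1p6 {Ω : Type*} [MeasurableSpace Ω] (P : Measure Ω) [IsProbabilityMeasure P]
    (U : Opens ℂ) (hU : IsConnected (U : Set ℂ))
    (h : Ω → 𝓓'(U, ℝ)) (hh : IsGFF P h)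
    (D Dt : Ω → U → U → ℝ)
    (hD : IsRandomContinuousLengthMetric D) (hDt : IsRandomContinuousLengthMetric Dt)
    (hlocal : IsLocalMetric P h D)
    (hiid : IsCondIIDGiven (MeasurableSpace.comap h inferInstance) P D Dt)
    (hbilip : ∃ C : 𝓓'(U, ℝ) → ℝ, Measurable C ∧ (∀ T, 1 < C T) ∧
      ∀ᵐ ω ∂P, ∀ z w : U, Dt ω z w ≤ C (h ω) * D ω z w) :
    (∃ F : 𝓓'(U, ℝ) → U → U → ℝ, Measurable F ∧ ∀ᵐ ω ∂P, D ω = F (h ω)) ∧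
      ∀ᵐ ω ∂P, ∀ z w : U, Dt ω z w ≤ D ω z w := by
  obtain ⟨C, hC, hC1, hle⟩ := hbilip
  have hhm := hh.isCenteredGaussianDistribution.measurable
  obtain ⟨Q, hQ, hQd⟩ := exists_countable_dense U
  have := hQ.to_subtype
  choose f hf hDf using fun x y : Q =>
    exists_measurable_ae_eq hh hD hDt hlocal hiid hC hC1 hle hQ hQd x y
  -- Exchangeability transfers the a.s. identity from `D` to `Dt` with the same function `f` of the
  -- field.
  have hDtf : ∀ x y : Q, ∀ᵐ ω ∂P, f x y (h ω) = Dt ω x y := fun x y =>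
    hiid.ae_swap (c := fun ω => f x y (h ω)) (u := fun d => d x y) (E := {t | t.1 = t.2.1})
      hhm.comap_le hD.measurable hDt.measurable ((hf x y).comp (comap_measurable h))
      (by fun_prop) (measurableSet_eq_fun (by fun_prop) (by fun_prop))
      ((hDf x y).mono fun ω hω => hω.symm)
  -- The approximating sequences do not depend on `ω`, so the distances of all pairs of points are
  -- recovered on one almost sure event.
  choose s hs hsx using fun x : U => mem_closure_iff_seq_limit.1 (hQd x)
  let q : U → ℕ → Q := fun x n => ⟨s x n, hs x n⟩
  have hlim : ∀ {d : U → U → ℝ}, IsContinuousLengthMetric d → ∀ x y : U,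
      Filter.Tendsto (fun n => d (q x n) (q y n)) Filter.atTop (nhds (d x y)) :=
    fun hd x y => hd.toIsContinuousMetric.tendsto (hsx x) (hsx y)
  have hDf' := ae_all_iff.2 fun x => ae_all_iff.2 fun y => hDf x y
  refine ⟨⟨fun T x y => Filter.limsup (fun n => f (q x n) (q y n) T) Filter.atTop, ?_, ?_⟩, ?_⟩
  · exact measurable_pi_iff.2 fun x => measurable_pi_iff.2 fun y =>
      Measurable.limsup fun n => hf _ _
  · filter_upwards [hDf'] with ω hω
    ext x y
    simp_rw [← hω]
    exact (hlim (hD.isContinuousLengthMetric ω) x y).limsup_eq.symm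
  · filter_upwards [hDf', ae_all_iff.2 fun x => ae_all_iff.2 fun y => hDtf x y] with ω h1 h2 z w
    refine le_of_tendsto_of_tendsto' (hlim (hDt.isContinuousLengthMetric ω) z w)
      (hlim (hD.isContinuousLengthMetric ω) z w) fun n => ?_
    rw [h1, h2]
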